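/- Let $\Sigma$ be a finite alphabet. A transduction is a partial function $f:\Sigma^*\rightharpoonup\Sigma^*$. A bimachine $B=(\mathcal L,\mathcal R,\omega,\lambda,\rho)$ consists of a finite deterministic left automaton $\mathcal L$ (reading words from left to right) and a finite deterministic right automaton $\mathcal R$ (reading words from right to left) recognizing the same language, an output function $\omega:Q_{\mathcal L}\times\Sigma\times Q_{\mathcal R}\to\Sigma^*$, and final functions $\lambda:F_{\mathcal R}\to\Sigma^*$, $\rho:F_{\mathcal L}\to\Sigma^*$. It realizes the transduction whose domain is this language and which maps $u$ to $\lambda(r)\,\omega(l_0,u,r_0)\,\rho(l)$, where $l_0,r_0$ are the initial states, $l,r$ are the states reached by $\mathcal L,\mathcal R$ on $u$, and $\omega$ is extended to words by $\omega(l,\epsilon,r)=\epsilon$ and $\omega(l,uv,r)=\omega(l,u,r')\,\omega(l',v,r)$, with $l'$ reached from $l$ by reading $u$ and $r'$ reached from $r$ by reading $v$ from right to left. For an automaton $\mathcal A$, write $u\sim_{\mathcal A}v$ if $u$ and $v$ lead from the initial state to the same state (or both have no run), and write $\mathcal A\sqsubseteq\mathcal A'$ if ${\sim_{\mathcal A}}\subseteq{\sim_{\mathcal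 A'}}$. Write $B\sqsubseteq B'$ if $\mathcal L\sqsubseteq\mathcal L'$ and $\mathcal R\sqsubseteq\mathcal R'$. A bimachine $B$ realizing $f$ is minimal if every bimachine $B'$ realizing $f$ with $B\sqsubseteq B'$ satisfies $B'\sqsubseteq B$. Bimachines $B,B'$ are equal up to state renaming and output shifting if $B\sqsubseteq B'$, $B'\sqsubseteq B$ and they realize the same transduction. The canonical right automaton $\mathcal R_f$ (possibly infinite for a general $f$) has as states the classes of the left congruence: $u\leftharpoonup_f v$ iff for all $w$, $wu\in\mathrm{dom} f\Leftrightarrow wv\in\mathrm{dom} f$, and $\sup\{d(f(wu),f(wv)) : wu\in\mathrm{dom} f\}<\infty$, where $d(x,y)=|x|+|y|-2|x\wedge y|$ and $x\wedge y$ is the longest common prefix. Reading $\sigma$ leads from the class of $w$ to the class of $\sigma w$. For a right automaton $\mathcal R$, $\mathrm{Left}_f(\mathcal R)$ is the left automaton whose states are the classes of the right congruence: $u\sim_L v$ iff for all $w$, $uw\in\mathrm{dom} f\Leftrightarrow vw\in\mathrm{dom} f$ and, if $uw\in\mathrm{dom} f$, $\hat f_w(u)^{-1}f(uw)=\hat f_w(v)^{-1}f(vw)$,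 where $\hat f_w(u)$ is the longest common prefix of all $f(uz)$ with $z\sim_{\mathcal R}w$, $uz\in\mathrm{dom} f$. Reading $\sigma$ leads from the class of $w$ to the class of $w\sigma$. In both automata the initial state is the class of $\epsilon$ and the final states are the classes of the words of $\mathrm{dom} f$. The left automaton $\mathcal L_f$ and the right automaton $\mathrm{Right}_f(\mathcal L)$ are defined symmetrically. **Theorem.** Let $f$ be a transduction over $\Sigma$. 1. The set of minimal bimachines realizing $f$ is finite up to state renaming and output shifting. 2. Every minimal bimachine $(\mathcal L,\mathcal R,\omega,\lambda,\rho)$ realizing $f$ satisfies $\mathrm{Left}_f(\mathcal R_f)\sqsubseteq\mathcal L\sqsubseteq\mathcal L_f$ and $\mathrm{Right}_f(\mathcal L_f)\sqsubseteq\mathcal R\sqsubseteq\mathcal R_f$. 3. There is an algorithm which, given a (nondeterministic, functional) finite transducer realizing $f$, whose transitions read one letter each and output a word, and whose initial and final states also have output words, computes a finite list of minimal bimachines realizing $f$ that contains exactly one representative of each class of minimal bimachines realizing $f$ up to state renaming and output shifting. There is likewise such an algorithm when $f$ is given by a bimachine realizing it. -/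

import Mathlib

namespace RatTrans

/-! ### Longest common prefixes and the prefix distance -/

section Words

variable {α : Type}

/-- `p` is the longest common prefix of all the words of `S`. -/
def IsLcp (S : Set (List α)) (p : List α) : Prop :=
  (∀ s ∈ S, p <+: s) ∧ ∀ q : List α, (∀ s ∈ S, q <+: s) → q <+: p

open Classical in
/-- The longest common prefix of a set of words; it is the empty word for the empty set. -/
noncomputable def lcp (S : Set (List α)) : List α :=
  if h : S.Nonempty ∧ ∃ p, IsLcp S p then h.2.choose else []

theorem exists_isLcp {S : Set (List α)} (hS : S.Nonempty) : ∃ p, IsLcp S p := by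
  classical
  obtain ⟨s₀, hs₀⟩ := hS
  let P : ℕ → Prop := fun n => ∃ p : List α, p.length = n ∧ ∀ s ∈ S, p <+: s
  have h0 : P 0 := ⟨[], rfl, fun s _ => List.nil_prefix⟩
  have hmax := Nat.findGreatest_spec (P := P) (Nat.zero_le s₀.length) h0
  obtain ⟨p, hp, hpS⟩ := hmax
  refine ⟨p, hpS, fun q hq => ?_⟩
  have hqn : q.length ≤ p.length := by
    rw [hp]
    exact Nat.le_findGreatest (hq s₀ hs₀).length_le ⟨q, rfl, hq⟩
  exact List.prefix_of_prefix_length_le (hq s₀ hs₀) (hpS s₀ hs₀) hqn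

theorem lcp_isLcp {S : Set (List α)} (hS : S.Nonempty) : IsLcp S (lcp S) := by
  have h : S.Nonempty ∧ ∃ p, IsLcp S p := ⟨hS, exists_isLcp hS⟩
  unfold lcp
  rw [dif_pos h]
  exact h.2.choose_spec

theorem IsLcp.unique {S : Set (List α)} {p q : List α} (hp : IsLcp S p) (hq : IsLcp S q) :
    p = q :=
  (hq.2 p hp.1).eq_of_length_le (hp.2 q hq.1).length_le

theorem lcp_append {S : Set (List α)} (hS : S.Nonempty) (x : List α) :
    lcp ((fun s => x ++ s) '' S) = x ++ lcp S := by
  have h := lcp_isLcp hS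
  refine (lcp_isLcp (hS.image _)).unique ⟨?_, ?_⟩
  · rintro _ ⟨s, hs, rfl⟩
    exact (List.prefix_append_right_inj x).2 (h.1 s hs)
  · intro q hq
    obtain ⟨s₀, hs₀⟩ := hS
    have hq₀ : q <+: x ++ s₀ := hq _ ⟨s₀, hs₀, rfl⟩
    rcases le_total q.length x.length with hl | hl
    · exact (List.prefix_of_prefix_length_le hq₀ (List.prefix_append x s₀) hl).trans
        (List.prefix_append _ _)
    · obtain ⟨q', rfl⟩ := List.prefix_of_prefix_length_le (List.prefix_append x s₀) hq₀ hl
      refine (List.prefix_append_right_inj x).2 (h.2 q' fun s hs => ?_)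
      exact (List.prefix_append_right_inj x).1 (hq _ ⟨s, hs, rfl⟩)

/-- The prefix distance `|u| + |v| - 2 |u ∧ v|`. The subtraction is never truncated. -/
noncomputable def prefixDist (u v : List α) : ℕ :=
  u.length + v.length - 2 * (lcp {u, v}).length

theorem lcp_pair (u v : List α) : IsLcp {u, v} (lcp {u, v}) := lcp_isLcp ⟨u, by simp⟩

theorem prefixDist_self (u : List α) : prefixDist u u = 0 := by
  have h := (lcp_pair u u).2 u (by simp)
  have := h.length_le
  unfold prefixDist
  omega

theorem prefixDist_comm (u v : List α) : prefixDist u v = prefixDist v u := by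
  unfold prefixDist
  rw [Set.pair_comm, Nat.add_comm]

theorem prefixDist_triangle (x y z : List α) :
    prefixDist x z ≤ prefixDist x y + prefixDist y z := by
  have h1 := lcp_pair x y
  have h2 := lcp_pair y z
  have h3 := lcp_pair x z
  have a1 := h1.1 x (by simp)
  have a2 := h1.1 y (by simp)
  have b1 := h2.1 y (by simp)
  have b2 := h2.1 z (by simp)
  have c1 := (h3.1 x (by simp)).length_le
  have c2 := (h3.1 z (by simp)).length_le
  have l1 := a1.length_le
  have l2 := a2.length_le
  have l3 := b1.length_le
  have l4 := b2.length_le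
  have key : min (lcp {x, y}).length (lcp {y, z}).length ≤ (lcp {x, z}).length := by
    rcases le_total (lcp {x, y}).length (lcp {y, z}).length with hl | hl
    · rw [min_eq_left hl]
      refine (h3.2 _ ?_).length_le
      rintro s (rfl | rfl)
      · exact a1
      · exact (List.prefix_of_prefix_length_le a2 b1 hl).trans b2
    · rw [min_eq_right hl]
      refine (h3.2 _ ?_).length_le
      rintro s (rfl | rfl)
      · exact (List.prefix_of_prefix_length_le b1 a2 hl).trans a1
      · exact b2
  unfold prefixDist
  omega

end Words

/-! ### Deterministic automata -/

/-- A deterministic (possibly incomplete) automaton with a single initial state. The state set is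
required to be finite only where the automaton is part of a machine.

The same structure serves for left and for right automata: a left automaton reads a word from left
to right, a right automaton reads it from right to left. So a left automaton on `u` is in the state
`A.run u`, a right automaton on `u` is in the state `A.run u.reverse`; for a right automaton,
`A.step r a = some r'` is the backward deterministic transition `(r', a, r)`. -/
structure DetAut (α Q : Type) where
  start : Q
  step : Q → α → Option Q
  accept : Set Q

namespace DetAut

variable {α Q Q' : Type}

/-- The state reached from `q` after reading a word, if there is a run. -/
def runFrom (A : DetAut α Q) : Q → List α → Option Q
  | q, [] => some q
  | q, a :: w => (A.step q a).bind fun q' => A.runFrom q' w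

/-- The state reached from the initial state after reading a word, if there is a run. -/
def run (A : DetAut α Q) (w : List α) : Option Q := A.runFrom A.start w

/-- There is an accepting run over `w` (read from left to right). -/
def Accepts (A : DetAut α Q) (w : List α) : Prop := ∃ q ∈ A.accept, A.run w = some q

/-- `A` is finer than `A'`: the transition congruence of `A`, which relates `u` and `v` if
`∀ q, A.run u = some q ↔ A.run v = some q`, is contained in that of `A'`. Since reversal is a
bijection on words, this is also the relation between `A` and `A'` as right automata. -/
def Finer (A : DetAut α Q) (A' : DetAut α Q') : Prop :=
  ∀ u v : List α, A.run u = A.run v → A'.run u = A'.run v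

theorem runFrom_append (A : DetAut α Q) (q : Q) (u v : List α) :
    A.runFrom q (u ++ v) = (A.runFrom q u).bind fun q' => A.runFrom q' v := by
  induction u generalizing q with
  | nil => simp [runFrom]
  | cons a u ih =>
    simp only [List.cons_append, runFrom]
    cases A.step q a with
    | none => rfl
    | some q' => simpa using ih q'

end DetAut

/-! ### Bimachines -/

/-- A bimachine over `α`: a finite left automaton and a finite right automaton which recognize the
same language, an output function, a left final function `lam` on the final states of the right
automaton and a right final function `rho` on the final states of the left automaton. -/
structure Bimachine (α : Type) where
  L : Type
  R : Type
  finite_L : Finite L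
  finite_R : Finite R
  left : DetAut α L
  right : DetAut α R
  out : L → α → R → List α
  lam : right.accept → List α
  rho : left.accept → List α
  same_language : ∀ u : List α, left.Accepts u ↔ right.Accepts u.reverse

namespace Bimachine

variable {α : Type}

/-- The extension of the output function to words:
`out(l, a v, r) = out(l, a, r') out(l', v, r)` where the left automaton goes from `l` to `l'` by
reading `a` and the right automaton goes from `r` to `r'` by reading `v` from right to left. It is
defined whenever the two automata have runs. -/
def outWord (B : Bimachine α) : B.L → List α → B.R → Option (List α)
  | _, [], _ => some []
  | l, a :: v, r =>
    (B.left.step l a).bind fun l' =>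
      (B.right.runFrom r v.reverse).bind fun r' =>
        (B.outWord l' v r).map fun w => B.out l a r' ++ w

/-- The graph of the transduction realized by a bimachine. -/
def sem (B : Bimachine α) : Set (List α × List α) :=
  {p | ∃ (l : B.left.accept) (r : B.right.accept) (w : List α),
    B.left.run p.1 = some l.1 ∧ B.right.run p.1.reverse = some r.1 ∧
    B.outWord B.left.start p.1 B.right.start = some w ∧
    p.2 = B.lam r ++ w ++ B.rho l}

/-- The bimachine realizes the transduction (partial function) `f`. -/
def Realizes (B : Bimachine α) (f : List α →. List α) : Prop := B.sem = f.graph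

/-- `B` is finer than `B'`: its left and its right automaton are finer than those of `B'`. -/
def Finer (B B' : Bimachine α) : Prop := B.left.Finer B'.left ∧ B.right.Finer B'.right

/-- `B` is a minimal bimachine realizing `f`: no bimachine realizing `f` is strictly coarser. -/
def IsMinimal (B : Bimachine α) (f : List α →. List α) : Prop :=
  B.Realizes f ∧ ∀ B' : Bimachine α, B'.Realizes f → B.Finer B' → B'.Finer B

/-- Equality up to state renaming and output shifting: each of the two bimachines is finer than
the other, and they realize the same transduction. -/
def Equiv (B B' : Bimachine α) : Prop := B.Finer B' ∧ B'.Finer B ∧ B.sem = B'.sem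

theorem Finer.refl (B : Bimachine α) : B.Finer B := ⟨fun _ _ h => h, fun _ _ h => h⟩

theorem Finer.trans {B B' B'' : Bimachine α} (h : B.Finer B') (h' : B'.Finer B'') :
    B.Finer B'' :=
  ⟨fun u v e => h'.1 u v (h.1 u v e), fun u v e => h'.2 u v (h.2 u v e)⟩

/-- Equality up to state renaming and output shifting is an equivalence relation. -/
def equivSetoid (α : Type) : Setoid (Bimachine α) where
  r := Equiv
  iseqv :=
    { refl := fun B => ⟨Finer.refl B, Finer.refl B, rfl⟩
      symm := fun h => ⟨h.2.1, h.1, h.2.2.symm⟩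
      trans := fun h h' => ⟨h.1.trans h'.1, h'.2.1.trans h.2.1, h.2.2.trans h'.2.2⟩ }

end Bimachine

/-! ### Transducers -/

/-- A finite (nondeterministic, real-time) transducer over `α`, with outputs on the transitions, on
the initial states and on the final states of the underlying automaton. -/
structure Transducer (α : Type) where
  Q : Type
  finite_Q : Finite Q
  aut : NFA α Q
  out : (p : Q) → (a : α) → aut.step p a → List α
  initOut : aut.start → List α
  finalOut : aut.accept → List α

namespace Transducer

variable {α : Type}

/-- `T.Run p u v q`: there is a run from `p` to `q` over `u` whose transitions output `v`. -/
inductive Run (T : Transducer α) : T.Q → List α → List α → T.Q → Prop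
  | nil (p : T.Q) : Run T p [] [] p
  | cons {p : T.Q} {a : α} (q : T.aut.step p a) {u v : List α} {r : T.Q}
      (h : Run T q.1 u v r) : Run T p (a :: u) (T.out p a q ++ v) r

/-- The set of pairs realized by a transducer. -/
def sem (T : Transducer α) : Set (List α × List α) :=
  {x | ∃ (p : T.aut.start) (q : T.aut.accept) (v : List α),
    T.Run p.1 x.1 v q.1 ∧ x.2 = T.initOut p ++ v ++ T.finalOut q}

/-- The transducer realizes the transduction (partial function) `f`; it is then functional. -/
def Realizes (T : Transducer α) (f : List α →. List α) : Prop := T.sem = f.graph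

end Transducer

/-! ### Minimization with respect to one automaton, and the canonical automata -/

section Canonical

variable {α : Type}

/-- The mirror image of a transduction: `mirror f (u.reverse)` is `(f u).reverse`. It exchanges
left and right, and serves to define the symmetric version of a notion. -/
def mirror (f : List α →. List α) : List α →. List α :=
  fun u => (f u.reverse).map List.reverse

/-- The longest common prefix of all the words `f (u v)`, where `u v` is in the domain of `f` and
`v` leads the right automaton `A` to the same state as `w`. -/
noncomputable def hat {Q : Type} (f : List α →. List α) (A : DetAut α Q) (w u : List α) :
    List α :=
  lcp {s | ∃ v : List α, A.run v.reverse = A.run w.reverse ∧ s ∈ f (u ++ v)}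

/-- The right congruence whose classes are the states of the left minimization: `u` and `v` are
related if for every `w`, `u w ∈ dom f ↔ v w ∈ dom f`, and in this case `f (u w)` and `f (v w)` are
equal after removal of their prefixes `hat f A w u` and `hat f A w v`. -/
def MinRel {Q : Type} (f : List α →. List α) (A : DetAut α Q) (u v : List α) : Prop :=
  ∀ w : List α, ((f (u ++ w)).Dom ↔ (f (v ++ w)).Dom) ∧
    ∀ x ∈ f (u ++ w), ∀ y ∈ f (v ++ w),
      x.drop (hat f A w u).length = y.drop (hat f A w v).length

/-- `MinRel` as an equivalence relation. -/
def minSetoid {Q : Type} (f : List α →. List α) (A : DetAut α Q) : Setoid (List α) where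
  r := MinRel f A
  iseqv :=
    { refl := fun u w => ⟨Iff.rfl, fun x hx y hy => by rw [Part.mem_unique hx hy]⟩
      symm := fun h w => ⟨(h w).1.symm, fun x hx y hy => ((h w).2 y hy x hx).symm⟩
      trans := fun {u v t} h h' w => ⟨(h w).1.trans (h' w).1, fun x hx y hy => by
        have hd : (f (v ++ w)).Dom := (h w).1.1 (Part.dom_iff_mem.2 ⟨x, hx⟩)
        obtain ⟨z, hz⟩ := Part.dom_iff_mem.1 hd
        exact ((h w).2 x hx z hz).trans ((h' w).2 z hz y hy)⟩ }

theorem run_reverse_cons {Q : Type} (A : DetAut α Q) {v w : List α} (a : α)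
    (h : A.run v.reverse = A.run w.reverse) :
    A.run (a :: v).reverse = A.run (a :: w).reverse := by
  unfold DetAut.run at *
  rw [List.reverse_cons, List.reverse_cons, A.runFrom_append, A.runFrom_append, h]

theorem hat_congr {Q : Type} (f : List α →. List α) (A : DetAut α Q) {v w : List α}
    (h : A.run v.reverse = A.run w.reverse) (u : List α) : hat f A v u = hat f A w u := by
  unfold hat
  rw [h]

theorem hat_prefix {Q : Type} (f : List α →. List α) (A : DetAut α Q) {v w u x : List α}
    (h : A.run v.reverse = A.run w.reverse) (hx : x ∈ f (u ++ v)) : hat f A w u <+: x :=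
  (lcp_isLcp (S := {s | ∃ v : List α, A.run v.reverse = A.run w.reverse ∧ s ∈ f (u ++ v)})
    ⟨x, v, h, hx⟩).1 x ⟨v, h, hx⟩

/-- The words that are left after removal of the common prefix at the previous position. -/
theorem hat_snoc {Q : Type} (f : List α →. List α) (A : DetAut α Q) (u w : List α) (a : α)
    (hd : (f (u ++ [a] ++ w)).Dom) :
    hat f A w (u ++ [a]) = hat f A (a :: w) u ++
      lcp {t | ∃ v x : List α, A.run v.reverse = A.run w.reverse ∧ x ∈ f (u ++ a :: v) ∧
        t = x.drop (hat f A (a :: w) u).length} := by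
  obtain ⟨x₀, hx₀⟩ := Part.dom_iff_mem.1 hd
  rw [← lcp_append]
  · unfold hat
    congr 1
    ext s
    constructor
    · rintro ⟨v, hv, hs⟩
      have hs' : s ∈ f (u ++ a :: v) := by simpa using hs
      refine ⟨_, ⟨v, s, hv, hs', rfl⟩, ?_⟩
      exact List.prefix_iff_eq_append.1 (hat_prefix f A (run_reverse_cons A a hv) hs')
    · rintro ⟨_, ⟨v, x, hv, hx, rfl⟩, rfl⟩
      refine ⟨v, hv, ?_⟩
      have e := List.prefix_iff_eq_append.1 (hat_prefix f A (run_reverse_cons A a hv) hx)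
      unfold hat at e
      simp only [e]
      simpa using hx
  · exact ⟨_, w, x₀, rfl, by simpa using hx₀, rfl⟩

theorem MinRel.snoc {Q : Type} {f : List α →. List α} {A : DetAut α Q} {u v : List α}
    (h : MinRel f A u v) (a : α) : MinRel f A (u ++ [a]) (v ++ [a]) := by
  intro w
  have hdom : (f (u ++ [a] ++ w)).Dom ↔ (f (v ++ [a] ++ w)).Dom := by simpa using (h (a :: w)).1
  refine ⟨hdom, fun x hx y hy => ?_⟩
  rw [hat_snoc f A u w a (Part.dom_iff_mem.2 ⟨x, hx⟩),
    hat_snoc f A v w a (Part.dom_iff_mem.2 ⟨y, hy⟩), List.length_append, List.length_append,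
    ← List.drop_drop, ← List.drop_drop,
    (h (a :: w)).2 x (by simpa using hx) y (by simpa using hy)]
  congr 3
  ext t
  constructor
  · rintro ⟨z, s, hz, hs, rfl⟩
    obtain ⟨s', hs'⟩ := Part.dom_iff_mem.1 ((h (a :: z)).1.1 (Part.dom_iff_mem.2 ⟨s, hs⟩))
    refine ⟨z, s', hz, hs', ?_⟩
    have e := (h (a :: z)).2 s hs s' hs'
    rwa [hat_congr f A (run_reverse_cons A a hz), hat_congr f A (run_reverse_cons A a hz)] at e
  · rintro ⟨z, s, hz, hs, rfl⟩
    obtain ⟨s', hs'⟩ := Part.dom_iff_mem.1 ((h (a :: z)).1.2 (Part.dom_iff_mem.2 ⟨s, hs⟩))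
    refine ⟨z, s', hz, hs', ?_⟩
    have e := (h (a :: z)).2 s' hs' s hs
    rw [hat_congr f A (run_reverse_cons A a hz), hat_congr f A (run_reverse_cons A a hz)] at e
    exact e.symm

/-- The left automaton `Left_f(A)` of the left minimization with respect to a right automaton `A`:
its states are the classes of `MinRel f A`. -/
def minLeft {Q : Type} (f : List α →. List α) (A : DetAut α Q) :
    DetAut α (Quotient (minSetoid f A)) where
  start := Quotient.mk _ []
  step q a := some (Quotient.map (sa := minSetoid f A) (sb := minSetoid f A) (fun u => u ++ [a])
    (fun _ _ h => MinRel.snoc h a) q)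
  accept := {q | ∃ w : List α, (f w).Dom ∧ Quotient.mk _ w = q}

/-- The right automaton `Right_f(A)` of the right minimization with respect to a left automaton
`A`, defined symmetrically. -/
def minRight {Q : Type} (f : List α →. List α) (A : DetAut α Q) :
    DetAut α (Quotient (minSetoid (mirror f) A)) :=
  minLeft (mirror f) A

/-- The left congruence of a transduction: `u` and `v` are related if for every `w`,
`w u ∈ dom f ↔ w v ∈ dom f`, and the prefix distance of `f (w u)` and `f (w v)` is bounded
independently of `w`. -/
def LeftCong (f : List α →. List α) (u v : List α) : Prop :=
  (∀ w : List α, (f (w ++ u)).Dom ↔ (f (w ++ v)).Dom) ∧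
    ∃ N : ℕ, ∀ w : List α, ∀ x ∈ f (w ++ u), ∀ y ∈ f (w ++ v), prefixDist x y ≤ N

/-- `LeftCong` as an equivalence relation. -/
def leftCongSetoid (f : List α →. List α) : Setoid (List α) where
  r := LeftCong f
  iseqv :=
    { refl := fun u => ⟨fun _ => Iff.rfl, 0, fun w x hx y hy => by
        rw [Part.mem_unique hx hy, prefixDist_self]⟩
      symm := fun ⟨h, N, hN⟩ => ⟨fun w => (h w).symm, N, fun w x hx y hy => by
        rw [prefixDist_comm]; exact hN w y hy x hx⟩
      trans := fun {u v t} ⟨h, N, hN⟩ ⟨h', N', hN'⟩ =>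
        ⟨fun w => (h w).trans (h' w), N + N', fun w x hx y hy => by
          obtain ⟨z, hz⟩ := Part.dom_iff_mem.1 ((h w).1 (Part.dom_iff_mem.2 ⟨x, hx⟩))
          exact (prefixDist_triangle x z y).trans
            (Nat.add_le_add (hN w x hx z hz) (hN' w z hz y hy))⟩ }

theorem LeftCong.cons {f : List α →. List α} {u v : List α} (h : LeftCong f u v) (a : α) :
    LeftCong f (a :: u) (a :: v) := by
  obtain ⟨h1, N, hN⟩ := h
  refine ⟨fun w => by simpa using h1 (w ++ [a]), N, fun w x hx y hy => ?_⟩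
  exact hN (w ++ [a]) x (by simpa using hx) y (by simpa using hy)

/-- The canonical right automaton `R_f`, whose states are the classes of the left congruence of
`f`; reading `a` to the left of `w` leads from the class of `w` to the class of `a w`. -/
def canonRight (f : List α →. List α) : DetAut α (Quotient (leftCongSetoid f)) where
  start := Quotient.mk _ []
  step q a := some (Quotient.map (sa := leftCongSetoid f) (sb := leftCongSetoid f) (fun u => a :: u)
    (fun _ _ h => LeftCong.cons h a) q)
  accept := {q | ∃ w : List α, (f w).Dom ∧ Quotient.mk _ w = q}

/-- The canonical left automaton `L_f`, defined symmetrically. -/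
def canonLeft (f : List α →. List α) : DetAut α (Quotient (leftCongSetoid (mirror f))) :=
  canonRight (mirror f)

end Canonical

/-! ### Machines as finite data -/

/-- A description of a transducer as finite data: numbers of letters and of states, the list of
transitions `(p, a, q, output)`, and the lists of initial and of final states with their outputs.
Letters and states are numbered from `0`. -/
structure TransducerCode where
  letters : ℕ
  states : ℕ
  trans : List (ℕ × ℕ × ℕ × List ℕ)
  initial : List (ℕ × List ℕ)
  final : List (ℕ × List ℕ)

/-- A description of a bimachine as finite data: numbers of letters, of left states and of right
states, the two initial states, the lists of transitions `(state, letter, next state)` of the two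
automata (in the direction in which they read), the list of entries `(l, a, r, output)` of the
output function, and the lists of final states of the right and of the left automaton with the
values of the final functions `lam` and `rho`. -/
structure BimachineCode where
  letters : ℕ
  leftStates : ℕ
  rightStates : ℕ
  leftStart : ℕ
  rightStart : ℕ
  leftTrans : List (ℕ × ℕ × ℕ)
  rightTrans : List (ℕ × ℕ × ℕ)
  out : List (ℕ × ℕ × ℕ × List ℕ)
  lam : List (ℕ × List ℕ)
  rho : List (ℕ × List ℕ)

/-- A transducer code as the tuple of its components. -/
def TransducerCode.equivTuple : TransducerCode ≃
    ℕ × ℕ × List (ℕ × ℕ × ℕ × List ℕ) × List (ℕ × List ℕ) × List (ℕ × List ℕ) where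
  toFun c := (c.letters, c.states, c.trans, c.initial, c.final)
  invFun t := ⟨t.1, t.2.1, t.2.2.1, t.2.2.2.1, t.2.2.2.2⟩
  left_inv _ := rfl
  right_inv _ := rfl

/-- A bimachine code as the tuple of its components. -/
def BimachineCode.equivTuple : BimachineCode ≃
    ℕ × ℕ × ℕ × ℕ × ℕ × List (ℕ × ℕ × ℕ) × List (ℕ × ℕ × ℕ) ×
      List (ℕ × ℕ × ℕ × List ℕ) × List (ℕ × List ℕ) × List (ℕ × List ℕ) where
  toFun c := (c.letters, c.leftStates, c.rightStates, c.leftStart, c.rightStart, c.leftTrans,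
    c.rightTrans, c.out, c.lam, c.rho)
  invFun t := ⟨t.1, t.2.1, t.2.2.1, t.2.2.2.1, t.2.2.2.2.1, t.2.2.2.2.2.1, t.2.2.2.2.2.2.1,
    t.2.2.2.2.2.2.2.1, t.2.2.2.2.2.2.2.2.1, t.2.2.2.2.2.2.2.2.2⟩
  left_inv _ := rfl
  right_inv _ := rfl

instance : Primcodable TransducerCode := Primcodable.ofEquiv _ TransducerCode.equivTuple

instance : Primcodable BimachineCode := Primcodable.ofEquiv _ BimachineCode.equivTuple

/-- The word of numbers that describes `w` with respect to a numbering `e` of the alphabet. -/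
def codeWord {α : Type} {k : ℕ} (e : α ≃ Fin k) (w : List α) : List ℕ :=
  w.map fun a => (e a : ℕ)

/-- The code `c` describes the transducer `T`, with respect to the numbering `e` of the alphabet
and some numbering of the states. -/
def TransducerCode.Represents {α : Type} {k : ℕ} (e : α ≃ Fin k) (c : TransducerCode)
    (T : Transducer α) : Prop :=
  c.letters = k ∧ ∃ eQ : T.Q ≃ Fin c.states,
    (∀ (p : T.Q) (a : α) (q : T.Q) (w : List ℕ),
      ((eQ p : ℕ), (e a : ℕ), (eQ q : ℕ), w) ∈ c.trans ↔
        ∃ h : q ∈ T.aut.step p a, w = codeWord e (T.out p a ⟨q, h⟩)) ∧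
    (∀ (q : T.Q) (w : List ℕ), ((eQ q : ℕ), w) ∈ c.initial ↔
      ∃ h : q ∈ T.aut.start, w = codeWord e (T.initOut ⟨q, h⟩)) ∧
    (∀ (q : T.Q) (w : List ℕ), ((eQ q : ℕ), w) ∈ c.final ↔
      ∃ h : q ∈ T.aut.accept, w = codeWord e (T.finalOut ⟨q, h⟩))

/-- The code `c` describes the bimachine `B`, with respect to the numbering `e` of the alphabet
and some numberings of the left states and of the right states. -/
def BimachineCode.Represents {α : Type} {k : ℕ} (e : α ≃ Fin k) (c : BimachineCode)
    (B : Bimachine α) : Prop :=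
  c.letters = k ∧ ∃ (eL : B.L ≃ Fin c.leftStates) (eR : B.R ≃ Fin c.rightStates),
    c.leftStart = (eL B.left.start : ℕ) ∧ c.rightStart = (eR B.right.start : ℕ) ∧
    (∀ (p : B.L) (a : α) (q : B.L),
      ((eL p : ℕ), (e a : ℕ), (eL q : ℕ)) ∈ c.leftTrans ↔ B.left.step p a = some q) ∧
    (∀ (p : B.R) (a : α) (q : B.R),
      ((eR p : ℕ), (e a : ℕ), (eR q : ℕ)) ∈ c.rightTrans ↔ B.right.step p a = some q) ∧
    (∀ (l : B.L) (a : α) (r : B.R) (w : List ℕ),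
      ((eL l : ℕ), (e a : ℕ), (eR r : ℕ), w) ∈ c.out ↔ w = codeWord e (B.out l a r)) ∧
    (∀ (r : B.R) (w : List ℕ), ((eR r : ℕ), w) ∈ c.lam ↔
      ∃ h : r ∈ B.right.accept, w = codeWord e (B.lam ⟨r, h⟩)) ∧
    (∀ (l : B.L) (w : List ℕ), ((eL l : ℕ), w) ∈ c.rho ↔
      ∃ h : l ∈ B.left.accept, w = codeWord e (B.rho ⟨l, h⟩))

/-- The list `D` of codes describes a set of representatives of the classes of minimal bimachines
realizing `f`: the described bimachines are minimal and realize `f`, each minimal bimachine is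
equal to one of them up to state renaming and output shifting, and no two of them are. -/
def DescribesRepresentatives {α : Type} {k : ℕ} (e : α ≃ Fin k) (f : List α →. List α)
    (D : List BimachineCode) : Prop :=
  ∃ Bs : List (Bimachine α), List.Forall₂ (BimachineCode.Represents e) D Bs ∧
    (∀ B ∈ Bs, B.IsMinimal f) ∧
    (∀ B : Bimachine α, B.IsMinimal f → ∃ B' ∈ Bs, B.Equiv B') ∧
    Bs.Pairwise fun B B' => ¬ B.Equiv B'

end RatTrans

open RatTrans

/-!
The proof replaces a bimachine by the pair `(K, K')` of the transition congruences of its two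
automata. Words are embedded in the free group (`toGrp`), where the quotient `x⁻¹ y` of two words
records exactly what is left of them after removal of their longest common prefix. A pair of right
congruences, of which the second one is about words read from right to left, is compatible with `f`
(`Compat`) if both saturate the domain and the values satisfy
`f(u z)⁻¹ f(u w) = f(v z)⁻¹ f(v w)` whenever `u` and `v` are `K`-related and `z` and `w` are
`K'`-related, so that the matrix of values has rank one on each product of classes. The transition
congruences of a bimachine that realizes `f` are compatible with `f` (`Bimachine.Realizes.compat`),
and every compatible pair of finite index arises in this way (`Compat.exists_bimachine`; the outputs
are the increments of the longest common prefixes). So minimal bimachines are maximal compatible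
pairs, and bimachines that realize `f` are equal up to state renaming and output shifting if and only
if they have the same pair.

For a fixed `K'` there is a coarsest compatible `K`, which is the congruence of `Left_f`
(`minRel_iff`). Every compatible `K'` is contained in the canonical congruence
(`Compat.le_canonRight`): since the prefix distance of two words is a function of their quotient in
the free group, the distance of `f(w u)` and `f(w v)` depends only on the class of `w`. As `Left_f`
is antitone, this gives the bounds on minimal bimachines. The lower bound
`Left_f(R_f)` has finite index (`Compat.indexLE_leftRel`): for canonically related `s` and `t`,
each repetition of a common loop in a long word `u` multiplies the values on `u s` and `u t` on the
left by group elements `C` and `D`. If the loop is iterated, the quotients stay in a finite set, and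
unique roots in the free group force `C = D`. So the loop can be removed from `u` without a change of
the quotient (`Compat.delay_loop`), and all quotients are attained on short words. This gives the
finiteness of the set of minimal bimachines, and an explicit bound on their size in terms of any
compatible pair.

A functional transducer yields a compatible pair through the subset constructions in both directions
(`Transducer.Realizes.compat`). Relative to it, inclusion of congruences, compatibility and equality
of transductions are decided by words of bounded length (`le_of_short`, `Compat.of_short`,
`gval_eq_of_short`). Hence it is a primitive recursive property of a list of bimachines to be a list
of representatives of the minimal ones (`Check`), and an unbounded search finds such a list. A
bimachine is converted to a transducer that guesses the run of the right automaton.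
-/

namespace RatTrans

/-! ### Words in the free group -/

section FreeGroupWords

variable {α : Type}

/-- The element of the free group that is spelled by a word. -/
def toGrp (w : List α) : FreeGroup α := FreeGroup.mk (w.map fun a => (a, true))

@[simp] theorem toGrp_nil : toGrp ([] : List α) = 1 := rfl

theorem toGrp_append (x y : List α) : toGrp (x ++ y) = toGrp x * toGrp y := by
  simp [toGrp, FreeGroup.mul_mk]

/-- Two words can be written `p s` and `p t` with no common first letter of `s` and `t`. -/
theorem exists_strip (x y : List α) : ∃ p s t : List α, x = p ++ s ∧ y = p ++ t ∧
    ∀ a, a ∈ s.head? → a ∈ t.head? → False := by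
  induction x generalizing y with
  | nil => exact ⟨[], [], y, rfl, rfl, by simp⟩
  | cons a x ih =>
    cases y with
    | nil => exact ⟨[], a :: x, [], rfl, rfl, by simp⟩
    | cons b y =>
      by_cases h : a = b
      · subst h
        obtain ⟨p, s, t, rfl, rfl, h⟩ := ih y
        exact ⟨a :: p, s, t, rfl, rfl, h⟩
      · refine ⟨[], a :: x, b :: y, rfl, rfl, fun c h1 h2 => h ?_⟩
        simp at h1 h2
        rw [h1, h2]

/-- If `s` and `t` have no common first letter, then `s⁻¹ t` is a reduced word in the free group, so
it determines `s` and `t`. -/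
theorem strip_unique_of_reduced {s t s' t' : List α}
    (h : ∀ a, a ∈ s.head? → a ∈ t.head? → False) (h' : ∀ a, a ∈ s'.head? → a ∈ t'.head? → False)
    (e : (toGrp s)⁻¹ * toGrp t = (toGrp s')⁻¹ * toGrp t') : s = s' ∧ t = t' := by
  classical
  have red : ∀ {s t : List α}, (∀ a, a ∈ s.head? → a ∈ t.head? → False) →
      ((toGrp s)⁻¹ * toGrp t).toWord =
        (s.map fun a => (a, false)).reverse ++ t.map fun a => (a, true) := by
    intro s t h
    have e1 : (toGrp s)⁻¹ * toGrp t =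
        FreeGroup.mk ((s.map fun a => (a, false)).reverse ++ t.map fun a => (a, true)) := by
      simp [toGrp, FreeGroup.inv_mk, FreeGroup.mul_mk, FreeGroup.invRev, Function.comp_def]
    rw [e1, FreeGroup.toWord_mk]
    apply FreeGroup.IsReduced.reduce_eq
    have mono : ∀ (b : Bool) (l : List α),
        List.IsChain (fun a b : α × Bool => a.1 = b.1 → a.2 = b.2) (l.map fun a => (a, b)) := by
      intro b l
      rw [List.isChain_map]
      exact List.Pairwise.isChain (List.pairwise_of_forall (by simp))
    unfold FreeGroup.IsReduced
    rw [List.isChain_append]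
    refine ⟨?_, mono _ _, ?_⟩
    · rw [← List.map_reverse]
      exact mono _ _
    · rintro ⟨a, x⟩ ha ⟨b, y⟩ hb hab
      simp at ha hb hab
      obtain ⟨ha, -⟩ := ha
      obtain ⟨hb, -⟩ := hb
      subst hab
      exact (h a ha hb).elim
  have e2 := congrArg FreeGroup.toWord e
  rw [red h, red h'] at e2
  have e3 := congrArg (fun l => (l.filter fun a => a.2).map Prod.fst) e2
  have e4 := congrArg (fun l => ((l.filter fun a => !a.2).map Prod.fst).reverse) e2
  simp only [List.filter_append, List.filter_reverse, List.filter_map, Function.comp_def] at e3 e4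
  simp [Function.comp_def] at e3 e4
  exact ⟨e4, e3⟩

theorem toGrp_injective : Function.Injective (toGrp (α := α)) := by
  intro x y h
  exact (strip_unique_of_reduced (s := []) (s' := []) (t := x) (t' := y) (by simp) (by simp)
    (by simp [h])).2

/-- Two pairs of words with the same quotient in the free group differ by a change of their common
prefix. -/
theorem exists_delay {x x' y y' : List α}
    (e : (toGrp x)⁻¹ * toGrp x' = (toGrp y)⁻¹ * toGrp y') :
    ∃ p q s t : List α, x = p ++ s ∧ x' = p ++ t ∧ y = q ++ s ∧ y' = q ++ t ∧
      ∀ a, a ∈ s.head? → a ∈ t.head? → False := by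
  obtain ⟨p, s, t, rfl, rfl, h⟩ := exists_strip x x'
  obtain ⟨q, s', t', rfl, rfl, h'⟩ := exists_strip y y'
  obtain ⟨rfl, rfl⟩ := strip_unique_of_reduced h h' (by simpa [toGrp_append, mul_assoc] using e)
  exact ⟨p, q, s, t, rfl, rfl, rfl, rfl, h⟩

theorem delay_eq {p q s t : List α} :
    (toGrp (p ++ s))⁻¹ * toGrp (p ++ t) = (toGrp (q ++ s))⁻¹ * toGrp (q ++ t) := by
  simp [toGrp_append, mul_assoc]

theorem prefix_of_strip {p s t r : List α} (h : ∀ a, a ∈ s.head? → a ∈ t.head? → False)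
    (h1 : r <+: p ++ s) (h2 : r <+: p ++ t) : r <+: p := by
  rcases le_total r.length p.length with hl | hl
  · exact List.prefix_of_prefix_length_le h1 (List.prefix_append _ _) hl
  · obtain ⟨r', rfl⟩ := List.prefix_of_prefix_length_le (List.prefix_append p s) h1 hl
    rw [List.prefix_append_right_inj] at h1 h2
    cases r' with
    | nil => simp
    | cons a r' =>
      obtain ⟨s', rfl⟩ := h1
      obtain ⟨t', rfl⟩ := h2
      exact (h a (by simp) (by simp)).elim

theorem prefixDist_strip {p s t : List α} (h : ∀ a, a ∈ s.head? → a ∈ t.head? → False) :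
    prefixDist (p ++ s) (p ++ t) = s.length + t.length := by
  have e : lcp {p ++ s, p ++ t} = p := by
    refine (lcp_pair _ _).unique ⟨?_, ?_⟩
    · rintro x (rfl | rfl) <;> exact List.prefix_append _ _
    · intro q hq
      exact prefix_of_strip h (hq _ (by simp)) (hq _ (by simp))
  unfold prefixDist
  rw [e]
  simp
  omega

/-- The prefix distance of two words is a function of their quotient in the free group. -/
theorem prefixDist_congr {x x' y y' : List α}
    (e : (toGrp x)⁻¹ * toGrp x' = (toGrp y)⁻¹ * toGrp y') :
    prefixDist x x' = prefixDist y y' := by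
  obtain ⟨p, q, s, t, rfl, rfl, rfl, rfl, h⟩ := exists_delay e
  rw [prefixDist_strip h, prefixDist_strip h]

/-- Over a finite alphabet, pairs of words at bounded prefix distance have finitely many quotients
in the free group. -/
theorem finite_delays [Finite α] (N : ℕ) :
    {g : FreeGroup α | ∃ x y : List α, prefixDist x y ≤ N ∧ (toGrp x)⁻¹ * toGrp y = g}.Finite := by
  refine (((List.finite_length_le α N).prod (List.finite_length_le α N)).image
    fun p => (toGrp p.1)⁻¹ * toGrp p.2).subset ?_
  rintro _ ⟨x, y, h, rfl⟩
  obtain ⟨p, s, t, rfl, rfl, hst⟩ := exists_strip x y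
  rw [prefixDist_strip hst] at h
  refine ⟨(s, t), ⟨?_, ?_⟩, ?_⟩
  · simp only [Set.mem_ofPred_eq]; omega
  · simp only [Set.mem_ofPred_eq]; omega
  · simp [toGrp_append, mul_assoc]

open MulOpposite in
/-- The reversal of words, extended to the free group as an anti-homomorphism. -/
def revHom : FreeGroup α →* (FreeGroup α)ᵐᵒᵖ := FreeGroup.lift fun a => op (FreeGroup.of a)

theorem toGrp_cons (a : α) (w : List α) : toGrp (a :: w) = FreeGroup.of a * toGrp w := by
  rw [← List.singleton_append, toGrp_append]
  rfl

theorem revHom_toGrp (w : List α) : revHom (toGrp w) = MulOpposite.op (toGrp w.reverse) := by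
  induction w with
  | nil => simp
  | cons a w ih =>
    rw [toGrp_cons, map_mul, ih, List.reverse_cons, toGrp_append, MulOpposite.op_mul]
    congr 1

/-- An identity between left quotients, read from right to left. -/
theorem revHom_delay {a b c d : FreeGroup α} (e : a * b⁻¹ = c * d⁻¹) :
    (revHom b).unop⁻¹ * (revHom a).unop = (revHom d).unop⁻¹ * (revHom c).unop := by
  have := congrArg (fun x => (revHom x).unop) e
  simpa using this

end FreeGroupWords

/-! ### Compatible pairs of congruences -/

section Compatible

variable {α : Type}

open Classical in
/-- The value of a transduction as an element of the free group, `1` outside the domain. -/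
noncomputable def gval (f : List α →. List α) (u : List α) : FreeGroup α :=
  if h : (f u).Dom then toGrp ((f u).get h) else 1

theorem gval_of_mem {f : List α →. List α} {u x : List α} (h : x ∈ f u) :
    gval f u = toGrp x := by
  obtain ⟨h, rfl⟩ := h
  simp [gval, h]

theorem gval_of_not_dom {f : List α →. List α} {u : List α} (h : ¬ (f u).Dom) :
    gval f u = 1 := by
  simp [gval, h]

theorem mirror_dom (f : List α →. List α) (u : List α) :
    (mirror f u).Dom ↔ (f u.reverse).Dom := Iff.rfl

theorem mirror_mirror (f : List α →. List α) : mirror (mirror f) = f := by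
  funext u
  refine Part.ext fun x => ?_
  simp [mirror]

theorem gval_mirror (f : List α →. List α) (u : List α) :
    gval (mirror f) u = (revHom (gval f u.reverse)).unop := by
  by_cases h : (f u.reverse).Dom
  · obtain ⟨x, hx⟩ := Part.dom_iff_mem.1 h
    rw [gval_of_mem hx, revHom_toGrp]
    exact gval_of_mem (Part.mem_map _ hx)
  · rw [gval_of_not_dom h, gval_of_not_dom (f := mirror f) h]
    simp

/-- A right congruence on words. Right automata read the mirror image of a word from left to right,
so that right congruences serve on both sides. -/
def IsRightCong (K : Setoid (List α)) : Prop :=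
  ∀ u v w : List α, K u v → K (u ++ w) (v ++ w)

/-- The equivalence relation `K` has at most `m` classes. -/
def IndexLE (K : Setoid (List α)) (m : ℕ) : Prop :=
  ∃ h : List α → Fin m, ∀ u v, h u = h v → K u v

/-- The transition congruence of an automaton. -/
def runKer {Q : Type} (A : DetAut α Q) : Setoid (List α) := Setoid.ker A.run

theorem runKer_apply {Q : Type} {A : DetAut α Q} {u v : List α} :
    runKer A u v ↔ A.run u = A.run v := Iff.rfl

theorem finer_iff {Q Q' : Type} (A : DetAut α Q) (A' : DetAut α Q') :
    A.Finer A' ↔ runKer A ≤ runKer A' := Iff.rfl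

theorem isRightCong_runKer {Q : Type} (A : DetAut α Q) : IsRightCong (runKer A) := by
  intro u v w h
  rw [runKer_apply] at *
  unfold DetAut.run at *
  rw [A.runFrom_append, A.runFrom_append, h]

theorem exists_indexLE_runKer {Q : Type} [Finite Q] (A : DetAut α Q) :
    ∃ m, IndexLE (runKer A) m := by
  obtain ⟨m, ⟨e⟩⟩ := Finite.exists_equiv_fin (Option Q)
  exact ⟨m, fun u => e (A.run u), fun u v h => e.injective h⟩

theorem IndexLE.mono {K K' : Setoid (List α)} {m : ℕ} (h : IndexLE K m) (hK : K ≤ K') :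
    IndexLE K' m := by
  obtain ⟨h, hh⟩ := h
  exact ⟨h, fun u v e => hK (hh u v e)⟩

theorem IndexLE.inf {K K' : Setoid (List α)} {m m' : ℕ} (h : IndexLE K m) (h' : IndexLE K' m') :
    IndexLE (K ⊓ K') (m * m') := by
  obtain ⟨h, hh⟩ := h
  obtain ⟨h', hh'⟩ := h'
  refine ⟨fun u => finProdFinEquiv (h u, h' u), fun u v e => ?_⟩
  have := finProdFinEquiv.injective e
  rw [Prod.mk.injEq] at this
  exact ⟨hh u v this.1, hh' u v this.2⟩

theorem IsRightCong.inf {K K' : Setoid (List α)} (h : IsRightCong K) (h' : IsRightCong K') :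
    IsRightCong (K ⊓ K') :=
  fun u v w e => ⟨h u v w e.1, h' u v w e.2⟩

/-- Two right congruences `K` and `K'` are compatible with `f` if both saturate the domain, and the
matrix of the values `f (u z.reverse)` has rank one on products of classes, in the sense that the
quotient of two entries of a row is the same for all rows in a class of `K`. The right congruence
`K'` is about words that are read from right to left. For congruences of finite index this means
that some bimachine with these transition congruences realizes `f`. -/
structure Compat (f : List α →. List α) (K K' : Setoid (List α)) : Prop where
  dom_left : ∀ u v, K u v → ((f u).Dom ↔ (f v).Dom)
  dom_right : ∀ u v, K' u v → ((f u.reverse).Dom ↔ (f v.reverse).Dom)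
  delay : ∀ u v z w, K u v → K' z w →
    (gval f (u ++ z.reverse))⁻¹ * gval f (u ++ w.reverse) =
      (gval f (v ++ z.reverse))⁻¹ * gval f (v ++ w.reverse)

theorem Compat.mono {f : List α →. List α} {K K' J J' : Setoid (List α)} (h : Compat f K K')
    (hJ : J ≤ K) (hJ' : J' ≤ K') : Compat f J J' :=
  ⟨fun u v e => h.dom_left u v (hJ e), fun u v e => h.dom_right u v (hJ' e),
    fun u v z w e e' => h.delay u v z w (hJ e) (hJ' e')⟩

theorem Compat.mirror {f : List α →. List α} {K K' : Setoid (List α)} (h : Compat f K K') :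
    Compat (mirror f) K' K := by
  refine ⟨fun u v e => h.dom_right u v e, fun u v e => ?_, fun u v z w e e' => ?_⟩
  · simpa [mirror_dom] using h.dom_left u v e
  · have := h.delay z w u v e' e
    simp only [gval_mirror, List.reverse_append, List.reverse_reverse]
    apply revHom_delay
    rw [inv_mul_eq_iff_eq_mul] at this
    rw [this]
    group

theorem Compat.of_mirror {f : List α →. List α} {K K' : Setoid (List α)}
    (h : Compat (RatTrans.mirror f) K' K) : Compat f K K' := by
  simpa [mirror_mirror] using h.mirror

/-- It suffices to compare quotients inside the domain. -/
theorem Compat.of_dom {f : List α →. List α} {K K' : Setoid (List α)} (hK : IsRightCong K)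
    (hK' : IsRightCong K') (h1 : ∀ u v, K u v → ((f u).Dom ↔ (f v).Dom))
    (h2 : ∀ u v, K' u v → ((f u.reverse).Dom ↔ (f v.reverse).Dom))
    (h3 : ∀ u v z w, K u v → K' z w → ∀ x ∈ f (u ++ z.reverse), ∀ x' ∈ f (u ++ w.reverse),
      ∀ y ∈ f (v ++ z.reverse), ∀ y' ∈ f (v ++ w.reverse),
      (toGrp x)⁻¹ * toGrp x' = (toGrp y)⁻¹ * toGrp y') : Compat f K K' := by
  refine ⟨h1, h2, fun u v z w e e' => ?_⟩
  have a1 := h1 _ _ (hK u v z.reverse e)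
  have a2 := h1 _ _ (hK u v w.reverse e)
  have a3 := h2 _ _ (hK' z w u.reverse e')
  simp only [List.reverse_append, List.reverse_reverse] at a3
  by_cases hd : (f (u ++ z.reverse)).Dom
  · obtain ⟨x, hx⟩ := Part.dom_iff_mem.1 hd
    obtain ⟨x', hx'⟩ := Part.dom_iff_mem.1 (a3.1 hd)
    obtain ⟨y, hy⟩ := Part.dom_iff_mem.1 (a1.1 hd)
    obtain ⟨y', hy'⟩ := Part.dom_iff_mem.1 (a2.1 (a3.1 hd))
    rw [gval_of_mem hx, gval_of_mem hx', gval_of_mem hy, gval_of_mem hy']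
    exact h3 u v z w e e' x hx x' hx' y hy y' hy'
  · rw [gval_of_not_dom hd, gval_of_not_dom (fun h => hd (a1.2 h)),
      gval_of_not_dom (fun h => hd (a3.2 h)), gval_of_not_dom (fun h => hd (a3.2 (a2.2 h)))]

theorem Compat.dom_iff_left {f : List α →. List α} {K K' : Setoid (List α)} (h : Compat f K K')
    (hK : IsRightCong K) {u v : List α} (e : K u v) (w : List α) :
    (f (u ++ w)).Dom ↔ (f (v ++ w)).Dom := h.dom_left _ _ (hK u v w e)

theorem Compat.dom_iff_right {f : List α →. List α} {K K' : Setoid (List α)} (h : Compat f K K')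
    (hK' : IsRightCong K') {z w : List α} (e : K' z w) (u : List α) :
    (f (u ++ z.reverse)).Dom ↔ (f (u ++ w.reverse)).Dom := by
  simpa using h.dom_right _ _ (hK' z w u.reverse e)

/-! ### The coarsest left congruence compatible with a right one -/

/-- The relation `MinRel f A` in terms of quotients in the free group, for an arbitrary equivalence
relation in place of the transition congruence of `A`. -/
def leftRel (f : List α →. List α) (K' : Setoid (List α)) : Setoid (List α) where
  r u v := (∀ w : List α, (f (u ++ w)).Dom ↔ (f (v ++ w)).Dom) ∧
    ∀ z w, K' z w → (f (u ++ z.reverse)).Dom → (f (u ++ w.reverse)).Dom →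
      (gval f (u ++ z.reverse))⁻¹ * gval f (u ++ w.reverse) =
        (gval f (v ++ z.reverse))⁻¹ * gval f (v ++ w.reverse)
  iseqv :=
    { refl := fun _ => ⟨fun _ => Iff.rfl, fun _ _ _ _ _ => rfl⟩
      symm := fun h => ⟨fun w => (h.1 w).symm, fun z w e h1 h2 =>
        (h.2 z w e ((h.1 _).2 h1) ((h.1 _).2 h2)).symm⟩
      trans := fun h h' => ⟨fun w => (h.1 w).trans (h'.1 w), fun z w e h1 h2 =>
        (h.2 z w e h1 h2).trans (h'.2 z w e ((h.1 _).1 h1) ((h.1 _).1 h2))⟩ }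

theorem leftRel_anti (f : List α →. List α) {K K' : Setoid (List α)} (h : K ≤ K') :
    leftRel f K' ≤ leftRel f K :=
  fun _ _ e => ⟨e.1, fun z w hz h1 h2 => e.2 z w (h hz) h1 h2⟩

/-- The left congruence of a compatible pair is contained in the one that is determined by the right
congruence. -/
theorem Compat.le_leftRel {f : List α →. List α} {K K' : Setoid (List α)} (h : Compat f K K')
    (hK : IsRightCong K) : K ≤ leftRel f K' :=
  fun u v e => ⟨fun w => h.dom_iff_left hK e w, fun z w e' _ _ => h.delay u v z w e e'⟩

theorem isRightCong_leftRel {f : List α →. List α} {K' : Setoid (List α)}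
    (hK' : IsRightCong K') : IsRightCong (leftRel f K') := by
  refine fun u v w e => ⟨fun t => by simpa using e.1 (w ++ t), fun z t h h1 h2 => ?_⟩
  simpa using e.2 (z ++ w.reverse) (t ++ w.reverse) (hK' _ _ _ h) (by simpa using h1)
    (by simpa using h2)

theorem compat_leftRel {f : List α →. List α} {K' : Setoid (List α)} (hK' : IsRightCong K')
    (hd : ∀ u v, K' u v → ((f u.reverse).Dom ↔ (f v.reverse).Dom)) :
    Compat f (leftRel f K') K' := by
  refine Compat.of_dom (isRightCong_leftRel hK') hK' (fun u v e => by simpa using e.1 []) hd ?_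
  intro u v z w e e' x hx x' hx' y hy y' hy'
  have := e.2 z w e' (Part.dom_iff_mem.2 ⟨x, hx⟩) (Part.dom_iff_mem.2 ⟨x', hx'⟩)
  rwa [gval_of_mem hx, gval_of_mem hx', gval_of_mem hy, gval_of_mem hy'] at this

/-- The longest common prefix is attained by a pair of words: if something is left of `x` after
removal of `hat f A w u`, then some value branches off exactly there. -/
theorem exists_branch {Q : Type} {f : List α →. List α} {A : DetAut α Q} {u w x : List α}
    (hx : x ∈ f (u ++ w)) (hne : x.drop (hat f A w u).length ≠ []) :
    ∃ z y, A.run z.reverse = A.run w.reverse ∧ y ∈ f (u ++ z) ∧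
      ∀ r, r <+: x → r <+: y → r.length ≤ (hat f A w u).length := by
  by_contra! hcon
  have hlcp : IsLcp {s | ∃ v : List α, A.run v.reverse = A.run w.reverse ∧ s ∈ f (u ++ v)}
      (hat f A w u) := lcp_isLcp ⟨x, w, rfl, hx⟩
  obtain ⟨s, hs⟩ := hat_prefix f A rfl hx
  generalize hat f A w u = h at *
  subst hs
  cases s with
  | nil => simp at hne
  | cons a s =>
    have hp : h ++ [a] <+: h := by
      refine hlcp.2 _ ?_
      rintro y ⟨z, hz, hy⟩
      obtain ⟨r, hr1, hr2, hr3⟩ := hcon z y hz hy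
      refine (List.prefix_of_prefix_length_le (l₃ := h ++ a :: s) ?_ hr1 ?_).trans hr2
      · simp
      · simp only [List.length_append, List.length_singleton]
        omega
    have := hp.length_le
    simp at this

/-- If `u` and `v` are related, then what is left of `f (u w)` after removal of the common prefix is
a suffix of what is left of `f (v w)`: some value on `u` branches off at the end of the common
prefix, and the values on `v` branch off with the same remainders. The statement is in terms of
lengths, so that equality follows by symmetry. -/
theorem length_drop_le_of_leftRel {Q : Type} {f : List α →. List α} {A : DetAut α Q}
    {u v w x y : List α} (e : leftRel f (runKer A) u v) (hx : x ∈ f (u ++ w))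
    (hy : y ∈ f (v ++ w)) :
    (x.drop (hat f A w u).length).length ≤ (y.drop (hat f A w v).length).length ∧
      ((x.drop (hat f A w u).length).length = (y.drop (hat f A w v).length).length →
        x.drop (hat f A w u).length = y.drop (hat f A w v).length) := by
  by_cases hne : x.drop (hat f A w u).length = []
  · rw [hne]
    refine ⟨by simp, fun h => ?_⟩
    rw [List.length_nil] at h
    exact (List.length_eq_zero_iff.1 h.symm).symm
  obtain ⟨z, x', hz, hx', hb⟩ := exists_branch hx hne
  obtain ⟨y', hy'⟩ := Part.dom_iff_mem.1 ((e.1 z).1 (Part.dom_iff_mem.2 ⟨x', hx'⟩))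
  have h0 := e.2 w.reverse z.reverse hz.symm (by simpa using Part.dom_iff_mem.2 ⟨x, hx⟩)
    (by simpa using Part.dom_iff_mem.2 ⟨x', hx'⟩)
  simp only [List.reverse_reverse] at h0
  rw [gval_of_mem hx, gval_of_mem hx', gval_of_mem hy, gval_of_mem hy'] at h0
  obtain ⟨p, q, s, t, rfl, rfl, rfl, rfl, hst⟩ := exists_delay h0
  have hu1 : hat f A w u <+: p :=
    prefix_of_strip hst (hat_prefix f A rfl hx) (hat_prefix f A hz hx')
  have hu2 := hb p (List.prefix_append _ _) (List.prefix_append _ _)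
  have hv : hat f A w v <+: q :=
    prefix_of_strip hst (hat_prefix f A rfl hy) (hat_prefix f A hz hy')
  have hpe : hat f A w u = p := hu1.eq_of_length_le hu2
  rw [hpe, List.drop_left]
  have hvl := hv.length_le
  constructor
  · simp only [List.length_drop, List.length_append]
    omega
  · intro hl
    simp only [List.length_drop, List.length_append] at hl
    have : (hat f A w v).length = q.length := by omega
    rw [this, List.drop_left]

/-- The definition by longest common prefixes and the definition by quotients in the free group give
the same relation. -/
theorem minRel_iff {Q : Type} {f : List α →. List α} {A : DetAut α Q} {u v : List α} :
    MinRel f A u v ↔ leftRel f (runKer A) u v := by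
  constructor
  · intro h
    refine ⟨fun w => (h w).1, fun z w e h1 h2 => ?_⟩
    obtain ⟨x, hx⟩ := Part.dom_iff_mem.1 h1
    obtain ⟨x', hx'⟩ := Part.dom_iff_mem.1 h2
    obtain ⟨y, hy⟩ := Part.dom_iff_mem.1 ((h _).1.1 h1)
    obtain ⟨y', hy'⟩ := Part.dom_iff_mem.1 ((h _).1.1 h2)
    rw [gval_of_mem hx, gval_of_mem hx', gval_of_mem hy, gval_of_mem hy']
    have e' : A.run z.reverse.reverse = A.run w.reverse.reverse := by
      simpa using runKer_apply.1 e
    have a1 := (h z.reverse).2 x hx y hy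
    have a2 := (h w.reverse).2 x' hx' y' hy'
    rw [← hat_congr f A e', ← hat_congr f A e'] at a2
    rw [← List.prefix_iff_eq_append.1 (hat_prefix f A rfl hx),
      ← List.prefix_iff_eq_append.1 (hat_prefix f A rfl hy),
      ← List.prefix_iff_eq_append.1 (hat_prefix f A e'.symm hx'),
      ← List.prefix_iff_eq_append.1 (hat_prefix f A e'.symm hy'), a1, a2]
    exact delay_eq
  · intro e w
    refine ⟨e.1 w, fun x hx y hy => ?_⟩
    obtain ⟨h1, h2⟩ := length_drop_le_of_leftRel e hx hy
    exact h2 (h1.antisymm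
      (length_drop_le_of_leftRel ((leftRel f (runKer A)).symm e) hy hx).1)

theorem minLeft_run {Q : Type} (f : List α →. List α) (A : DetAut α Q) (w : List α) :
    (minLeft f A).run w = some (Quotient.mk _ w) := by
  have : ∀ (w u : List α), (minLeft f A).runFrom (Quotient.mk _ u) w =
      some (Quotient.mk _ (u ++ w)) := by
    intro w
    induction w with
    | nil => intro u; simp [DetAut.runFrom]
    | cons a w ih =>
      intro u
      have := ih (u ++ [a])
      rw [List.append_assoc, List.singleton_append] at this
      exact this
  exact this w []

theorem runKer_minLeft {Q : Type} (f : List α →. List α) (A : DetAut α Q) :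
    runKer (minLeft f A) = leftRel f (runKer A) := by
  ext u v
  rw [← minRel_iff, runKer_apply, minLeft_run, minLeft_run, Option.some.injEq, Quotient.eq]
  rfl

theorem canonRight_run (f : List α →. List α) (w : List α) :
    (canonRight f).run w = some (Quotient.mk _ w.reverse) := by
  have : ∀ (w u : List α), (canonRight f).runFrom (Quotient.mk _ u) w =
      some (Quotient.mk _ (w.reverse ++ u)) := by
    intro w
    induction w with
    | nil => intro u; simp [DetAut.runFrom]
    | cons a w ih =>
      intro u
      have := ih (a :: u)
      rw [List.reverse_cons, List.append_assoc, List.singleton_append]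
      exact this
  have h := this w []
  rw [List.append_nil] at h
  exact h

theorem runKer_canonRight (f : List α →. List α) {u v : List α} :
    runKer (canonRight f) u v ↔ LeftCong f u.reverse v.reverse := by
  rw [runKer_apply, canonRight_run, canonRight_run, Option.some.injEq, Quotient.eq]
  rfl

open Classical in
/-- A right congruence that is compatible with one of finite index lies below the canonical one:
the prefix distance of `f (w u)` and `f (w v)` depends on the class of `w` only. -/
theorem Compat.le_canonRight {f : List α →. List α} {K K' : Setoid (List α)} (h : Compat f K K')
    (hK : IsRightCong K) (hK' : IsRightCong K') {m : ℕ} (hm : IndexLE K m) :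
    K' ≤ runKer (canonRight f) := by
  intro u v e
  rw [runKer_canonRight]
  refine ⟨fun w => h.dom_iff_right hK' e w, ?_⟩
  obtain ⟨c, hc⟩ := hm
  -- the distance as a function of `w`, to be bounded on representatives of the classes of `K`
  let pd : List α → ℕ := fun w =>
    if hd : (f (w ++ u.reverse)).Dom ∧ (f (w ++ v.reverse)).Dom then
      prefixDist ((f (w ++ u.reverse)).get hd.1) ((f (w ++ v.reverse)).get hd.2) else 0
  let rep : Fin m → List α := fun i => if hi : ∃ w, c w = i then hi.choose else []
  refine ⟨Finset.univ.sup fun i => pd (rep i), fun w x hx y hy => ?_⟩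
  have hr : c (rep (c w)) = c w := by
    have : ∃ w', c w' = c w := ⟨w, rfl⟩
    simp only [rep, dif_pos this]
    exact this.choose_spec
  refine le_trans ?_ (Finset.le_sup (f := fun i => pd (rep i)) (Finset.mem_univ (c w)))
  have hrw := hc _ _ hr
  have hd1 : (f (rep (c w) ++ u.reverse)).Dom :=
    (h.dom_iff_left hK hrw _).2 (Part.dom_iff_mem.2 ⟨x, hx⟩)
  have hd2 : (f (rep (c w) ++ v.reverse)).Dom :=
    (h.dom_iff_left hK hrw _).2 (Part.dom_iff_mem.2 ⟨y, hy⟩)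
  have hdel := h.delay _ _ _ _ hrw e
  rw [gval_of_mem hx, gval_of_mem hy, gval_of_mem (Part.get_mem hd1),
    gval_of_mem (Part.get_mem hd2)] at hdel
  simp only [pd, dif_pos (And.intro hd1 hd2)]
  exact (prefixDist_congr hdel).ge

end Compatible

/-! ### The compatible pair of a bimachine -/

section BimachineCompat

variable {α : Type}

theorem Bimachine.outWord_cons (B : Bimachine α) {l l' : B.L} {r r' : B.R} {a : α}
    {v t : List α} (hl : B.left.step l a = some l') (hr : B.right.runFrom r v.reverse = some r')
    (ht : B.outWord l' v r = some t) : B.outWord l (a :: v) r = some (B.out l a r' ++ t) := by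
  simp [Bimachine.outWord, hl, hr, ht]

theorem Bimachine.outWord_append (B : Bimachine α) {l l' : B.L} {r r' : B.R} {u v : List α}
    (hl : B.left.runFrom l u = some l') (hr : B.right.runFrom r v.reverse = some r') :
    B.outWord l (u ++ v) r =
      (B.outWord l u r').bind fun x => (B.outWord l' v r).map fun y => x ++ y := by
  induction u generalizing l with
  | nil =>
    simp only [DetAut.runFrom, Option.some.injEq] at hl
    subst hl
    simp [Bimachine.outWord]
  | cons a u ih =>
    simp only [DetAut.runFrom] at hl
    obtain ⟨l1, h1, h2⟩ := Option.bind_eq_some_iff.1 hl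
    simp only [List.cons_append, Bimachine.outWord, h1, Option.bind_some, ih h2,
      List.reverse_append, DetAut.runFrom_append, hr]
    cases B.right.runFrom r' u.reverse with
    | none => simp
    | some r1 =>
      cases B.outWord l1 u r' with
      | none => simp
      | some x => cases B.outWord l' v r <;> simp

theorem Bimachine.outWord_isSome (B : Bimachine α) {l : B.L} {r : B.R} {u : List α}
    (hl : (B.left.runFrom l u).isSome) (hr : (B.right.runFrom r u.reverse).isSome) :
    (B.outWord l u r).isSome := by
  induction u generalizing l with
  | nil => rfl
  | cons a u ih =>
    simp only [DetAut.runFrom] at hl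
    obtain ⟨l', hl⟩ := Option.isSome_iff_exists.1 hl
    obtain ⟨l1, h1, h2⟩ := Option.bind_eq_some_iff.1 hl
    rw [List.reverse_cons, DetAut.runFrom_append] at hr
    obtain ⟨r', hr⟩ := Option.isSome_iff_exists.1 hr
    obtain ⟨r1, h3, -⟩ := Option.bind_eq_some_iff.1 hr
    have := ih (l := l1) (by simp [h2]) (by simp [h3])
    obtain ⟨x, hx⟩ := Option.isSome_iff_exists.1 this
    simp [Bimachine.outWord, h1, h3, hx]

theorem Bimachine.exists_sem_iff (B : Bimachine α) (u : List α) :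
    (∃ x, (u, x) ∈ B.sem) ↔ B.left.Accepts u := by
  constructor
  · rintro ⟨x, l, r, w, h1, -⟩
    exact ⟨l, l.2, h1⟩
  · intro h
    obtain ⟨r, hr, hr'⟩ := (B.same_language u).1 h
    obtain ⟨l, hl, hl'⟩ := h
    obtain ⟨w, hw⟩ := Option.isSome_iff_exists.1
      (B.outWord_isSome (l := B.left.start) (r := B.right.start) (u := u)
        (by simpa [DetAut.run] using Option.isSome_iff_exists.2 ⟨_, hl'⟩)
        (by simpa [DetAut.run] using Option.isSome_iff_exists.2 ⟨_, hr'⟩))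
    exact ⟨_, ⟨l, hl⟩, ⟨r, hr⟩, w, hl', hr', hw, rfl⟩

theorem Bimachine.Realizes.mem_iff {B : Bimachine α} {f : List α →. List α} (h : B.Realizes f)
    {u x : List α} : x ∈ f u ↔ (u, x) ∈ B.sem := by
  rw [h]
  rfl

theorem Bimachine.Realizes.dom_iff_left {B : Bimachine α} {f : List α →. List α}
    (h : B.Realizes f) {u : List α} : (f u).Dom ↔ B.left.Accepts u := by
  rw [Part.dom_iff_mem, ← B.exists_sem_iff]
  simp only [h.mem_iff]

theorem Bimachine.Realizes.dom_iff_right {B : Bimachine α} {f : List α →. List α}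
    (h : B.Realizes f) {u : List α} : (f u).Dom ↔ B.right.Accepts u.reverse := by
  rw [h.dom_iff_left, B.same_language]

/-- The value on `u z` factors through the state reached by the left automaton on `u` and the state
reached by the right automaton on `z`. -/
theorem Bimachine.Realizes.exists_factor {B : Bimachine α} {f : List α →. List α}
    (h : B.Realizes f) {u z x : List α} (hx : x ∈ f (u ++ z.reverse)) :
    ∃ (l : B.L) (r : B.R) (l' : B.left.accept) (r' : B.right.accept) (p q : List α),
      B.left.run u = some l ∧ B.right.run z = some r ∧
      B.left.runFrom l z.reverse = some l'.1 ∧ B.right.runFrom r u.reverse = some r'.1 ∧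
      B.outWord B.left.start u r = some p ∧ B.outWord l z.reverse B.right.start = some q ∧
      x = B.lam r' ++ p ++ (q ++ B.rho l') := by
  obtain ⟨l', r', w, h1, h2, h3, h4⟩ := h.mem_iff.1 hx
  simp only [DetAut.run, DetAut.runFrom_append, List.reverse_append, List.reverse_reverse] at h1 h2
  obtain ⟨l, hl, hl'⟩ := Option.bind_eq_some_iff.1 h1
  obtain ⟨r, hr, hr'⟩ := Option.bind_eq_some_iff.1 h2
  have := B.outWord_append (u := u) (v := z.reverse) hl (by simpa using hr)
  simp only at h3
  rw [h3] at this
  obtain ⟨p, hp, hp'⟩ := Option.bind_eq_some_iff.1 this.symm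
  obtain ⟨q, hq, rfl⟩ := Option.map_eq_some_iff.1 hp'
  refine ⟨l, r, l', r', p, q, hl, hr, hl', hr', hp, hq, ?_⟩
  simpa using h4

/-- The value on `u z` is a product of a word that depends on `u` and the right state of `z` and of
a word that depends on `z` and the left state of `u`. In a quotient of two entries of a row the
former cancels, and the latter do not change within a class of left states. -/
theorem Bimachine.Realizes.compat {B : Bimachine α} {f : List α →. List α} (h : B.Realizes f) :
    Compat f (runKer B.left) (runKer B.right) := by
  refine Compat.of_dom (isRightCong_runKer _) (isRightCong_runKer _) ?_ ?_ ?_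
  · intro u v e
    rw [h.dom_iff_left, h.dom_iff_left]
    unfold DetAut.Accepts
    rw [runKer_apply.1 e]
  · intro u v e
    rw [h.dom_iff_right, h.dom_iff_right]
    unfold DetAut.Accepts
    rw [List.reverse_reverse, List.reverse_reverse, runKer_apply.1 e]
  · intro u v z w e e' x hx x' hx' y hy y' hy'
    rw [runKer_apply] at e e'
    obtain ⟨l1, r1, l1', r1', p1, q1, a1, b1, c1, d1, i1, j1, rfl⟩ := h.exists_factor hx
    obtain ⟨l2, r2, l2', r2', p2, q2, a2, b2, c2, d2, i2, j2, rfl⟩ := h.exists_factor hx'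
    obtain ⟨l3, r3, l3', r3', p3, q3, a3, b3, c3, d3, i3, j3, rfl⟩ := h.exists_factor hy
    obtain ⟨l4, r4, l4', r4', p4, q4, a4, b4, c4, d4, i4, j4, rfl⟩ := h.exists_factor hy'
    obtain rfl : l1 = l2 := by simpa [a1] using a2
    obtain rfl : l1 = l3 := by simpa [a1, ← e] using a3
    obtain rfl : l1 = l4 := by simpa [a1, ← e] using a4
    obtain rfl : r1 = r2 := by simpa [b1, ← e'] using b2
    obtain rfl : r1 = r3 := by simpa [b1] using b3
    obtain rfl : r1 = r4 := by simpa [b1, ← e'] using b4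
    obtain rfl : r1' = r2' := by rw [d1] at d2; exact Subtype.ext (Option.some.inj d2)
    obtain rfl : r3' = r4' := by rw [d3] at d4; exact Subtype.ext (Option.some.inj d4)
    obtain rfl : l1' = l3' := by rw [c1] at c3; exact Subtype.ext (Option.some.inj c3)
    obtain rfl : l2' = l4' := by rw [c2] at c4; exact Subtype.ext (Option.some.inj c4)
    obtain rfl : p1 = p2 := by simpa [i1] using i2
    obtain rfl : p3 = p4 := by simpa [i3] using i4
    obtain rfl : q1 = q3 := by simpa [j1] using j3
    obtain rfl : q2 = q4 := by simpa [j2] using j4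
    exact delay_eq

end BimachineCompat

/-! ### The bimachine of a compatible pair -/

section Construction

variable {α Q Q' : Type}

/-- The automaton with another set of final states. -/
def DetAut.withAccept (A : DetAut α Q) (s : Set Q) : DetAut α Q := ⟨A.start, A.step, s⟩

theorem DetAut.runFrom_withAccept (A : DetAut α Q) (s : Set Q) (q : Q) (w : List α) :
    (A.withAccept s).runFrom q w = A.runFrom q w := by
  induction w generalizing q with
  | nil => rfl
  | cons a w ih =>
    simp only [DetAut.runFrom, ih]
    rfl

theorem DetAut.run_withAccept (A : DetAut α Q) (s : Set Q) (w : List α) :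
    (A.withAccept s).run w = A.run w := A.runFrom_withAccept s _ w

theorem runKer_withAccept (A : DetAut α Q) (s : Set Q) :
    runKer (A.withAccept s) = runKer A := by
  ext u v
  simp only [runKer_apply, A.run_withAccept]

theorem DetAut.accepts_withAccept {f : List α →. List α} {A : DetAut α Q} {g : List α → List α}
    (h : ∀ u v, A.run (g u) = A.run (g v) → ((f u).Dom ↔ (f v).Dom))
    (h' : ∀ u, (f u).Dom → A.run (g u) ≠ none) (u : List α) :
    (A.withAccept {q | ∃ v, (f v).Dom ∧ A.run (g v) = some q}).Accepts (g u) ↔ (f u).Dom := by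
  unfold DetAut.Accepts
  simp only [A.run_withAccept]
  constructor
  · rintro ⟨q, ⟨v, hv, hv'⟩, hq⟩
    exact (h u v (hq.trans hv'.symm)).2 hv
  · intro hd
    obtain ⟨q, hq⟩ := Option.ne_none_iff_exists'.1 (h' u hd)
    exact ⟨q, ⟨u, hd, hq⟩, hq⟩

open Classical in
/-- The bimachine on two given automata that are compatible with `f`. On a letter `a` between `u`
and `w` it outputs the increase of the longest common prefix from `hat f A' (a w) u` to
`hat f A' w (u a)`. -/
noncomputable def compatBimachine [Finite Q] [Finite Q'] (f : List α →. List α) (A : DetAut α Q)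
    (A' : DetAut α Q') (h : Compat f (runKer A) (runKer A'))
    (hr : ∀ u, (f u).Dom → A.run u ≠ none ∧ A'.run u.reverse ≠ none) : Bimachine α where
  L := Q
  R := Q'
  finite_L := ‹_›
  finite_R := ‹_›
  -- `id` makes the two sides instances of `DetAut.accepts_withAccept`
  left := A.withAccept {q | ∃ u, (f u).Dom ∧ A.run (id u) = some q}
  right := A'.withAccept {q | ∃ u, (f u).Dom ∧ A'.run u.reverse = some q}
  out l a r :=
    if e : ∃ p : List α × List α, A.run p.1 = some l ∧ A'.run p.2.reverse = some r ∧
        (f (p.1 ++ [a] ++ p.2)).Dom then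
      (hat f A' e.choose.2 (e.choose.1 ++ [a])).drop
        (hat f A' (a :: e.choose.2) e.choose.1).length
    else []
  lam r := hat f A' r.2.choose []
  rho l := ((f l.2.choose).get l.2.choose_spec.1).drop (hat f A' [] l.2.choose).length
  same_language u := by
    rw [DetAut.accepts_withAccept (g := List.reverse) (fun u v e => by
        simpa using h.dom_right u.reverse v.reverse e) (fun u hu => (hr u hu).2) u]
    exact DetAut.accepts_withAccept (g := id) (fun u v e => h.dom_left u v e)
      (fun u hu => (hr u hu).1) u

variable {f : List α →. List α} {A : DetAut α Q} {A' : DetAut α Q'}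

/-- The output on a letter can be computed with any words that lead to the same states. -/
theorem hat_append_out (h : Compat f (runKer A) (runKer A')) {u u' w w' : List α} {a : α}
    (hu : A.run u = A.run u')
    (hw : A'.run w.reverse = A'.run w'.reverse) (hd : (f (u ++ [a] ++ w)).Dom) :
    hat f A' (a :: w) u ++ (hat f A' w' (u' ++ [a])).drop (hat f A' (a :: w') u').length =
      hat f A' w (u ++ [a]) := by
  rw [hat_congr f A' hw.symm, hat_congr f A' (run_reverse_cons A' a hw.symm)]
  have hrel : leftRel f (runKer A') u u' := h.le_leftRel (isRightCong_runKer A) hu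
  have m1 := (minRel_iff.2 hrel) (a :: w)
  have m2 := (MinRel.snoc (minRel_iff.2 hrel) a) w
  obtain ⟨x, hx⟩ := Part.dom_iff_mem.1 hd
  obtain ⟨y, hy⟩ := Part.dom_iff_mem.1 (m2.1.1 hd)
  have e1 := m1.2 x (by simpa using hx) y (by simpa using hy)
  have e2 := m2.2 x hx y hy
  obtain ⟨o, ho⟩ : hat f A' (a :: w) u <+: hat f A' w (u ++ [a]) :=
    ⟨_, (hat_snoc f A' u w a hd).symm⟩
  obtain ⟨o', ho'⟩ : hat f A' (a :: w) u' <+: hat f A' w (u' ++ [a]) :=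
    ⟨_, (hat_snoc f A' u' w a (m2.1.1 hd)).symm⟩
  obtain ⟨s, rfl⟩ := hat_prefix f A' rfl hx
  obtain ⟨s', rfl⟩ := hat_prefix f A' rfl hy
  rw [List.drop_left, List.drop_left] at e2
  subst e2
  rw [← ho, ← ho', List.append_assoc, List.append_assoc, List.drop_left, List.drop_left,
    List.append_left_inj] at e1
  rw [← ho, ← ho', List.drop_left, e1]

variable [Finite Q] [Finite Q'] (h : Compat f (runKer A) (runKer A'))
  (hr : ∀ u, (f u).Dom → A.run u ≠ none ∧ A'.run u.reverse ≠ none)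

open Classical in
/-- The outputs along a word telescope. -/
theorem compatBimachine_outWord {u v : List α} {l : Q} (hl : A.run u = some l)
    (hd : (f (u ++ v)).Dom) :
    ∃ t, (compatBimachine f A A' h hr).outWord l v A'.start = some t ∧
      hat f A' v u ++ t = hat f A' [] (u ++ v) := by
  induction v generalizing u l with
  | nil => exact ⟨[], rfl, by simp⟩
  | cons a v ih =>
    have hd' : (f (u ++ [a] ++ v)).Dom := by simpa using hd
    obtain ⟨h1, h2⟩ := hr _ hd
    have e1 : A.run (u ++ a :: v) = (A.step l a).bind fun l' => A.runFrom l' v := by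
      unfold DetAut.run at *
      rw [A.runFrom_append, hl]
      rfl
    have e2 : A'.run (u ++ a :: v).reverse =
        (A'.run v.reverse).bind fun r => A'.runFrom r (u ++ [a]).reverse := by
      unfold DetAut.run at *
      rw [← A'.runFrom_append]
      simp
    rw [e1] at h1
    rw [e2] at h2
    obtain ⟨l1, hl1⟩ : ∃ l1, A.step l a = some l1 := by
      cases hs : A.step l a with
      | none => simp [hs] at h1
      | some l1 => exact ⟨l1, rfl⟩
    obtain ⟨r1, hr1⟩ : ∃ r1, A'.run v.reverse = some r1 := by
      cases hs : A'.run v.reverse with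
      | none => simp [hs] at h2
      | some l1 => exact ⟨l1, rfl⟩
    have hl1' : A.run (u ++ [a]) = some l1 := by
      unfold DetAut.run at *
      simp [A.runFrom_append, hl, DetAut.runFrom, hl1]
    obtain ⟨t, ht, ht'⟩ := ih hl1' hd'
    have hex : ∃ p : List α × List α, A.run p.1 = some l ∧ A'.run p.2.reverse = some r1 ∧
        (f (p.1 ++ [a] ++ p.2)).Dom := ⟨(u, v), hl, hr1, hd'⟩
    have hstep : (compatBimachine f A A' h hr).outWord l (a :: v) A'.start =
        some ((compatBimachine f A A' h hr).out l a r1 ++ t) := by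
      have s1 : (compatBimachine f A A' h hr).left.step l a = some l1 := hl1
      have s2 : (compatBimachine f A A' h hr).right.runFrom A'.start v.reverse = some r1 :=
        (A'.run_withAccept _ _).trans hr1
      exact Bimachine.outWord_cons _ s1 s2 ht
    refine ⟨_, hstep, ?_⟩
    have hout : (compatBimachine f A A' h hr).out l a r1 =
        (hat f A' hex.choose.2 (hex.choose.1 ++ [a])).drop
          (hat f A' (a :: hex.choose.2) hex.choose.1).length := dif_pos hex
    rw [hout, ← List.append_assoc,
      hat_append_out h (hl.trans hex.choose_spec.1.symm) (hr1.trans hex.choose_spec.2.1.symm) hd',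
      ht']
    simp

theorem compatBimachine_realizes : (compatBimachine f A A' h hr).Realizes f := by
  set B := compatBimachine f A A' h hr with hB
  have key : ∀ u x, x ∈ f u → ∀ y, (u, y) ∈ B.sem → y = x := by
    rintro u x hx y ⟨l, r, w, h1, h2, h3, h4⟩
    have h1' : A.run u = some l.1 := (A.run_withAccept _ _).symm.trans h1
    have h2' : A'.run u.reverse = some r.1 := (A'.run_withAccept _ _).symm.trans h2
    obtain ⟨t, ht, ht'⟩ := compatBimachine_outWord h hr (u := []) (v := u) (l := A.start) rfl
      (Part.dom_iff_mem.2 ⟨x, hx⟩)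
    obtain rfl : w = t := by
      have : some w = some t := h3.symm.trans ht
      simpa using this
    rw [List.nil_append] at ht'
    have hlam : B.lam r = hat f A' u [] :=
      hat_congr f A' (r.2.choose_spec.2.trans h2'.symm) []
    have hrho : B.rho l = x.drop (hat f A' [] u).length := by
      have hrel : leftRel f (runKer A') l.2.choose u :=
        h.le_leftRel (isRightCong_runKer A) (l.2.choose_spec.2.trans h1'.symm)
      exact ((minRel_iff.2 hrel) []).2 _ (by simpa using Part.get_mem l.2.choose_spec.1) x
        (by simpa using hx)
    simp only at h4
    rw [h4, hlam, ht', hrho]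
    exact List.prefix_iff_eq_append.1 (hat_prefix f A' rfl (by simpa using hx))
  have hdom : ∀ u, (f u).Dom ↔ ∃ y, (u, y) ∈ B.sem := by
    intro u
    rw [B.exists_sem_iff]
    exact (DetAut.accepts_withAccept (g := id) (fun u v e => h.dom_left u v e)
      (fun u hu => (hr u hu).1) u).symm
  unfold Bimachine.Realizes
  ext ⟨u, y⟩
  constructor
  · intro hy
    obtain ⟨x, hx⟩ := Part.dom_iff_mem.1 ((hdom u).2 ⟨y, hy⟩)
    rw [key u x hx y hy]
    exact hx
  · intro hy
    have hy : y ∈ f u := hy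
    obtain ⟨y', hy'⟩ := (hdom u).1 (Part.dom_iff_mem.2 ⟨y, hy⟩)
    rwa [key u y hy y' hy'] at hy'

end Construction

/-! ### Minimal bimachines as maximal compatible pairs -/

section Minimal

variable {α : Type}

/-- The automaton whose states are the classes of a right congruence. -/
def quotAut (K : Setoid (List α)) (hK : IsRightCong K) : DetAut α (Quotient K) where
  start := Quotient.mk _ []
  step q a := some (Quotient.map (sa := K) (sb := K) (fun u => u ++ [a])
    (fun _ _ h => hK _ _ _ h) q)
  accept := ∅

theorem quotAut_run (K : Setoid (List α)) (hK : IsRightCong K) (w : List α) :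
    (quotAut K hK).run w = some (Quotient.mk _ w) := by
  have : ∀ (w u : List α), (quotAut K hK).runFrom (Quotient.mk _ u) w =
      some (Quotient.mk _ (u ++ w)) := by
    intro w
    induction w with
    | nil => intro u; simp [DetAut.runFrom]
    | cons a w ih =>
      intro u
      have := ih (u ++ [a])
      rw [List.append_assoc, List.singleton_append] at this
      exact this
  exact this w []

theorem runKer_quotAut (K : Setoid (List α)) (hK : IsRightCong K) :
    runKer (quotAut K hK) = K := by
  ext u v
  rw [runKer_apply, quotAut_run, quotAut_run, Option.some.injEq, Quotient.eq]

theorem IndexLE.finite_quotient {K : Setoid (List α)} {m : ℕ} (h : IndexLE K m) :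
    Finite (Quotient K) := by
  obtain ⟨c, hc⟩ := h
  refine Finite.of_injective (fun q : Quotient K => c q.out) fun p q e => ?_
  have := hc _ _ e
  rw [← Quotient.out_eq p, ← Quotient.out_eq q]
  exact Quotient.sound this

/-- A compatible pair of right congruences of finite index is the pair of transition congruences of
a bimachine. -/
theorem Compat.exists_bimachine {f : List α →. List α} {K K' : Setoid (List α)}
    (h : Compat f K K') (hK : IsRightCong K) (hK' : IsRightCong K') {m m' : ℕ}
    (hm : IndexLE K m) (hm' : IndexLE K' m') :
    ∃ B : Bimachine α, B.Realizes f ∧ runKer B.left = K ∧ runKer B.right = K' := by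
  have := hm.finite_quotient
  have := hm'.finite_quotient
  have h' : Compat f (runKer (quotAut K hK)) (runKer (quotAut K' hK')) := by
    rwa [runKer_quotAut, runKer_quotAut]
  exact ⟨compatBimachine f _ _ h' fun u _ => by simp [quotAut_run],
    compatBimachine_realizes _ _, (runKer_withAccept _ _).trans (runKer_quotAut K hK),
    (runKer_withAccept _ _).trans (runKer_quotAut K' hK')⟩

theorem Bimachine.exists_indexLE_left (B : Bimachine α) : ∃ m, IndexLE (runKer B.left) m := by
  have := B.finite_L
  exact exists_indexLE_runKer _

theorem Bimachine.exists_indexLE_right (B : Bimachine α) : ∃ m, IndexLE (runKer B.right) m := by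
  have := B.finite_R
  exact exists_indexLE_runKer _

/-- The transition congruences of a minimal bimachine form a maximal compatible pair. -/
theorem Bimachine.IsMinimal.maximal {B : Bimachine α} {f : List α →. List α} (h : B.IsMinimal f)
    {J J' : Setoid (List α)} (hJ : IsRightCong J) (hJ' : IsRightCong J') (hc : Compat f J J')
    (hl : runKer B.left ≤ J) (hr : runKer B.right ≤ J') :
    J ≤ runKer B.left ∧ J' ≤ runKer B.right := by
  obtain ⟨m, hm⟩ := B.exists_indexLE_left
  obtain ⟨m', hm'⟩ := B.exists_indexLE_right
  obtain ⟨B', hB', rfl, rfl⟩ := hc.exists_bimachine hJ hJ' (hm.mono hl) (hm'.mono hr)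
  exact h.2 B' hB' ⟨hl, hr⟩

theorem Bimachine.Realizes.right_le {B : Bimachine α} {f : List α →. List α} (h : B.Realizes f) :
    runKer B.right ≤ runKer (canonRight f) := by
  obtain ⟨m, hm⟩ := B.exists_indexLE_left
  exact h.compat.le_canonRight (isRightCong_runKer _) (isRightCong_runKer _) hm

theorem Bimachine.Realizes.left_le {B : Bimachine α} {f : List α →. List α} (h : B.Realizes f) :
    runKer B.left ≤ runKer (canonLeft f) := by
  obtain ⟨m, hm⟩ := B.exists_indexLE_right
  exact h.compat.mirror.le_canonRight (isRightCong_runKer _) (isRightCong_runKer _) hm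

/-- By maximality the left congruence is `leftRel f (runKer B.right)`, and the right congruence is
contained in the canonical one. -/
theorem Bimachine.IsMinimal.leftRel_le {B : Bimachine α} {f : List α →. List α}
    (h : B.IsMinimal f) : leftRel f (runKer (canonRight f)) ≤ runKer B.left := by
  have hc := h.1.compat
  exact (leftRel_anti f h.1.right_le).trans
    (h.maximal (isRightCong_leftRel (isRightCong_runKer _)) (isRightCong_runKer _)
      (compat_leftRel (isRightCong_runKer _) hc.dom_right)
      (hc.le_leftRel (isRightCong_runKer _)) le_rfl).1

theorem Bimachine.IsMinimal.rightRel_le {B : Bimachine α} {f : List α →. List α}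
    (h : B.IsMinimal f) : leftRel (mirror f) (runKer (canonLeft f)) ≤ runKer B.right := by
  have hc := h.1.compat.mirror
  exact (leftRel_anti (mirror f) h.1.left_le).trans
    (h.maximal (isRightCong_runKer _) (isRightCong_leftRel (isRightCong_runKer _))
      (compat_leftRel (isRightCong_runKer _) hc.dom_right).of_mirror le_rfl
      (hc.le_leftRel (isRightCong_runKer _))).2

end Minimal

/-! ### Short representatives and loops -/

section Loops

variable {α : Type}

/-- Two of the first `N + 1` factorizations of a word of length at least `N` have the same colour.
The factor between them is a loop. -/
theorem exists_loop {N : ℕ} (c : List α → List α → Fin N) {u : List α} (hu : N ≤ u.length) :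
    ∃ u₁ u₂ u₃, u = u₁ ++ u₂ ++ u₃ ∧ u₂ ≠ [] ∧ (u₁ ++ u₂).length ≤ N ∧
      c u₁ (u₂ ++ u₃) = c (u₁ ++ u₂) u₃ := by
  obtain ⟨i, j, hij, e⟩ := Fintype.exists_ne_map_eq_of_card_lt
    (fun i : Fin (N + 1) => c (u.take i) (u.drop i)) (by simp)
  wlog hlt : i < j generalizing i j
  · exact this j i hij.symm e.symm (lt_of_le_of_ne (not_lt.1 hlt) hij.symm)
  have hj := j.2
  have hlt' : (i : ℕ) < j := hlt
  have h1 : u.take j = u.take i ++ (u.drop i).take (j - i) := by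
    rw [List.take_drop, Nat.add_sub_cancel' hlt'.le]
    have := (List.take_append_drop i (u.take j)).symm
    rwa [List.take_take, min_eq_left hlt'.le] at this
  have h2 : u.drop i = (u.drop i).take (j - i) ++ u.drop j := by
    have := (List.take_append_drop (j - i) (u.drop i)).symm
    rwa [List.drop_drop, Nat.add_sub_cancel' hlt'.le] at this
  refine ⟨u.take i, (u.drop i).take (j - i), u.drop j, ?_, ?_, ?_, ?_⟩
  · rw [← h1, List.take_append_drop]
  · intro h
    have := congrArg List.length h
    simp only [List.length_take, List.length_drop, List.length_nil] at this
    omega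
  · rw [← h1, List.length_take]
    omega
  · rw [← h1, ← h2]
    exact e

/-- Every class of a right congruence of index at most `m` has an element shorter than `m`. -/
theorem exists_short {K : Setoid (List α)} (hK : IsRightCong K) {m : ℕ} (hm : IndexLE K m)
    (u : List α) : ∃ u', u'.length < m ∧ K u u' := by
  obtain ⟨c, hc⟩ := hm
  induction hn : u.length using Nat.strong_induction_on generalizing u with
  | _ n ih =>
    by_cases hu : u.length < m
    · exact ⟨u, hu, K.refl u⟩
    · obtain ⟨u₁, u₂, u₃, rfl, h2, -, e⟩ := exists_loop (fun u _ => c u) (not_lt.1 hu)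
      have hlen := List.length_pos_iff.2 h2
      simp only [List.length_append] at hn
      obtain ⟨u', h1, h3⟩ := ih (u₁ ++ u₃).length (by simp only [List.length_append]; omega) _ rfl
      exact ⟨u', h1, K.trans (hK _ _ u₃ (K.symm (hc _ _ e))) h3⟩

/-- A right congruence of index at most `m` is contained in one of index at most `m'` as soon as
this holds for words of length at most `m * m'`. -/
theorem le_of_short {K J : Setoid (List α)} (hK : IsRightCong K) (hJ : IsRightCong J) {m m' N : ℕ}
    (hm : IndexLE K m) (hm' : IndexLE J m') (hN : m * m' ≤ N)
    (h : ∀ u v, u.length ≤ N → v.length ≤ N → K u v → J u v) : K ≤ J := by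
  intro u v e
  obtain ⟨u', hu, hu1, hu2⟩ := exists_short (hK.inf hJ) (hm.inf hm') u
  obtain ⟨v', hv, hv1, hv2⟩ := exists_short (hK.inf hJ) (hm.inf hm') v
  exact J.trans hu2 (J.trans (h u' v' (by omega) (by omega)
    (K.trans (K.symm hu1) (K.trans e hv1))) (J.symm hv2))

/-- Iteration of a loop acts on the values by powers of a group element. -/
theorem Compat.gval_iterate {f : List α →. List α} {K K' : Setoid (List α)} (h : Compat f K K')
    (hK' : IsRightCong K') {u v z : List α} (hu : K (u ++ v) u) (hz : K' (z ++ v.reverse) z)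
    (n : ℕ) :
    gval f (u ++ (List.replicate n v).flatten ++ z.reverse) =
      (gval f (u ++ v ++ z.reverse) * (gval f (u ++ z.reverse))⁻¹) ^ n *
        gval f (u ++ z.reverse) := by
  have hz' : ∀ n, K' z (z ++ ((List.replicate n v).flatten).reverse) := by
    intro n
    induction n with
    | zero => simp
    | succ n ih =>
      rw [List.replicate_succ', List.flatten_append, List.reverse_append]
      simp only [List.flatten_cons, List.flatten_nil, List.append_nil]
      refine K'.trans ih ?_
      rw [← List.append_assoc]
      exact hK' _ _ _ (K'.symm hz)
  induction n with
  | zero => simp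
  | succ n ih =>
    have e := h.delay _ _ _ _ hu (hz' n)
    rw [inv_mul_eq_iff_eq_mul] at e
    simp only [List.reverse_append, List.reverse_reverse] at e
    rw [List.replicate_succ, List.flatten_cons, pow_succ', mul_assoc, ← ih]
    simp only [List.append_assoc] at e ⊢
    rw [e]
    group

/-- The quotients of the values on `u s` and `u t` do not change when a common loop is removed, if
`s` and `t` are related by the canonical congruence. Otherwise the quotients of the values on the
iterated loops would be pairwise distinct, since the free group has unique roots. -/
theorem Compat.delay_loop [Finite α] {f : List α →. List α} {K K' : Setoid (List α)}
    (h : Compat f K K') (hK : IsRightCong K) (hK' : IsRightCong K') {u v z w : List α}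
    (hu : K (u ++ v) u) (hz : K' (z ++ v.reverse) z) (hw : K' (w ++ v.reverse) w)
    (hzw : runKer (canonRight f) z w) (hd : (f (u ++ z.reverse)).Dom) :
    (gval f (u ++ v ++ z.reverse))⁻¹ * gval f (u ++ v ++ w.reverse) =
      (gval f (u ++ z.reverse))⁻¹ * gval f (u ++ w.reverse) := by
  obtain ⟨hdom, N, hN⟩ := (runKer_canonRight f).1 hzw
  have hun : ∀ n, K u (u ++ (List.replicate n v).flatten) := by
    intro n
    induction n with
    | zero => simp
    | succ n ih =>
      rw [List.replicate_succ, List.flatten_cons, ← List.append_assoc]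
      exact K.trans ih (hK _ _ _ (K.symm hu))
  have hX := h.gval_iterate hK' hu hz
  have hY := h.gval_iterate hK' hu hw
  set X := gval f (u ++ z.reverse)
  set Y := gval f (u ++ w.reverse)
  set C := gval f (u ++ v ++ z.reverse) * X⁻¹ with hC
  set D := gval f (u ++ v ++ w.reverse) * Y⁻¹ with hD
  have hfin : ∀ n, (C ^ n * X)⁻¹ * (D ^ n * Y) ∈
      {g : FreeGroup α | ∃ x y : List α, prefixDist x y ≤ N ∧ (toGrp x)⁻¹ * toGrp y = g} := by
    intro n
    have hd1 : (f (u ++ (List.replicate n v).flatten ++ z.reverse)).Dom :=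
      (h.dom_iff_left hK (hun n) _).1 hd
    obtain ⟨x, hx⟩ := Part.dom_iff_mem.1 hd1
    obtain ⟨y, hy⟩ := Part.dom_iff_mem.1 ((hdom _).1 hd1)
    refine ⟨x, y, hN _ x hx y hy, ?_⟩
    rw [← hX, ← hY, gval_of_mem hx, gval_of_mem hy]
  obtain ⟨i, -, j, -, hij, e⟩ := Set.infinite_univ.exists_ne_map_eq_of_mapsTo
    (fun n _ => hfin n) (finite_delays N)
  -- two of the quotients agree, which gives `C ^ n = D ^ n` for some `n ≠ 0`
  have hCD : C = D := by
    wlog hlt : i < j generalizing i j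
    · exact this j i hij.symm e.symm (lt_of_le_of_ne (not_lt.1 hlt) hij.symm)
    refine IsMulTorsionFree.pow_left_injective (n := j - i) (by omega) ?_
    obtain ⟨k, rfl⟩ := Nat.exists_eq_add_of_lt hlt
    have : i + k + 1 - i = k + 1 := by omega
    simp only [this]
    have e1 : (C ^ i)⁻¹ * D ^ i = (C ^ (i + (k + 1)))⁻¹ * D ^ (i + (k + 1)) := by
      have := congrArg (fun g => X * g * Y⁻¹) e
      simpa [mul_assoc, add_assoc] using this
    rw [add_comm i (k + 1), pow_add C, pow_add D, mul_inv_rev, mul_assoc,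
      mul_right_inj, ← mul_assoc] at e1
    have e2 := mul_eq_right.1 e1.symm
    exact (inv_mul_eq_one.1 e2)
  have e1 : gval f (u ++ v ++ z.reverse) = C * X := by rw [hC]; group
  have e2 : gval f (u ++ v ++ w.reverse) = D * Y := by rw [hD]; group
  rw [e1, e2, hCD]
  group

/-- The quotient of the values on `u s` and `u t` is attained on a short word in place of `u`: a
long `u` has a loop for `K` that is also a loop for `K'` after `s` and after `t`, and it can be
removed by `Compat.delay_loop`. -/
theorem Compat.exists_short_delay [Finite α] {f : List α →. List α} {K K' : Setoid (List α)}
    (h : Compat f K K') (hK : IsRightCong K) (hK' : IsRightCong K') {m : ℕ} (hm : IndexLE K m)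
    (hm' : IndexLE K' m) {s t : List α} (hst : runKer (canonRight f) s t) (u : List α)
    (hd : (f (u ++ s.reverse)).Dom) :
    ∃ u', u'.length < m * m * m ∧ (gval f (u ++ s.reverse))⁻¹ * gval f (u ++ t.reverse) =
      (gval f (u' ++ s.reverse))⁻¹ * gval f (u' ++ t.reverse) := by
  obtain ⟨c, hc⟩ := hm
  obtain ⟨c', hc'⟩ := hm'
  induction hn : u.length using Nat.strong_induction_on generalizing u with
  | _ n ih =>
    by_cases hu : u.length < m * m * m
    · exact ⟨u, hu, rfl⟩
    · obtain ⟨u₁, u₂, u₃, rfl, h2, -, e⟩ := exists_loop (fun p q => finProdFinEquiv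
        (finProdFinEquiv (c p, c' (s ++ q.reverse)), c' (t ++ q.reverse))) (not_lt.1 hu)
      have e1 := finProdFinEquiv.injective e
      rw [Prod.mk.injEq] at e1
      have e2 := finProdFinEquiv.injective e1.1
      rw [Prod.mk.injEq] at e2
      have hlen := List.length_pos_iff.2 h2
      simp only [List.length_append] at hn
      have hKu := K.symm (hc _ _ e2.1)
      have hz := hc' _ _ e2.2
      have hw := hc' _ _ e1.2
      rw [List.reverse_append, ← List.append_assoc] at hz hw
      have hd' : (f (u₁ ++ u₃ ++ s.reverse)).Dom := by
        rw [List.append_assoc] at hd ⊢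
        exact (h.dom_iff_left hK hKu _).1 hd
      have hloop := h.delay_loop hK hK' hKu hz hw
        (isRightCong_runKer _ _ _ u₃.reverse hst) (by simpa using hd')
      obtain ⟨u', h1, h3⟩ := ih (u₁ ++ u₃).length (by simp only [List.length_append]; omega) _
        hd' rfl
      refine ⟨u', h1, Eq.trans ?_ h3⟩
      simpa using hloop

open Classical in
/-- The left minimization with respect to the canonical right automaton is finite, of a size that
depends only on the alphabet and on the index `m` of some compatible pair: the class of `u` is
determined by its `K`-class and by the quotients of the values on `u s` and `u t`, where `s` and
`t` run over representatives of the `K'`-classes, and these quotients are attained on words of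
length less than `m * m * m`. -/
theorem Compat.indexLE_leftRel [Finite α] {f : List α →. List α} {K K' : Setoid (List α)}
    (h : Compat f K K') (hK : IsRightCong K) (hK' : IsRightCong K') {m W : ℕ}
    (hm : IndexLE K m) (hm' : IndexLE K' m) (ws : List (List α)) (hW : ws.length = W)
    (hws : ∀ u : List α, u.length < m * m * m → u ∈ ws) :
    IndexLE (leftRel f (runKer (canonRight f))) (m * W ^ (m * m)) := by
  have hle := h.le_canonRight hK hK' hm
  have hshort := fun s t hst => h.exists_short_delay hK hK' hm hm' (s := s) (t := t) hst
  obtain ⟨c, hc⟩ := hm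
  obtain ⟨c', hc'⟩ := hm'
  have hm0 : 0 < m := (Nat.zero_le _).trans_lt (c []).2
  have hW0 : 0 < W := by
    rw [← hW]
    exact List.length_pos_of_mem (hws [] (by simp; omega))
  let rep : Fin m → List α := fun i => if hi : ∃ w, c' w = i then hi.choose else []
  have hrep : ∀ z, K' z (rep (c' z)) := by
    intro z
    refine hc' _ _ ?_
    have : ∃ w', c' w' = c' z := ⟨z, rfl⟩
    simp only [rep, dif_pos this]
    exact this.choose_spec.symm
  let del : List α → Fin m × Fin m → FreeGroup α := fun u p =>
    (gval f (u ++ (rep p.1).reverse))⁻¹ * gval f (u ++ (rep p.2).reverse)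
  have hidx : ∀ u p, ∃ i : Fin W, runKer (canonRight f) (rep p.1) (rep p.2) →
      (f (u ++ (rep p.1).reverse)).Dom → del u p = del (ws.get (i.cast hW.symm)) p := by
    intro u p
    by_cases hh : runKer (canonRight f) (rep p.1) (rep p.2) ∧
        (f (u ++ (rep p.1).reverse)).Dom
    · obtain ⟨u', h1, h2⟩ := hshort _ _ hh.1 u hh.2
      obtain ⟨i, hi⟩ := List.get_of_mem (hws u' h1)
      refine ⟨i.cast hW, fun _ _ => ?_⟩
      have hi' : ws.get ((i.cast hW).cast hW.symm) = u' := hi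
      simp only [del]
      rw [hi', h2]
    · exact ⟨⟨0, hW0⟩, fun h1 h2 => (hh ⟨h1, h2⟩).elim⟩
  -- the class of `u` is determined by its `K`-class and by the position in `ws` of short words that
  -- attain the quotients of the values on representatives
  choose idx hidx using hidx
  let e : Fin m × (Fin m × Fin m → Fin W) ≃ Fin (m * W ^ (m * m)) :=
    Fintype.equivFinOfCardEq (by simp)
  refine ⟨fun u => e (c u, idx u), fun u v huv => ?_⟩
  have huv := e.injective huv
  rw [Prod.mk.injEq] at huv
  have hKuv : K u v := hc _ _ huv.1
  refine ⟨fun w => h.dom_iff_left hK hKuv w, fun z w hzw hd1 hd2 => ?_⟩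
  have hs := hrep z
  have ht := hrep w
  have hst : runKer (canonRight f) (rep (c' z)) (rep (c' w)) :=
    (runKer (canonRight f)).trans ((runKer (canonRight f)).symm (hle hs))
      ((runKer (canonRight f)).trans hzw (hle ht))
  have hdu := (h.dom_iff_right hK' hs u).1 hd1
  have hdv := (h.dom_iff_left hK hKuv _).1 hdu
  have hdel : del u (c' z, c' w) = del v (c' z, c' w) := by
    rw [hidx u _ hst hdu, hidx v _ hst hdv, huv.2]
  have d1 := h.delay u v _ _ hKuv hs
  have d2 := h.delay u v _ _ hKuv ht
  simp only [del] at hdel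
  generalize gval f (u ++ z.reverse) = a at *
  generalize gval f (v ++ z.reverse) = a' at *
  generalize gval f (u ++ w.reverse) = b at *
  generalize gval f (v ++ w.reverse) = b' at *
  generalize gval f (u ++ (rep (c' z)).reverse) = s at *
  generalize gval f (v ++ (rep (c' z)).reverse) = s' at *
  generalize gval f (u ++ (rep (c' w)).reverse) = t at *
  generalize gval f (v ++ (rep (c' w)).reverse) = t' at *
  -- pass from `z`, `w` to their representatives and back
  calc a⁻¹ * b = (a⁻¹ * s) * (s⁻¹ * t) * (b⁻¹ * t)⁻¹ := by group
    _ = (a'⁻¹ * s') * (s'⁻¹ * t') * (b'⁻¹ * t')⁻¹ := by rw [d1, d2, hdel]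
    _ = a'⁻¹ * b' := by group

end Loops

/-! ### Compatibility and equality are decided by short words -/

section SmallModel

variable {α : Type}

/-- The equations that define compatibility are symmetric under reversal. -/
theorem delay_mirror {f : List α →. List α} {u v z w : List α}
    (h : (gval f (u ++ z.reverse))⁻¹ * gval f (u ++ w.reverse) =
      (gval f (v ++ z.reverse))⁻¹ * gval f (v ++ w.reverse)) :
    (gval (mirror f) (z ++ u.reverse))⁻¹ * gval (mirror f) (z ++ v.reverse) =
      (gval (mirror f) (w ++ u.reverse))⁻¹ * gval (mirror f) (w ++ v.reverse) := by
  simp only [gval_mirror, List.reverse_append, List.reverse_reverse]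
  apply revHom_delay
  rw [inv_mul_eq_iff_eq_mul] at h
  rw [h]
  group

/-- A long word can be replaced by a short one in the equations that define compatibility with
`K` and `K'`, if these equations hold for short words. -/
theorem Compat.exists_short_left {f : List α →. List α} {K₀ K₀' K K' : Setoid (List α)}
    (h : Compat f K₀ K₀') (hK₀' : IsRightCong K₀') (hK : IsRightCong K)
    (hK' : IsRightCong K') {m M N : ℕ} (hm : IndexLE K₀ m) (hm' : IndexLE K₀' m)
    (hM : IndexLE K M) (hM' : IndexLE K' M) (hN : M * m ≤ N)
    (hs : ∀ u v z w : List α, u.length ≤ N → v.length ≤ N → z.length ≤ N → w.length ≤ N →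
      K u v → K' z w → (gval f (u ++ z.reverse))⁻¹ * gval f (u ++ w.reverse) =
        (gval f (v ++ z.reverse))⁻¹ * gval f (v ++ w.reverse)) (u : List α) :
    ∃ u', u'.length ≤ N ∧ K u u' ∧ ∀ z w, K' z w →
      (gval f (u ++ z.reverse))⁻¹ * gval f (u ++ w.reverse) =
        (gval f (u' ++ z.reverse))⁻¹ * gval f (u' ++ w.reverse) := by
  obtain ⟨c, hc⟩ := hM.inf hm
  induction hn : u.length using Nat.strong_induction_on generalizing u with
  | _ n ih =>
    by_cases hu : u.length ≤ N
    · exact ⟨u, hu, K.refl u, fun _ _ _ => rfl⟩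
    · obtain ⟨u₁, u₂, u₃, rfl, h2, h12, e⟩ := exists_loop (fun p _ => c p)
        (hN.trans (not_le.1 hu).le)
      have hlen := List.length_pos_iff.2 h2
      simp only [List.length_append] at hn h12
      have hloop := hc _ _ e
      obtain ⟨u', h1, h3, h4⟩ := ih (u₁ ++ u₃).length
        (by simp only [List.length_append]; omega) _ rfl
      refine ⟨u', h1, K.trans (hK _ _ u₃ (K.symm hloop.1)) h3, fun z w hzw => ?_⟩
      refine Eq.trans ?_ (h4 z w hzw)
      obtain ⟨z', hz, hz1, hz2⟩ := exists_short (hK'.inf hK₀') (hM'.inf hm') (z ++ u₃.reverse)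
      obtain ⟨w', hw, hw1, hw2⟩ := exists_short (hK'.inf hK₀') (hM'.inf hm') (w ++ u₃.reverse)
      have d1 := h.delay _ _ _ _ (K₀.symm hloop.2) hz2
      have d2 := h.delay _ _ _ _ (K₀.symm hloop.2) hw2
      have d3 := hs (u₁ ++ u₂) u₁ z' w' (by simp only [List.length_append]; omega) (by omega)
        (by omega) (by omega) (K.symm hloop.1)
        (K'.trans (K'.symm hz1) (K'.trans (hK' _ _ _ hzw) hw1))
      simp only [List.reverse_append, List.reverse_reverse, ← List.append_assoc] at d1 d2 d3 ⊢
      generalize gval f (u₁ ++ u₂ ++ u₃ ++ z.reverse) = a at *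
      generalize gval f (u₁ ++ u₃ ++ z.reverse) = a' at *
      generalize gval f (u₁ ++ u₂ ++ u₃ ++ w.reverse) = b at *
      generalize gval f (u₁ ++ u₃ ++ w.reverse) = b' at *
      generalize gval f (u₁ ++ u₂ ++ z'.reverse) = s at *
      generalize gval f (u₁ ++ z'.reverse) = s' at *
      generalize gval f (u₁ ++ u₂ ++ w'.reverse) = t at *
      generalize gval f (u₁ ++ w'.reverse) = t' at *
      -- pass from `z u₃`, `w u₃` to short words in the same classes and back
      calc a⁻¹ * b = (a⁻¹ * s) * (s⁻¹ * t) * (b⁻¹ * t)⁻¹ := by group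
        _ = (a'⁻¹ * s') * (s'⁻¹ * t') * (b'⁻¹ * t')⁻¹ := by rw [d1, d2, d3]
        _ = a'⁻¹ * b' := by group

/-- If `f` has a compatible pair of index at most `m`, then a pair of index at most `M` is
compatible with `f` as soon as the conditions hold on words of length at most `M * m`. -/
theorem Compat.of_short {f : List α →. List α} {K₀ K₀' K K' : Setoid (List α)}
    (h : Compat f K₀ K₀') (hK₀ : IsRightCong K₀) (hK₀' : IsRightCong K₀') (hK : IsRightCong K)
    (hK' : IsRightCong K') {m M N : ℕ} (hm : IndexLE K₀ m) (hm' : IndexLE K₀' m)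
    (hM : IndexLE K M) (hM' : IndexLE K' M) (hN : M * m ≤ N)
    (h1 : ∀ u v : List α, u.length ≤ N → v.length ≤ N → K u v → ((f u).Dom ↔ (f v).Dom))
    (h2 : ∀ u v : List α, u.length ≤ N → v.length ≤ N → K' u v →
      ((f u.reverse).Dom ↔ (f v.reverse).Dom))
    (hs : ∀ u v z w : List α, u.length ≤ N → v.length ≤ N → z.length ≤ N → w.length ≤ N →
      K u v → K' z w → (gval f (u ++ z.reverse))⁻¹ * gval f (u ++ w.reverse) =
        (gval f (v ++ z.reverse))⁻¹ * gval f (v ++ w.reverse)) : Compat f K K' := by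
  refine ⟨fun u v e => ?_, fun u v e => ?_, fun u v z w e e' => ?_⟩
  · obtain ⟨u', hu, hu1, hu2⟩ := exists_short (hK.inf hK₀) (hM.inf hm) u
    obtain ⟨v', hv, hv1, hv2⟩ := exists_short (hK.inf hK₀) (hM.inf hm) v
    rw [h.dom_left u u' hu2, h.dom_left v v' hv2]
    exact h1 u' v' (by omega) (by omega) (K.trans (K.symm hu1) (K.trans e hv1))
  · obtain ⟨u', hu, hu1, hu2⟩ := exists_short (hK'.inf hK₀') (hM'.inf hm') u
    obtain ⟨v', hv, hv1, hv2⟩ := exists_short (hK'.inf hK₀') (hM'.inf hm') v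
    rw [h.dom_right u u' hu2, h.dom_right v v' hv2]
    exact h2 u' v' (by omega) (by omega) (K'.trans (K'.symm hu1) (K'.trans e hv1))
  · have L := h.exists_short_left hK₀' hK hK' hm hm' hM hM' hN hs
    have R := h.mirror.exists_short_left hK₀ hK' hK hm' hm hM' hM hN
      fun z w u v hz hw hu hv ez eu => delay_mirror (hs u v z w hu hv hz hw eu ez)
    obtain ⟨u', hu, hu1, hu2⟩ := L u
    obtain ⟨v', hv, hv1, hv2⟩ := L v
    obtain ⟨z', hz, hz1, hz2⟩ := R z
    obtain ⟨w', hw, hw1, hw2⟩ := R w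
    have e1 : K u' v' := K.trans (K.symm hu1) (K.trans e hv1)
    have e2 : K' z' w' := K'.trans (K'.symm hz1) (K'.trans e' hw1)
    have := delay_mirror (hs u' v' z' w' hu hv hz hw e1 e2)
    rw [hu2 z w e', hv2 z w e']
    have key := delay_mirror ((hz2 u' v' e1).trans (this.trans (hw2 u' v' e1).symm))
    rwa [mirror_mirror] at key

/-- Two transductions with the same domain and a common compatible pair of index at most `m` are
equal if they agree on words of length at most `2 * m`: all values are determined by those, through
the equation `f (u z) = f (u w) (f (v w))⁻¹ f (v z)`. -/
theorem gval_eq_of_short {f g : List α →. List α} {K K' : Setoid (List α)} (hf : Compat f K K')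
    (hg : Compat g K K') (hK : IsRightCong K) (hK' : IsRightCong K') {m N : ℕ}
    (hm : IndexLE K m) (hm' : IndexLE K' m) (hN : 2 * m ≤ N)
    (hs : ∀ u : List α, u.length ≤ N → gval f u = gval g u) (x : List α) :
    gval f x = gval g x := by
  induction hn : x.length using Nat.strong_induction_on generalizing x with
  | _ n ih =>
    by_cases hx : x.length ≤ N
    · exact hs x hx
    · obtain ⟨u, z, rfl, hu, hz⟩ : ∃ u z : List α, x = u ++ z.reverse ∧ m ≤ u.length ∧
          m ≤ z.length := by
        refine ⟨x.take m, (x.drop m).reverse, by simp, ?_, ?_⟩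
        · rw [List.length_take]; omega
        · rw [List.length_reverse, List.length_drop]; omega
      obtain ⟨v, hv, hv1⟩ := exists_short hK hm u
      obtain ⟨w, hw, hw1⟩ := exists_short hK' hm' z
      simp only [List.length_append, List.length_reverse] at hn
      have e1 := ih (u ++ w.reverse).length (by simp; omega) _ rfl
      have e2 := ih (v ++ w.reverse).length (by simp; omega) _ rfl
      have e3 := ih (v ++ z.reverse).length (by simp; omega) _ rfl
      have d1 := hf.delay _ _ _ _ hv1 (K'.symm hw1)
      have d2 := hg.delay _ _ _ _ hv1 (K'.symm hw1)
      rw [inv_mul_eq_iff_eq_mul] at d1 d2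
      rw [d1, d2, e1, e2, e3]

end SmallModel

/-! ### Transducers -/

section Transducers

variable {α : Type}

theorem Transducer.run_append_iff (T : Transducer α) {p r : T.Q} {u u' v : List α} :
    T.Run p (u ++ u') v r ↔ ∃ q w w', T.Run p u w q ∧ T.Run q u' w' r ∧ v = w ++ w' := by
  constructor
  · intro h
    induction u generalizing p v with
    | nil => exact ⟨p, [], v, .nil p, h, rfl⟩
    | cons a u ih =>
      cases h with
      | cons q h =>
        obtain ⟨s, w, w', h1, h2, rfl⟩ := ih h
        exact ⟨s, _, w', .cons q h1, h2, by simp⟩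
  · rintro ⟨q, w, w', h1, h2, rfl⟩
    induction h1 with
    | nil p => exact h2
    | cons q h1 ih =>
      rw [List.append_assoc]
      exact .cons q (ih h2)

/-- The states that a transducer can reach from its initial states. -/
def Transducer.reach (T : Transducer α) (u : List α) : Set T.Q :=
  {q | ∃ p ∈ T.aut.start, ∃ v, T.Run p u v q}

/-- The states from which a transducer can read the mirror image of `z` and accept. -/
def Transducer.coreach (T : Transducer α) (z : List α) : Set T.Q :=
  {q | ∃ r ∈ T.aut.accept, ∃ v, T.Run q z.reverse v r}

theorem Transducer.isRightCong_reach (T : Transducer α) : IsRightCong (Setoid.ker T.reach) := by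
  have key : ∀ u w : List α,
      T.reach (u ++ w) = {q | ∃ p ∈ T.reach u, ∃ v, T.Run p w v q} := by
    intro u w
    ext q
    constructor
    · rintro ⟨p, hp, v, h⟩
      obtain ⟨s, v1, v2, h1, h2, -⟩ := T.run_append_iff.1 h
      exact ⟨s, ⟨p, hp, v1, h1⟩, v2, h2⟩
    · rintro ⟨s, ⟨p, hp, v1, h1⟩, v2, h2⟩
      exact ⟨p, hp, _, T.run_append_iff.2 ⟨s, v1, v2, h1, h2, rfl⟩⟩
  intro u v w h
  rw [Setoid.ker_def] at *
  rw [key, key, h]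

theorem Transducer.isRightCong_coreach (T : Transducer α) :
    IsRightCong (Setoid.ker T.coreach) := by
  have key : ∀ u w : List α,
      T.coreach (u ++ w) = {q | ∃ p ∈ T.coreach u, ∃ v, T.Run q w.reverse v p} := by
    intro u w
    ext q
    simp only [Transducer.coreach, List.reverse_append]
    constructor
    · rintro ⟨p, hp, v, h⟩
      obtain ⟨s, v1, v2, h1, h2, -⟩ := T.run_append_iff.1 h
      exact ⟨s, ⟨p, hp, v2, h2⟩, v1, h1⟩
    · rintro ⟨s, ⟨p, hp, v1, h1⟩, v2, h2⟩
      exact ⟨p, hp, _, T.run_append_iff.2 ⟨s, v2, v1, h2, h1, rfl⟩⟩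
  intro u v w h
  rw [Setoid.ker_def] at *
  rw [key, key, h]

theorem indexLE_ker {X : Type} {n : ℕ} (e : X ≃ Fin n) (g : List α → Set X) :
    IndexLE (Setoid.ker g) (2 ^ n) := by
  classical
  have := Fintype.ofEquiv _ e.symm
  let i : Set X ≃ Fin (2 ^ n) := Fintype.equivFinOfCardEq (by
    rw [Fintype.card_set, Fintype.card_congr e, Fintype.card_fin])
  exact ⟨fun u => i (g u), fun u v h => i.injective h⟩

theorem Transducer.Realizes.mem_iff {T : Transducer α} {f : List α →. List α} (h : T.Realizes f)
    {u x : List α} : x ∈ f u ↔ (u, x) ∈ T.sem := by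
  rw [h]
  rfl

theorem Transducer.Realizes.dom_iff {T : Transducer α} {f : List α →. List α} (h : T.Realizes f)
    {u : List α} : (f u).Dom ↔ ∃ p ∈ T.aut.start, ∃ q ∈ T.aut.accept, ∃ v, T.Run p u v q := by
  rw [Part.dom_iff_mem]
  constructor
  · rintro ⟨x, hx⟩
    obtain ⟨p, q, v, hr, -⟩ := h.mem_iff.1 hx
    exact ⟨p, p.2, q, q.2, v, hr⟩
  · rintro ⟨p, hp, q, hq, v, hr⟩
    exact ⟨_, h.mem_iff.2 ⟨⟨p, hp⟩, ⟨q, hq⟩, v, hr, rfl⟩⟩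

/-- The subset constructions in both directions are compatible with the transduction of a
functional transducer: the runs on four words can all be chosen through the same middle state. -/
theorem Transducer.Realizes.compat {T : Transducer α} {f : List α →. List α} (h : T.Realizes f) :
    Compat f (Setoid.ker T.reach) (Setoid.ker T.coreach) := by
  refine Compat.of_dom T.isRightCong_reach T.isRightCong_coreach ?_ ?_ ?_
  · intro u v e
    rw [Setoid.ker_def] at e
    have key : ∀ u, (f u).Dom ↔ ∃ q ∈ T.reach u, q ∈ T.aut.accept := by
      intro u
      rw [h.dom_iff]
      constructor
      · rintro ⟨p, hp, q, hq, v, hr⟩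
        exact ⟨q, ⟨p, hp, v, hr⟩, hq⟩
      · rintro ⟨q, ⟨p, hp, v, hr⟩, hq⟩
        exact ⟨p, hp, q, hq, v, hr⟩
    rw [key, key, e]
  · intro u v e
    rw [Setoid.ker_def] at e
    have key : ∀ u : List α, (f u.reverse).Dom ↔ ∃ q ∈ T.coreach u, q ∈ T.aut.start := by
      intro u
      rw [h.dom_iff]
      constructor
      · rintro ⟨p, hp, q, hq, v, hr⟩
        exact ⟨p, ⟨q, hq, v, hr⟩, hp⟩
      · rintro ⟨p, ⟨q, hq, v, hr⟩, hp⟩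
        exact ⟨p, hp, q, hq, v, hr⟩
    rw [key, key, e]
  · intro u v z w e e' x hx x' hx' y hy y' hy'
    rw [Setoid.ker_def] at e e'
    obtain ⟨p, q, t, hr, -⟩ := h.mem_iff.1 hx
    obtain ⟨s, t1, t2, h1, h2, -⟩ := T.run_append_iff.1 hr
    have su : s ∈ T.reach u := ⟨p, p.2, t1, h1⟩
    have sz : s ∈ T.coreach z := ⟨q, q.2, t2, h2⟩
    obtain ⟨pv, hpv, tv, hv⟩ : s ∈ T.reach v := e ▸ su
    obtain ⟨qw, hqw, tw, hw⟩ : s ∈ T.coreach w := e' ▸ sz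
    have key : ∀ {u z : List α} {p q : T.Q} (hp : p ∈ T.aut.start) (hq : q ∈ T.aut.accept)
        {a b x : List α}, T.Run p u a s → T.Run s z.reverse b q → x ∈ f (u ++ z.reverse) →
        x = (T.initOut ⟨p, hp⟩ ++ a) ++ (b ++ T.finalOut ⟨q, hq⟩) := by
      intro u z p q hp hq a b x ha hb hx
      refine Part.mem_unique hx (h.mem_iff.2 ⟨⟨p, hp⟩, ⟨q, hq⟩, a ++ b, ?_, by simp⟩)
      exact T.run_append_iff.2 ⟨s, a, b, ha, hb, rfl⟩
    rw [key p.2 q.2 h1 h2 hx, key p.2 hqw h1 hw hx', key hpv q.2 hv h2 hy, key hpv hqw hv hw hy']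
    exact delay_eq

/-- The transducer of a bimachine. It guesses the run of the right automaton: a state is a pair of
a left state and of the right state that is reached by reading the rest of the word. -/
def Bimachine.toTransducer (B : Bimachine α) : Transducer α where
  Q := B.L × B.R
  finite_Q := by
    have := B.finite_L
    have := B.finite_R
    infer_instance
  aut :=
    { step := fun p a => {q | B.left.step p.1 a = some q.1 ∧ B.right.step q.2 a = some p.2}
      start := {p | p.1 = B.left.start ∧ p.2 ∈ B.right.accept}
      accept := {p | p.1 ∈ B.left.accept ∧ p.2 = B.right.start} }
  out p a q := B.out p.1 a q.1.2
  initOut p := B.lam ⟨p.1.2, p.2.2⟩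
  finalOut p := B.rho ⟨p.1.1, p.2.1⟩

theorem Bimachine.toTransducer_run_iff (B : Bimachine α) {p q : B.toTransducer.Q} {u v : List α} :
    B.toTransducer.Run p u v q ↔ B.left.runFrom p.1 u = some q.1 ∧
      B.right.runFrom q.2 u.reverse = some p.2 ∧ B.outWord p.1 u q.2 = some v := by
  constructor
  · intro h
    induction h with
    | nil p => simp [DetAut.runFrom, Bimachine.outWord]
    | @cons p a s u v r h ih =>
      obtain ⟨h1, h2, h3⟩ := ih
      obtain ⟨s, s1, s2⟩ := s
      refine ⟨?_, ?_, B.outWord_cons s1 h2 h3⟩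
      · simpa [DetAut.runFrom, s1] using h1
      · simpa [DetAut.runFrom_append, DetAut.runFrom, h2] using s2
  · intro h
    induction u generalizing p v with
    | nil =>
      obtain ⟨h1, h2, h3⟩ := h
      simp only [DetAut.runFrom, List.reverse_nil, Option.some.injEq, Bimachine.outWord]
        at h1 h2 h3
      obtain rfl : p = q := Prod.ext h1 h2.symm
      subst h3
      exact Transducer.Run.nil (T := B.toTransducer) p
    | cons a u ih =>
      obtain ⟨h1, h2, h3⟩ := h
      simp only [DetAut.runFrom, List.reverse_cons, DetAut.runFrom_append] at h1 h2
      obtain ⟨l, hl, h1⟩ := Option.bind_eq_some_iff.1 h1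
      obtain ⟨r, hr, h2⟩ := Option.bind_eq_some_iff.1 h2
      obtain ⟨r', hr', h2⟩ := Option.bind_eq_some_iff.1 h2
      obtain rfl := Option.some.inj h2
      simp only [Bimachine.outWord, hl, hr, Option.bind_some] at h3
      obtain ⟨w, hw, rfl⟩ := Option.map_eq_some_iff.1 h3
      exact Transducer.Run.cons (T := B.toTransducer) (p := p) (a := a) ⟨(l, r), hl, hr'⟩
        (ih (p := (l, r)) ⟨h1, hr, hw⟩)

theorem Bimachine.toTransducer_sem (B : Bimachine α) : B.toTransducer.sem = B.sem := by
  ext ⟨u, x⟩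
  constructor
  · rintro ⟨⟨p, hp1, hp2⟩, ⟨q, hq1, hq2⟩, v, hr, hx⟩
    obtain ⟨h1, h2, h3⟩ := B.toTransducer_run_iff.1 hr
    rw [hp1] at h1 h3
    rw [hq2] at h2 h3
    exact ⟨⟨q.1, hq1⟩, ⟨p.2, hp2⟩, v, h1, h2, h3, hx⟩
  · rintro ⟨l, r, v, h1, h2, h3, hx⟩
    exact ⟨⟨(B.left.start, r.1), rfl, r.2⟩, ⟨(l.1, B.right.start), l.2, rfl⟩, v,
      B.toTransducer_run_iff.2 ⟨h1, h2, h3⟩, hx⟩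

end Transducers

/-! ### Finiteness of the set of minimal bimachines -/

section Finiteness

variable {α : Type}

theorem IndexLE.mono_right {K : Setoid (List α)} {m n : ℕ} (h : IndexLE K m) (hmn : m ≤ n) :
    IndexLE K n := by
  obtain ⟨c, hc⟩ := h
  exact ⟨fun u => (c u).castLE hmn, fun u v e => hc u v (Fin.castLE_injective hmn e)⟩

theorem IndexLE.finite_above {J : Setoid (List α)} {m : ℕ} (h : IndexLE J m) :
    {K : Setoid (List α) | J ≤ K}.Finite := by
  have := h.finite_quotient
  have : Finite (Setoid (Quotient J)) :=
    Finite.of_injective (fun s : Setoid (Quotient J) => fun x y => s x y) fun s t e =>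
      Setoid.ext fun x y => by rw [show s x y = t x y from congrFun (congrFun e x) y]
  exact Finite.of_equiv _ (Setoid.correspondence J).symm.toEquiv

theorem Bimachine.equiv_of_runKer_eq {B B' : Bimachine α} {f : List α →. List α}
    (h : B.Realizes f) (h' : B'.Realizes f) (hl : runKer B.left = runKer B'.left)
    (hr : runKer B.right = runKer B'.right) : B.Equiv B' :=
  ⟨⟨hl.le, hr.le⟩, ⟨hl.ge, hr.ge⟩, h.trans h'.symm⟩

/-- The left minimization with respect to the canonical right automaton has finite index. -/
theorem exists_indexLE_leftRel [Finite α] {f : List α →. List α} {K K' : Setoid (List α)}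
    (h : Compat f K K') (hK : IsRightCong K) (hK' : IsRightCong K') {m m' : ℕ}
    (hm : IndexLE K m) (hm' : IndexLE K' m') :
    ∃ n, IndexLE (leftRel f (runKer (canonRight f))) n := by
  let M := max m m'
  have hfin := List.finite_length_lt α (M * M * M)
  exact ⟨_, h.indexLE_leftRel hK hK' (hm.mono_right (le_max_left m m'))
    (hm'.mono_right (le_max_right m m')) hfin.toFinset.toList rfl fun u hu => by simpa using hu⟩

/-- A minimal bimachine is determined, up to equality, by its pair of transition congruences, and
these contain two fixed congruences of finite index. -/
theorem finite_minimal [Finite α] (f : List α →. List α) :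
    {c : Quotient (Bimachine.equivSetoid α) |
      ∃ B : Bimachine α, B.IsMinimal f ∧ Quotient.mk _ B = c}.Finite := by
  by_cases hne : ∃ B : Bimachine α, B.IsMinimal f
  swap
  · refine Set.finite_empty.subset ?_
    rintro _ ⟨B, hB, -⟩
    exact hne ⟨B, hB⟩
  obtain ⟨B₀, hB₀⟩ := hne
  obtain ⟨m, hm⟩ := B₀.exists_indexLE_left
  obtain ⟨m', hm'⟩ := B₀.exists_indexLE_right
  have hc := hB₀.1.compat
  obtain ⟨n, hn⟩ := exists_indexLE_leftRel hc (isRightCong_runKer _) (isRightCong_runKer _) hm hm'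
  obtain ⟨n', hn'⟩ := exists_indexLE_leftRel hc.mirror (isRightCong_runKer _)
    (isRightCong_runKer _) hm' hm
  have key : ∀ (c : Quotient (Bimachine.equivSetoid α)),
      (∃ B : Bimachine α, B.IsMinimal f ∧ Quotient.mk _ B = c) →
      c.out.IsMinimal f := by
    rintro _ ⟨B, hB, rfl⟩
    have e : B.Equiv (Quotient.mk (Bimachine.equivSetoid α) B).out :=
      (Bimachine.equivSetoid α).symm (Quotient.mk_out (s := Bimachine.equivSetoid α) B)
    exact ⟨e.2.2.symm.trans hB.1, fun B' hB' hf => (hB.2 B' hB' (e.1.trans hf)).trans e.1⟩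
  -- `canonLeft f` is by definition `canonRight (mirror f)`, as an automaton
  refine Set.Finite.of_injOn (f := fun c => (runKer c.out.left, runKer c.out.right))
    (t := {K | leftRel f (runKer (canonRight f)) ≤ K} ×ˢ
      {K | leftRel (mirror f) (runKer (canonRight (mirror f))) ≤ K}) ?_ ?_
    (hn.finite_above.prod hn'.finite_above)
  · intro c hc
    exact ⟨(key c hc).leftRel_le, (key c hc).rightRel_le⟩
  · intro c hc d hd e
    rw [Prod.mk.injEq] at e
    rw [← Quotient.out_eq c, ← Quotient.out_eq d]
    exact Quotient.sound (Bimachine.equiv_of_runKer_eq (key c hc).1 (key d hd).1 e.1 e.2)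

theorem minimal_bounds {f : List α →. List α} {B : Bimachine α} (h : B.IsMinimal f) :
    ((minLeft f (canonRight f)).Finer B.left ∧ B.left.Finer (canonLeft f)) ∧
      ((minRight f (canonLeft f)).Finer B.right ∧ B.right.Finer (canonRight f)) := by
  simp only [finer_iff]
  refine ⟨⟨?_, h.1.left_le⟩, ?_, h.1.right_le⟩
  · rw [runKer_minLeft]
    exact h.leftRel_le
  · unfold minRight
    rw [runKer_minLeft]
    exact h.rightRel_le

end Finiteness

/-! ### Primitive recursive functions and predicates -/

section PrimrecComposition
variable {σ β γ δ : Type*} [Primcodable σ] [Primcodable β] [Primcodable γ] [Primcodable δ]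

-- With closure properties in compositional form, `fun_prop` proves that a function or a predicate
-- that is given by a term is primitive recursive.
attribute [fun_prop] Primrec PrimrecPred
attribute [fun_prop] Primrec.id Primrec.const Primrec.comp Primrec.pair

@[fun_prop] theorem primrec_fst {f : σ → β × γ} (hf : Primrec f) : Primrec fun x => (f x).1 :=
  Primrec.fst.comp hf
@[fun_prop] theorem primrec_snd {f : σ → β × γ} (hf : Primrec f) : Primrec fun x => (f x).2 :=
  Primrec.snd.comp hf
@[fun_prop] theorem primrec_add {f g : σ → ℕ} (hf : Primrec f) (hg : Primrec g) :
    Primrec fun x => f x + g x := Primrec.nat_add.comp hf hg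
@[fun_prop] theorem primrec_mul {f g : σ → ℕ} (hf : Primrec f) (hg : Primrec g) :
    Primrec fun x => f x * g x := Primrec.nat_mul.comp hf hg
@[fun_prop] theorem primrec_mod {f g : σ → ℕ} (hf : Primrec f) (hg : Primrec g) :
    Primrec fun x => f x % g x := Primrec.nat_mod.comp hf hg
@[fun_prop] theorem primrec_pow {f g : σ → ℕ} (hf : Primrec f) (hg : Primrec g) :
    Primrec fun x => f x ^ g x := by
  refine (Primrec.nat_rec' hg (Primrec.const 1)
    (h := fun x p => p.2 * f x) (by unfold Primrec₂; fun_prop)).of_eq fun x => ?_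
  induction g x with
  | zero => rfl
  | succ n ih => rw [pow_succ, ← ih]
@[fun_prop] theorem primrec_append {f g : σ → List β} (hf : Primrec f) (hg : Primrec g) :
    Primrec fun x => f x ++ g x := Primrec.list_append.comp hf hg
@[fun_prop] theorem primrec_cons {f : σ → β} {g : σ → List β} (hf : Primrec f) (hg : Primrec g) :
    Primrec fun x => f x :: g x := Primrec.list_cons.comp hf hg
@[fun_prop] theorem primrec_length {f : σ → List β} (hf : Primrec f) :
    Primrec fun x => (f x).length := Primrec.list_length.comp hf
@[fun_prop] theorem primrec_reverse {f : σ → List β} (hf : Primrec f) :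
    Primrec fun x => (f x).reverse := Primrec.list_reverse.comp hf
@[fun_prop] theorem primrec_head? {f : σ → List β} (hf : Primrec f) :
    Primrec fun x => (f x).head? := Primrec.list_head?.comp hf
@[fun_prop] theorem primrec_range {f : σ → ℕ} (hf : Primrec f) :
    Primrec fun x => List.range (f x) := Primrec.list_range.comp hf
@[fun_prop] theorem primrec_take {f : σ → ℕ} {g : σ → List β} (hf : Primrec f) (hg : Primrec g) :
    Primrec fun x => (g x).take (f x) := Primrec.list_take.comp hf hg
@[fun_prop] theorem primrec_drop {f : σ → ℕ} {g : σ → List β} (hf : Primrec f) (hg : Primrec g) :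
    Primrec fun x => (g x).drop (f x) := Primrec.list_drop.comp hf hg
@[fun_prop] theorem primrec_getD {f : σ → List β} {g : σ → ℕ} (d : β) (hf : Primrec f)
    (hg : Primrec g) : Primrec fun x => (f x).getD (g x) d := (Primrec.list_getD d).comp hf hg
@[fun_prop] theorem primrec_optionGetD {f : σ → Option β} {g : σ → β} (hf : Primrec f)
    (hg : Primrec g) : Primrec fun x => (f x).getD (g x) := Primrec.option_getD.comp hf hg
@[fun_prop] theorem primrec_some {f : σ → β} (hf : Primrec f) :
    Primrec fun x => some (f x) := Primrec.option_some.comp hf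
@[fun_prop] theorem primrec_optionMap {f : σ → Option β} {g : σ → β → γ} (hf : Primrec f)
    (hg : Primrec fun p : σ × β => g p.1 p.2) : Primrec fun x => (f x).map (g x) :=
  Primrec.option_map hf hg
@[fun_prop] theorem primrec_map {f : σ → List β} {g : σ → β → γ} (hf : Primrec f)
    (hg : Primrec fun p : σ × β => g p.1 p.2) : Primrec fun x => (f x).map (g x) :=
  Primrec.list_map hf hg
@[fun_prop] theorem primrec_flatMap {f : σ → List β} {g : σ → β → List γ} (hf : Primrec f)
    (hg : Primrec fun p : σ × β => g p.1 p.2) : Primrec fun x => (f x).flatMap (g x) :=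
  Primrec.list_flatMap hf hg
@[fun_prop] theorem primrec_filterMap {f : σ → List β} {g : σ → β → Option γ} (hf : Primrec f)
    (hg : Primrec fun p : σ × β => g p.1 p.2) : Primrec fun x => (f x).filterMap (g x) :=
  Primrec.listFilterMap hf hg
@[fun_prop] theorem primrec_foldl {f : σ → List β} {g : σ → γ} {h : σ → γ → β → γ}
    (hf : Primrec f) (hg : Primrec g) (hh : Primrec fun p : σ × γ × β => h p.1 p.2.1 p.2.2) :
    Primrec fun x => (f x).foldl (h x) (g x) :=
  Primrec.list_foldl (h := fun x p => h x p.1 p.2) hf hg hh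
@[fun_prop] theorem primrec_ite {c : σ → Prop} [DecidablePred c] {f g : σ → β}
    (hc : PrimrecPred c) (hf : Primrec f) (hg : Primrec g) :
    Primrec fun x => if c x then f x else g x := Primrec.ite hc hf hg

@[fun_prop] theorem primrecPred_and {p q : σ → Prop} (hp : PrimrecPred p) (hq : PrimrecPred q) :
    PrimrecPred fun x => p x ∧ q x := hp.and hq
@[fun_prop] theorem primrecPred_not {p : σ → Prop} (hp : PrimrecPred p) :
    PrimrecPred fun x => ¬ p x := hp.not
@[fun_prop] theorem primrecPred_imp {p q : σ → Prop} (hp : PrimrecPred p) (hq : PrimrecPred q) :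
    PrimrecPred fun x => p x → q x := (hp.not.or hq).of_eq fun _ => by tauto
@[fun_prop] theorem primrecPred_iff {p q : σ → Prop} (hp : PrimrecPred p) (hq : PrimrecPred q) :
    PrimrecPred fun x => p x ↔ q x :=
  ((primrecPred_imp hp hq).and (primrecPred_imp hq hp)).of_eq fun _ => by tauto
@[fun_prop] theorem primrecPred_eq {f g : σ → β} (hf : Primrec f) (hg : Primrec g) :
    PrimrecPred fun x => f x = g x := by
  classical
  exact Primrec.eq.comp hf hg
@[fun_prop] theorem primrecPred_lt {f g : σ → ℕ} (hf : Primrec f) (hg : Primrec g) :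
    PrimrecPred fun x => f x < g x := Primrec.nat_lt.comp hf hg
@[fun_prop] theorem primrecPred_ball {L : σ → List β} {p : σ → β → Prop} (hL : Primrec L)
    (hp : PrimrecPred fun x : σ × β => p x.1 x.2) : PrimrecPred fun x => ∀ y ∈ L x, p x y := by
  have h : PrimrecRel fun (y : β) (x : σ) => p x y := hp.comp (Primrec.pair Primrec.snd Primrec.fst)
  exact h.forall_mem_list.comp hL Primrec.id
@[fun_prop] theorem primrecPred_bex {L : σ → List β} {p : σ → β → Prop} (hL : Primrec L)
    (hp : PrimrecPred fun x : σ × β => p x.1 x.2) : PrimrecPred fun x => ∃ y ∈ L x, p x y := by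
  have h : PrimrecRel fun (y : β) (x : σ) => p x y := hp.comp (Primrec.pair Primrec.snd Primrec.fst)
  exact h.exists_mem_list.comp hL Primrec.id

end PrimrecComposition


/-! ### The checks on finite data -/

section Definitions

/-- A step of the automaton with states `0, …, M - 1` and a transition table `t`. -/
def tableStep (M : ℕ) (t : List (List ℕ)) (p a : ℕ) : ℕ := ((t.getD p []).getD a 0) % M

/-- The state that the automaton with transition table `t` reaches from the state `0`. -/
def tableRun (M : ℕ) (t : List (List ℕ)) (u : List ℕ) : ℕ := u.foldl (tableStep M t) 0

/-- The initial states of a transducer code with their outputs. -/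
def codeInit (c : TransducerCode) : List (ℕ × List ℕ) :=
  c.initial.filterMap fun s => if s.1 < c.states then some s else none

/-- The states that are reached by a letter `a` from a list of states with outputs. Entries of the
code with a target out of range are ignored. -/
def codeStep (c : TransducerCode) (X : List (ℕ × List ℕ)) (a : ℕ) : List (ℕ × List ℕ) :=
  X.flatMap fun s => c.trans.filterMap fun t =>
    if t.1 = s.1 ∧ t.2.1 = a ∧ t.2.2.1 < c.states then some (t.2.2.1, s.2 ++ t.2.2.2) else none

/-- The outputs of the accepting runs of a transducer code over a word. -/
def codeOuts (c : TransducerCode) (u : List ℕ) : List (List ℕ) :=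
  (u.foldl (codeStep c) (codeInit c)).flatMap fun s => c.final.filterMap fun t =>
    if t.1 = s.1 then some (s.2 ++ t.2) else none

/-- The value of a functional transducer code, the empty word outside the domain. -/
def codeVal (c : TransducerCode) (u : List ℕ) : List ℕ := (codeOuts c u).head?.getD []

/-- A word is in the domain of a transducer code. -/
def CodeDom (c : TransducerCode) (u : List ℕ) : Prop := ¬ codeOuts c u = []

/-- All lists of length `n` with entries in `X`. -/
def listsOf {β : Type} (X : List β) : ℕ → List (List β)
  | 0 => [[]]
  | n + 1 => X.flatMap fun x => (listsOf X n).map fun l => x :: l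

/-- All words of length at most `N` over the letters `0, …, k - 1`. -/
def wordsUpTo (k N : ℕ) : List (List ℕ) :=
  (List.range (N + 1)).flatMap fun i => listsOf (List.range k) i

/-- All transition tables of automata with `M` states over `k` letters. -/
def tables (k M : ℕ) : List (List (List ℕ)) := listsOf (listsOf (List.range M) k) M

/-- The pairs of words `(x, x')` and `(y, y')` differ by a change of a common prefix. -/
def SameDelay (x x' y y' : List ℕ) : Prop :=
  ∃ i ∈ List.range (x.length + 1), ∃ j ∈ List.range (y.length + 1),
    x.take i = x'.take i ∧ y.take j = y'.take j ∧ x.drop i = y.drop j ∧ x'.drop i = y'.drop j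

/-- A bound on the index of the congruences of the subset construction. -/
def codeIndex (c : TransducerCode) : ℕ := 2 ^ c.states

/-- A bound on the number of states of the automata of minimal bimachines: the one given by
`Compat.indexLE_leftRel` for the subset construction. -/
def codeStates (c : TransducerCode) : ℕ :=
  codeIndex c * (wordsUpTo c.letters (codeIndex c * codeIndex c * codeIndex c)).length ^
    (codeIndex c * codeIndex c)

/-- The length of the words on which the conditions are tested. It is large enough for
`le_of_short`, `Compat.of_short` and `gval_eq_of_short`. -/
def codeLength (c : TransducerCode) : ℕ :=
  codeStates c * codeStates c + 2 * (codeStates c * codeIndex c)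

/-- The words on which the conditions are tested. -/
def codeWords (c : TransducerCode) : List (List ℕ) := wordsUpTo c.letters (codeLength c)

/-- On short words, the transition congruence of the table `t` is contained in that of `t'`. -/
def TableFiner (c : TransducerCode) (t t' : List (List ℕ)) : Prop :=
  ∀ u ∈ codeWords c, ∀ v ∈ codeWords c, tableRun (codeStates c) t u = tableRun (codeStates c) t v →
    tableRun (codeStates c) t' u = tableRun (codeStates c) t' v

/-- The automata of two tables are compatible with a transducer code, on short words. -/
def TableCompat (c : TransducerCode) (t t' : List (List ℕ)) : Prop :=
  (∀ u ∈ codeWords c, ∀ v ∈ codeWords c,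
    tableRun (codeStates c) t u = tableRun (codeStates c) t v → (CodeDom c u ↔ CodeDom c v)) ∧
  (∀ u ∈ codeWords c, ∀ v ∈ codeWords c,
    tableRun (codeStates c) t' u = tableRun (codeStates c) t' v →
      (CodeDom c u.reverse ↔ CodeDom c v.reverse)) ∧
  ∀ u ∈ codeWords c, ∀ v ∈ codeWords c, ∀ z ∈ codeWords c, ∀ w ∈ codeWords c,
    tableRun (codeStates c) t u = tableRun (codeStates c) t v →
    tableRun (codeStates c) t' z = tableRun (codeStates c) t' w →
    SameDelay (codeVal c (u ++ z.reverse)) (codeVal c (u ++ w.reverse))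
      (codeVal c (v ++ z.reverse)) (codeVal c (v ++ w.reverse))

/-- The data of a bimachine: the transition tables of the left and of the right automaton, the
table of the output function, and the tables of the final functions of the right and of the left
automaton, where `none` marks the states that are not final. -/
abbrev BimachineTables : Type :=
  List (List ℕ) × List (List ℕ) × List (List (List (List ℕ))) × List (Option (List ℕ)) ×
    List (Option (List ℕ))

/-- Removal of the numbers that are not letters. -/
def letterFilter (k : ℕ) (w : List ℕ) : List ℕ :=
  w.filterMap fun x => if x < k then some x else none

/-- The transitions of the automaton with a given table. -/
def tableTrans (k M : ℕ) (t : List (List ℕ)) : List (ℕ × ℕ × ℕ) :=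
  (List.range M).flatMap fun p => (List.range k).map fun a => (p, a, tableStep M t p a)

/-- The entries of a table of a final function. -/
def tableFinal (k M : ℕ) (s : List (Option (List ℕ))) : List (ℕ × List ℕ) :=
  (List.range M).filterMap fun r => (s.getD r none).map fun w => (r, letterFilter k w)

/-- The bimachine code with `M` left and right states and the given tables. -/
def BimachineTables.toCode (k M : ℕ) (b : BimachineTables) : BimachineCode where
  letters := k
  leftStates := M
  rightStates := M
  leftStart := 0
  rightStart := 0
  leftTrans := tableTrans k M b.1
  rightTrans := tableTrans k M b.2.1
  out := (List.range M).flatMap fun l => (List.range k).flatMap fun a => (List.range M).map fun r =>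
    (l, a, r, letterFilter k (((b.2.2.1.getD l []).getD a []).getD r []))
  lam := tableFinal k M b.2.2.2.1
  rho := tableFinal k M b.2.2.2.2

/-- A code of the transducer of a bimachine. The state `(l, r)` has the number
`r + c.rightStates * l`; this numbering is injective only on states in range, so entries of the code
that are out of range are dropped. -/
def BimachineCode.toTransducerCode (c : BimachineCode) : TransducerCode where
  letters := c.letters
  states := c.leftStates * c.rightStates
  trans := c.leftTrans.flatMap fun x => c.rightTrans.flatMap fun y => c.out.filterMap fun z =>
    if x.2.1 = y.2.1 ∧ z.1 = x.1 ∧ z.2.1 = x.2.1 ∧ z.2.2.1 = y.1 ∧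
      (x.1 < c.leftStates ∧ x.2.2 < c.leftStates) ∧ y.1 < c.rightStates ∧ y.2.2 < c.rightStates then
      some (y.2.2 + c.rightStates * x.1, x.2.1, y.1 + c.rightStates * x.2.2, z.2.2.2)
    else none
  initial := c.lam.filterMap fun x =>
    if x.1 < c.rightStates then some (x.1 + c.rightStates * c.leftStart, x.2) else none
  final := c.rho.filterMap fun x =>
    if x.1 < c.leftStates then some (c.rightStart + c.rightStates * x.1, x.2) else none

/-- The bimachine with the given tables agrees with a transducer code on short words. -/
def TablesRealize (c : TransducerCode) (b : BimachineTables) : Prop :=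
  ∀ u ∈ codeWords c,
    (¬ b.2.2.2.2.getD (tableRun (codeStates c) b.1 u) none = none ↔ CodeDom c u) ∧
    (¬ b.2.2.2.1.getD (tableRun (codeStates c) b.2.1 u.reverse) none = none ↔ CodeDom c u) ∧
    codeVal (b.toCode c.letters (codeStates c)).toTransducerCode u = codeVal c u

/-- On short words, each of the bimachines in the list `D` agrees with a transducer code and is
maximal among the compatible pairs of automata, each such pair is finer than one of them, and no
two of them have the same transition congruences. -/
def Check (c : TransducerCode) (D : List BimachineTables) : Prop :=
  (∀ b ∈ D, TablesRealize c b) ∧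
  (∀ b ∈ D, ∀ t ∈ tables c.letters (codeStates c), ∀ t' ∈ tables c.letters (codeStates c),
    TableCompat c t t' → TableFiner c b.1 t → TableFiner c b.2.1 t' →
      TableFiner c t b.1 ∧ TableFiner c t' b.2.1) ∧
  (∀ t ∈ tables c.letters (codeStates c), ∀ t' ∈ tables c.letters (codeStates c),
    TableCompat c t t' → ∃ b ∈ D, TableFiner c t b.1 ∧ TableFiner c t' b.2.1) ∧
  ∀ i ∈ List.range D.length, ∀ j ∈ List.range D.length, ¬ i = j →
    ¬ ((TableFiner c (D.getD i ([], [], [], [], [])).1 (D.getD j ([], [], [], [], [])).1 ∧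
        TableFiner c (D.getD j ([], [], [], [], [])).1 (D.getD i ([], [], [], [], [])).1) ∧
      TableFiner c (D.getD i ([], [], [], [], [])).2.1 (D.getD j ([], [], [], [], [])).2.1 ∧
        TableFiner c (D.getD j ([], [], [], [], [])).2.1 (D.getD i ([], [], [], [], [])).2.1)

end Definitions

/-! ### The checks are primitive recursive -/

section PrimrecChecks

variable {σ : Type*} [Primcodable σ] {c : σ → TransducerCode} {b : σ → BimachineCode}

@[fun_prop] theorem TransducerCode.primrec_letters (h : Primrec c) : Primrec fun x =>
    (c x).letters :=
  Primrec.fst.comp (Primrec.of_equiv.comp h)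

@[fun_prop] theorem TransducerCode.primrec_states (h : Primrec c) : Primrec fun x => (c x).states :=
  Primrec.fst.comp (Primrec.snd.comp (Primrec.of_equiv.comp h))

@[fun_prop] theorem TransducerCode.primrec_trans (h : Primrec c) : Primrec fun x => (c x).trans :=
  Primrec.fst.comp (Primrec.snd.comp (Primrec.snd.comp (Primrec.of_equiv.comp h)))

@[fun_prop] theorem TransducerCode.primrec_initial (h : Primrec c) : Primrec fun x =>
    (c x).initial :=
  Primrec.fst.comp (Primrec.snd.comp (Primrec.snd.comp (Primrec.snd.comp
    (Primrec.of_equiv.comp h))))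

@[fun_prop] theorem TransducerCode.primrec_final (h : Primrec c) : Primrec fun x => (c x).final :=
  Primrec.snd.comp (Primrec.snd.comp (Primrec.snd.comp (Primrec.snd.comp
    (Primrec.of_equiv.comp h))))

@[fun_prop] theorem BimachineCode.primrec_letters (h : Primrec b) : Primrec fun x =>
    (b x).letters :=
  Primrec.fst.comp (Primrec.of_equiv.comp h)

@[fun_prop] theorem BimachineCode.primrec_leftStates (h : Primrec b) : Primrec fun x =>
    (b x).leftStates :=
  Primrec.fst.comp (Primrec.snd.comp (Primrec.of_equiv.comp h))

@[fun_prop] theorem BimachineCode.primrec_rightStates (h : Primrec b) : Primrec fun x =>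
    (b x).rightStates :=
  Primrec.fst.comp (Primrec.snd.comp (Primrec.snd.comp (Primrec.of_equiv.comp h)))

@[fun_prop] theorem BimachineCode.primrec_leftStart (h : Primrec b) : Primrec fun x =>
    (b x).leftStart :=
  Primrec.fst.comp (Primrec.snd.comp (Primrec.snd.comp (Primrec.snd.comp
    (Primrec.of_equiv.comp h))))

@[fun_prop] theorem BimachineCode.primrec_rightStart (h : Primrec b) : Primrec fun x =>
    (b x).rightStart :=
  Primrec.fst.comp (Primrec.snd.comp (Primrec.snd.comp (Primrec.snd.comp (Primrec.snd.comp
    (Primrec.of_equiv.comp h)))))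

@[fun_prop] theorem BimachineCode.primrec_leftTrans (h : Primrec b) : Primrec fun x =>
    (b x).leftTrans :=
  Primrec.fst.comp (Primrec.snd.comp (Primrec.snd.comp (Primrec.snd.comp (Primrec.snd.comp
    (Primrec.snd.comp (Primrec.of_equiv.comp h))))))

@[fun_prop] theorem BimachineCode.primrec_rightTrans (h : Primrec b) : Primrec fun x =>
    (b x).rightTrans :=
  Primrec.fst.comp (Primrec.snd.comp (Primrec.snd.comp (Primrec.snd.comp (Primrec.snd.comp
    (Primrec.snd.comp (Primrec.snd.comp (Primrec.of_equiv.comp h)))))))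

@[fun_prop] theorem BimachineCode.primrec_out (h : Primrec b) : Primrec fun x => (b x).out :=
  Primrec.fst.comp (Primrec.snd.comp (Primrec.snd.comp (Primrec.snd.comp (Primrec.snd.comp
    (Primrec.snd.comp (Primrec.snd.comp (Primrec.snd.comp (Primrec.of_equiv.comp h))))))))

@[fun_prop] theorem BimachineCode.primrec_lam (h : Primrec b) : Primrec fun x => (b x).lam :=
  Primrec.fst.comp (Primrec.snd.comp (Primrec.snd.comp (Primrec.snd.comp (Primrec.snd.comp
    (Primrec.snd.comp (Primrec.snd.comp (Primrec.snd.comp (Primrec.snd.comp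
    (Primrec.of_equiv.comp h)))))))))

@[fun_prop] theorem BimachineCode.primrec_rho (h : Primrec b) : Primrec fun x => (b x).rho :=
  Primrec.snd.comp (Primrec.snd.comp (Primrec.snd.comp (Primrec.snd.comp (Primrec.snd.comp
    (Primrec.snd.comp (Primrec.snd.comp (Primrec.snd.comp (Primrec.snd.comp
    (Primrec.of_equiv.comp h)))))))))

@[fun_prop] theorem TransducerCode.primrec_mk {f₁ f₂ : σ → ℕ}
    {f₃ : σ → List (ℕ × ℕ × ℕ × List ℕ)} {f₄ f₅ : σ → List (ℕ × List ℕ)} (h₁ : Primrec f₁)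
    (h₂ : Primrec f₂) (h₃ : Primrec f₃) (h₄ : Primrec f₄) (h₅ : Primrec f₅) :
    Primrec fun x => TransducerCode.mk (f₁ x) (f₂ x) (f₃ x) (f₄ x) (f₅ x) :=
  (Primrec.of_equiv_symm (e := TransducerCode.equivTuple)).comp
    (show Primrec fun x => (f₁ x, f₂ x, f₃ x, f₄ x, f₅ x) by fun_prop)

@[fun_prop] theorem BimachineCode.primrec_mk {f₁ f₂ f₃ f₄ f₅ : σ → ℕ}
    {f₆ f₇ : σ → List (ℕ × ℕ × ℕ)} {f₈ : σ → List (ℕ × ℕ × ℕ × List ℕ)}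
    {f₉ g : σ → List (ℕ × List ℕ)} (h₁ : Primrec f₁) (h₂ : Primrec f₂) (h₃ : Primrec f₃)
    (h₄ : Primrec f₄) (h₅ : Primrec f₅) (h₆ : Primrec f₆) (h₇ : Primrec f₇) (h₈ : Primrec f₈)
    (h₉ : Primrec f₉) (hg : Primrec g) :
    Primrec fun x => BimachineCode.mk (f₁ x) (f₂ x) (f₃ x) (f₄ x) (f₅ x) (f₆ x) (f₇ x) (f₈ x)
      (f₉ x) (g x) :=
  (Primrec.of_equiv_symm (e := BimachineCode.equivTuple)).comp
    (show Primrec fun x => (f₁ x, f₂ x, f₃ x, f₄ x, f₅ x, f₆ x, f₇ x, f₈ x, f₉ x, g x)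
      by fun_prop)

@[fun_prop] theorem primrec_tableStep {M p a : σ → ℕ} {t : σ → List (List ℕ)} (hM : Primrec M)
    (ht : Primrec t) (hp : Primrec p) (ha : Primrec a) :
    Primrec fun x => tableStep (M x) (t x) (p x) (a x) := by
  unfold tableStep
  fun_prop

@[fun_prop] theorem primrec_tableRun {M : σ → ℕ} {t : σ → List (List ℕ)} {u : σ → List ℕ}
    (hM : Primrec M) (ht : Primrec t) (hu : Primrec u) :
    Primrec fun x => tableRun (M x) (t x) (u x) := by
  unfold tableRun
  fun_prop

@[fun_prop] theorem primrec_codeInit (hc : Primrec c) : Primrec fun x => codeInit (c x) := by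
  unfold codeInit
  fun_prop

@[fun_prop] theorem primrec_codeStep {X : σ → List (ℕ × List ℕ)} {a : σ → ℕ} (hc : Primrec c)
    (hX : Primrec X) (ha : Primrec a) : Primrec fun x => codeStep (c x) (X x) (a x) := by
  unfold codeStep
  fun_prop

@[fun_prop] theorem primrec_codeOuts {u : σ → List ℕ} (hc : Primrec c) (hu : Primrec u) :
    Primrec fun x => codeOuts (c x) (u x) := by
  unfold codeOuts
  fun_prop

@[fun_prop] theorem primrec_codeVal {u : σ → List ℕ} (hc : Primrec c) (hu : Primrec u) :
    Primrec fun x => codeVal (c x) (u x) := by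
  unfold codeVal
  fun_prop

@[fun_prop] theorem primrecPred_codeDom {u : σ → List ℕ} (hc : Primrec c) (hu : Primrec u) :
    PrimrecPred fun x => CodeDom (c x) (u x) := by
  unfold CodeDom
  fun_prop

@[fun_prop] theorem primrec_listsOf {β : Type} [Primcodable β] {X : σ → List β} {n : σ → ℕ}
    (hX : Primrec X) (hn : Primrec n) : Primrec fun x => listsOf (X x) (n x) := by
  refine (Primrec.nat_rec' hn (Primrec.const [[]])
    (h := fun x p => (X x).flatMap fun y => p.2.map fun l => y :: l)
    (by unfold Primrec₂; fun_prop)).of_eq fun x => ?_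
  induction n x with
  | zero => rfl
  | succ n ih => simp only [listsOf, ← ih]

@[fun_prop] theorem primrec_wordsUpTo {k N : σ → ℕ} (hk : Primrec k) (hN : Primrec N) :
    Primrec fun x => wordsUpTo (k x) (N x) := by
  unfold wordsUpTo
  fun_prop

@[fun_prop] theorem primrec_tables {k N : σ → ℕ} (hk : Primrec k) (hN : Primrec N) :
    Primrec fun x => tables (k x) (N x) := by
  unfold tables
  fun_prop

@[fun_prop] theorem primrecPred_sameDelay {f₁ f₂ f₃ f₄ : σ → List ℕ} (h₁ : Primrec f₁)
    (h₂ : Primrec f₂) (h₃ : Primrec f₃) (h₄ : Primrec f₄) :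
    PrimrecPred fun x => SameDelay (f₁ x) (f₂ x) (f₃ x) (f₄ x) := by
  unfold SameDelay
  fun_prop

@[fun_prop] theorem primrec_codeIndex (hc : Primrec c) : Primrec fun x => codeIndex (c x) := by
  unfold codeIndex
  fun_prop

@[fun_prop] theorem primrec_codeStates (hc : Primrec c) : Primrec fun x => codeStates (c x) := by
  unfold codeStates
  fun_prop

@[fun_prop] theorem primrec_codeLength (hc : Primrec c) : Primrec fun x => codeLength (c x) := by
  unfold codeLength
  fun_prop

@[fun_prop] theorem primrec_codeWords (hc : Primrec c) : Primrec fun x => codeWords (c x) := by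
  unfold codeWords
  fun_prop

@[fun_prop] theorem primrecPred_tableFiner {t t' : σ → List (List ℕ)} (hc : Primrec c)
    (ht : Primrec t) (ht' : Primrec t') : PrimrecPred fun x => TableFiner (c x) (t x) (t' x) := by
  unfold TableFiner
  fun_prop

@[fun_prop] theorem primrecPred_tableCompat {t t' : σ → List (List ℕ)} (hc : Primrec c)
    (ht : Primrec t) (ht' : Primrec t') : PrimrecPred fun x => TableCompat (c x) (t x) (t' x) := by
  unfold TableCompat
  fun_prop

@[fun_prop] theorem primrec_letterFilter {k : σ → ℕ} {w : σ → List ℕ} (hk : Primrec k)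
    (hw : Primrec w) : Primrec fun x => letterFilter (k x) (w x) := by
  unfold letterFilter
  fun_prop

@[fun_prop] theorem primrec_tableTrans {k M : σ → ℕ} {t : σ → List (List ℕ)} (hk : Primrec k)
    (hM : Primrec M) (ht : Primrec t) : Primrec fun x => tableTrans (k x) (M x) (t x) := by
  unfold tableTrans
  fun_prop

@[fun_prop] theorem primrec_tableFinal {k M : σ → ℕ} {s : σ → List (Option (List ℕ))}
    (hk : Primrec k) (hM : Primrec M) (hs : Primrec s) :
    Primrec fun x => tableFinal (k x) (M x) (s x) := by
  unfold tableFinal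
  fun_prop

@[fun_prop] theorem primrec_toCode {k M : σ → ℕ} {t : σ → BimachineTables} (hk : Primrec k)
    (hM : Primrec M) (ht : Primrec t) : Primrec fun x => (t x).toCode (k x) (M x) := by
  unfold BimachineTables.toCode
  fun_prop

@[fun_prop] theorem primrec_toTransducerCode (hb : Primrec b) :
    Primrec fun x => (b x).toTransducerCode := by
  unfold BimachineCode.toTransducerCode
  fun_prop

@[fun_prop] theorem primrecPred_tablesRealize {t : σ → BimachineTables} (hc : Primrec c)
    (ht : Primrec t) : PrimrecPred fun x => TablesRealize (c x) (t x) := by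
  unfold TablesRealize
  fun_prop

theorem primrecPred_check {D : σ → List BimachineTables} (hc : Primrec c) (hD : Primrec D) :
    PrimrecPred fun x => Check (c x) (D x) := by
  unfold Check
  fun_prop

end PrimrecChecks

/-- A search through all candidates finds a solution of a primitive recursive condition whenever
there is one. -/
theorem exists_partrec_search {σ τ : Type*} [Primcodable σ] [Primcodable τ] {R : σ → τ → Prop}
    (hR : PrimrecPred fun p : σ × τ => R p.1 p.2) :
    ∃ F : σ →. τ, Partrec F ∧ ∀ x, (∃ y, R x y) → ∃ y ∈ F x, R x y := by
  classical
  have h : PrimrecPred fun q : (σ × ℕ) × τ => R q.1.1 q.2 :=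
    hR.comp (f := fun q : (σ × ℕ) × τ => (q.1.1, q.2)) (by fun_prop)
  have hp : Primrec₂ fun (x : σ) (n : ℕ) => (Encodable.decode (α := τ) n).bind fun y =>
      if R x y then some y else none :=
    Primrec.option_bind (Primrec.decode.comp Primrec.snd)
      (Primrec.ite h (Primrec.option_some.comp Primrec.snd) (Primrec.const none))
  refine ⟨_, Partrec.rfindOpt hp.to_comp, fun x ⟨y, hy⟩ => ?_⟩
  have hd := (Nat.rfindOpt_dom (f := fun n => (Encodable.decode (α := τ) n).bind fun y =>
      if R x y then some y else none)).2 ⟨Encodable.encode y, y, by simp [hy]⟩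
  refine ⟨_, Part.get_mem hd, ?_⟩
  obtain ⟨n, hn⟩ := Nat.rfindOpt_spec (Part.get_mem hd)
  obtain ⟨z, -, hz⟩ := Option.bind_eq_some_iff.1 hn
  split_ifs at hz with hRz
  rwa [← Option.some.inj hz]

/-! ### Words of numbers -/

section CodeWords

variable {α : Type} {k : ℕ} (e : α ≃ Fin k)

theorem codeWord_append (u v : List α) : codeWord e (u ++ v) = codeWord e u ++ codeWord e v :=
  List.map_append

theorem codeWord_reverse (u : List α) : codeWord e u.reverse = (codeWord e u).reverse :=
  List.map_reverse

theorem codeWord_length (u : List α) : (codeWord e u).length = u.length := List.length_map _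

theorem codeWord_injective : Function.Injective (codeWord e) :=
  List.map_injective_iff.2 fun _ _ h => e.injective (Fin.val_injective h)

/-- The word that is described by a list of numbers, where numbers that are not letters are
skipped. -/
def decodeWord (w : List ℕ) : List α :=
  w.filterMap fun x => if h : x < k then some (e.symm ⟨x, h⟩) else none

theorem decodeWord_codeWord (u : List α) : decodeWord e (codeWord e u) = u := by
  unfold decodeWord codeWord
  rw [List.filterMap_map]
  refine (List.filterMap_congr (g := some) fun a _ => ?_).trans List.filterMap_some
  simp

theorem codeWord_decodeWord (w : List ℕ) : codeWord e (decodeWord e w) = letterFilter k w := by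
  unfold decodeWord codeWord letterFilter
  rw [List.map_filterMap]
  refine List.filterMap_congr fun x _ => ?_
  by_cases h : x < k <;> simp [h]

theorem letterFilter_codeWord (u : List α) : letterFilter k (codeWord e u) = codeWord e u := by
  rw [← codeWord_decodeWord e, decodeWord_codeWord]

theorem mem_listsOf {β : Type} {X : List β} {n : ℕ} {w : List β} :
    w ∈ listsOf X n ↔ w.length = n ∧ ∀ x ∈ w, x ∈ X := by
  induction n generalizing w with
  | zero =>
    simp only [listsOf, List.mem_singleton, List.length_eq_zero_iff]
    constructor
    · rintro rfl
      simp
    · exact fun h => h.1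
  | succ n ih =>
    simp only [listsOf, List.mem_flatMap, List.mem_map, ih]
    constructor
    · rintro ⟨x, hx, l, ⟨rfl, hl⟩, rfl⟩
      simpa using ⟨hx, hl⟩
    · rintro ⟨h1, h2⟩
      cases w with
      | nil => simp at h1
      | cons x l =>
        refine ⟨x, h2 x (by simp), l, ⟨by simpa using h1, fun y hy => h2 y (by simp [hy])⟩, rfl⟩

theorem forall_mem_wordsUpTo {N : ℕ} {P : List ℕ → Prop} :
    (∀ w ∈ wordsUpTo k N, P w) ↔ ∀ u : List α, u.length ≤ N → P (codeWord e u) := by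
  have key : ∀ w, w ∈ wordsUpTo k N ↔ w.length ≤ N ∧ ∀ x ∈ w, x < k := by
    intro w
    simp only [wordsUpTo, List.mem_flatMap, List.mem_range, mem_listsOf]
    constructor
    · rintro ⟨i, hi, rfl, h⟩
      exact ⟨by omega, h⟩
    · rintro ⟨h1, h2⟩
      exact ⟨_, by omega, rfl, h2⟩
  constructor
  · intro h u hu
    refine h _ ((key _).2 ⟨by rwa [codeWord_length], fun x hx => ?_⟩)
    obtain ⟨a, -, rfl⟩ := List.mem_map.1 hx
    exact (e a).2
  · intro h w hw
    obtain ⟨h1, h2⟩ := (key w).1 hw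
    have hfil : codeWord e (decodeWord e w) = w := by
      rw [codeWord_decodeWord]
      refine (List.filterMap_congr (g := some) fun x hx => ?_).trans List.filterMap_some
      simp [h2 x hx]
    rw [← hfil]
    refine h _ ?_
    rwa [← codeWord_length e, hfil]

/-- `SameDelay` is equality of quotients in the free group. -/
theorem sameDelay_codeWord_iff {x x' y y' : List α} :
    SameDelay (codeWord e x) (codeWord e x') (codeWord e y) (codeWord e y') ↔
      (toGrp x)⁻¹ * toGrp x' = (toGrp y)⁻¹ * toGrp y' := by
  unfold SameDelay
  simp only [codeWord, ← List.map_take, ← List.map_drop]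
  have hinj : ∀ {a b : List α}, (a.map fun a => (e a : ℕ)) = (b.map fun a => (e a : ℕ)) ↔ a = b :=
    fun {a b} => (codeWord_injective e).eq_iff
  simp only [hinj]
  constructor
  · rintro ⟨i, -, j, -, h1, h2, h3, h4⟩
    rw [← List.take_append_drop i x, ← List.take_append_drop i x', ← List.take_append_drop j y,
      ← List.take_append_drop j y', h1, h2, h3, h4]
    exact delay_eq
  · intro h
    obtain ⟨p, q, s, t, rfl, rfl, rfl, rfl, -⟩ := exists_delay h
    exact ⟨p.length, by simp, q.length, by simp, by simp, by simp, by simp, by simp⟩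

end CodeWords

/-! ### The transduction of a transducer code -/

section TransducerCodes

variable {α : Type} {k : ℕ} {e : α ≃ Fin k} {T : Transducer α} {c : TransducerCode}

/-- The computation of the states that are reached, with their outputs, follows the runs. -/
theorem mem_foldl_codeStep {eQ : T.Q ≃ Fin c.states}
    (h : ∀ (p : T.Q) (a : α) (q : T.Q) (w : List ℕ),
      ((eQ p : ℕ), (e a : ℕ), (eQ q : ℕ), w) ∈ c.trans ↔
        ∃ h : q ∈ T.aut.step p a, w = codeWord e (T.out p a ⟨q, h⟩))
    {X : List (ℕ × List ℕ)} (hX : ∀ s ∈ X, s.1 < c.states) {u : List α} {i : ℕ} {w : List ℕ} :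
    (i, w) ∈ (codeWord e u).foldl (codeStep c) X ↔ ∃ (p q : T.Q) (w₀ : List ℕ) (v : List α),
      ((eQ p : ℕ), w₀) ∈ X ∧ T.Run p u v q ∧ i = eQ q ∧ w = w₀ ++ codeWord e v := by
  induction u generalizing X with
  | nil =>
    simp only [codeWord, List.map_nil, List.foldl_nil]
    constructor
    · intro hi
      have hlt := hX _ hi
      exact ⟨eQ.symm ⟨i, hlt⟩, eQ.symm ⟨i, hlt⟩, w, [], by simpa using hi, .nil _, by simp,
        by simp⟩
    · rintro ⟨p, q, w₀, v, h1, h2, rfl, rfl⟩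
      cases h2
      simpa using h1
  | cons a u ih =>
    have hmem : ∀ s : ℕ × List ℕ, s ∈ codeStep c X (e a) ↔ ∃ (p q : T.Q) (w₀ : List ℕ)
        (hq : q ∈ T.aut.step p a), ((eQ p : ℕ), w₀) ∈ X ∧ s.1 = eQ q ∧
          s.2 = w₀ ++ codeWord e (T.out p a ⟨q, hq⟩) := by
      intro s
      simp only [codeStep, List.mem_flatMap, List.mem_filterMap]
      constructor
      · rintro ⟨⟨j, w₀⟩, hj, ⟨j', b, l, w'⟩, ht, hs⟩
        split_ifs at hs with hc
        obtain ⟨rfl, rfl, hl⟩ := hc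
        obtain rfl := Option.some.inj hs
        have hlt := hX _ hj
        simp only at hlt hl
        obtain ⟨hq, hw⟩ := (h (eQ.symm ⟨j', hlt⟩) a (eQ.symm ⟨l, hl⟩) w').1 (by simpa using ht)
        exact ⟨_, _, w₀, hq, by simpa using hj, by simp, by rw [hw]⟩
      · rintro ⟨p, q, w₀, hq, h1, h2, h3⟩
        refine ⟨_, h1, _, (h p a q _).2 ⟨hq, rfl⟩, ?_⟩
        rw [if_pos ⟨rfl, rfl, (eQ q).2⟩]
        exact congrArg some (Prod.ext h2.symm h3.symm)
    have hX' : ∀ s ∈ codeStep c X (e a), s.1 < c.states := by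
      intro s hs
      obtain ⟨p, q, w₀, hq, -, h2, -⟩ := (hmem s).1 hs
      rw [h2]
      exact (eQ q).2
    have hcons : codeWord e (a :: u) = (e a : ℕ) :: codeWord e u := rfl
    rw [hcons, List.foldl_cons, ih hX']
    constructor
    · rintro ⟨s, q, w₁, v, h1, h2, rfl, rfl⟩
      obtain ⟨p, s', w₀, hs, h3, h4, h5⟩ := (hmem _).1 h1
      obtain rfl : s = s' := eQ.injective (Fin.val_injective h4)
      simp only at h5
      subst h5
      refine ⟨p, q, w₀, _, h3, .cons ⟨s, hs⟩ h2, rfl, ?_⟩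
      rw [codeWord_append, List.append_assoc]
    · rintro ⟨p, q, w₀, v, h1, h2, rfl, rfl⟩
      cases h2 with
      | cons s h2 =>
        refine ⟨s.1, q, _, _, (hmem _).2 ⟨p, s.1, w₀, s.2, h1, rfl, rfl⟩, h2, rfl, ?_⟩
        rw [codeWord_append, List.append_assoc]

theorem mem_codeOuts (h : c.Represents e T) {u : List α} {x : List ℕ} :
    x ∈ codeOuts c (codeWord e u) ↔ ∃ y, (u, y) ∈ T.sem ∧ x = codeWord e y := by
  obtain ⟨-, eQ, h1, h2, h3⟩ := h
  have hX : ∀ s ∈ codeInit c, s.1 < c.states := by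
    intro s hs
    obtain ⟨t, -, ht⟩ := List.mem_filterMap.1 hs
    split_ifs at ht with hlt
    rwa [← Option.some.inj ht]
  have hI : ∀ (p : T.Q) w, ((eQ p : ℕ), w) ∈ codeInit c ↔
      ∃ h : p ∈ T.aut.start, w = codeWord e (T.initOut ⟨p, h⟩) := by
    intro p w
    rw [← h2]
    unfold codeInit
    rw [List.mem_filterMap]
    constructor
    · rintro ⟨t, ht, hs⟩
      split_ifs at hs
      rwa [← Option.some.inj hs]
    · intro hp
      exact ⟨_, hp, if_pos (eQ p).2⟩
  simp only [codeOuts, List.mem_flatMap, List.mem_filterMap]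
  constructor
  · rintro ⟨⟨i, w⟩, hi, ⟨j, w'⟩, hj, hx⟩
    split_ifs at hx with hij
    obtain ⟨p, q, w₀, v, hp, hr, rfl, rfl⟩ := (mem_foldl_codeStep h1 hX).1 hi
    simp only at hij
    subst hij
    obtain ⟨hp', rfl⟩ := (hI p w₀).1 hp
    obtain ⟨hq', rfl⟩ := (h3 q w').1 hj
    refine ⟨_, ⟨⟨p, hp'⟩, ⟨q, hq'⟩, v, hr, rfl⟩, ?_⟩
    rw [← Option.some.inj hx, codeWord_append, codeWord_append]
  · rintro ⟨_, ⟨p, q, v, hr, rfl⟩, rfl⟩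
    refine ⟨(eQ q, _), (mem_foldl_codeStep h1 hX).2 ⟨p, q, _, v, (hI p _).2 ⟨p.2, rfl⟩, hr, rfl,
      rfl⟩, (eQ q, _), (h3 q _).2 ⟨q.2, rfl⟩, ?_⟩
    rw [if_pos rfl, codeWord_append, codeWord_append]

theorem codeDom_iff (h : c.Represents e T) {f : List α →. List α} (hT : T.Realizes f)
    {u : List α} : CodeDom c (codeWord e u) ↔ (f u).Dom := by
  unfold CodeDom
  rw [Part.dom_iff_mem, List.eq_nil_iff_forall_not_mem]
  push Not
  constructor
  · rintro ⟨x, hx⟩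
    obtain ⟨y, hy, -⟩ := (mem_codeOuts h).1 hx
    exact ⟨y, hT.mem_iff.2 hy⟩
  · rintro ⟨y, hy⟩
    exact ⟨_, (mem_codeOuts h).2 ⟨y, hT.mem_iff.1 hy, rfl⟩⟩

theorem exists_codeVal (h : c.Represents e T) {f : List α →. List α} (hT : T.Realizes f)
    (u : List α) : ∃ x, codeVal c (codeWord e u) = codeWord e x ∧ gval f u = toGrp x := by
  unfold codeVal
  cases hh : (codeOuts c (codeWord e u)).head? with
  | none =>
    refine ⟨[], rfl, gval_of_not_dom fun hd => ?_⟩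
    rw [← codeDom_iff h hT] at hd
    exact hd (List.head?_eq_none_iff.1 hh)
  | some x =>
    obtain ⟨y, hy, rfl⟩ := (mem_codeOuts h).1 (List.mem_of_mem_head? hh)
    exact ⟨y, rfl, gval_of_mem (hT.mem_iff.2 hy)⟩

end TransducerCodes

/-! ### Automata and bimachines given by tables -/

section Tables

variable {α : Type} {k M : ℕ}

/-- The automaton with a given transition table, as an automaton over the alphabet `α`. It has no
final states, since only its transition congruence matters. -/
def tableAut (e : α ≃ Fin k) (hM : 0 < M) (t : List (List ℕ)) : DetAut α (Fin M) where
  start := ⟨0, hM⟩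
  step p a := some ⟨tableStep M t p (e a), Nat.mod_lt _ hM⟩
  accept := ∅

theorem tableAut_run (e : α ≃ Fin k) (hM : 0 < M) (t : List (List ℕ)) (u : List α) :
    ∃ h : tableRun M t (codeWord e u) < M,
      (tableAut e hM t).run u = some ⟨tableRun M t (codeWord e u), h⟩ := by
  have : ∀ (u : List α) (q : Fin M), ∃ h : (codeWord e u).foldl (tableStep M t) q < M,
      (tableAut e hM t).runFrom q u = some ⟨(codeWord e u).foldl (tableStep M t) q, h⟩ := by
    intro u
    induction u with
    | nil => exact fun q => ⟨q.2, rfl⟩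
    | cons a u ih => exact fun q => ih ⟨tableStep M t q (e a), Nat.mod_lt _ hM⟩
  exact this u ⟨0, hM⟩

theorem runKer_tableAut {e : α ≃ Fin k} {hM : 0 < M} {t : List (List ℕ)} {u v : List α} :
    runKer (tableAut e hM t) u v ↔
      tableRun M t (codeWord e u) = tableRun M t (codeWord e v) := by
  obtain ⟨h1, e1⟩ := tableAut_run e hM t u
  obtain ⟨h2, e2⟩ := tableAut_run e hM t v
  rw [runKer_apply, e1, e2, Option.some.injEq, Fin.mk.injEq]

theorem indexLE_tableAut (e : α ≃ Fin k) (hM : 0 < M) (t : List (List ℕ)) :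
    IndexLE (runKer (tableAut e hM t)) M :=
  ⟨fun u => ⟨_, (tableAut_run e hM t u).1⟩, fun _ _ h => runKer_tableAut.2 (Fin.mk.inj h)⟩

theorem getD_ofFn {β : Type} {n : ℕ} (g : Fin n → β) (i : Fin n) (d : β) :
    (List.ofFn g).getD i d = g i := by
  rw [List.getD_eq_getElem _ _ (by simp)]
  simp

/-- Every right congruence of index at most `M` is the transition congruence of a table. -/
theorem exists_table (e : α ≃ Fin k) (hM : 0 < M) {K : Setoid (List α)} (hK : IsRightCong K)
    (hKM : IndexLE K M) : ∃ t ∈ tables k M, runKer (tableAut e hM t) = K := by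
  classical
  obtain ⟨c, hc⟩ := hKM
  -- number the classes such that the class of the empty word, the initial state, gets number `0`
  let s := Equiv.swap (c (Quotient.mk K []).out) ⟨0, hM⟩
  let j : List α → Fin M := fun u => s (c (Quotient.mk K u).out)
  have hj : ∀ u v, j u = j v ↔ K u v := by
    intro u v
    constructor
    · intro h
      have := Quotient.sound (s := K) (hc _ _ (s.injective h))
      rw [Quotient.out_eq, Quotient.out_eq] at this
      exact Quotient.exact this
    · intro h
      have : Quotient.mk K u = Quotient.mk K v := Quotient.sound h
      simp only [j, this]
  have hj0 : j [] = ⟨0, hM⟩ := Equiv.swap_apply_left _ _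
  let g : Fin M → Fin k → Fin M := fun p a =>
    if h : ∃ u, j u = p then j (h.choose ++ [e.symm a]) else ⟨0, hM⟩
  have hg : ∀ u a, g (j u) (e a) = j (u ++ [a]) := by
    intro u a
    have h : ∃ v, j v = j u := ⟨u, rfl⟩
    simp only [g, dif_pos h, Equiv.symm_apply_apply]
    rw [hj]
    exact hK _ _ _ ((hj _ _).1 h.choose_spec)
  let t : List (List ℕ) := List.ofFn fun p => List.ofFn fun a => (g p a : ℕ)
  have hstep : ∀ (p : Fin M) (a : Fin k), tableStep M t p a = g p a := by
    intro p a
    unfold tableStep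
    rw [getD_ofFn, getD_ofFn, Nat.mod_eq_of_lt (g p a).2]
  have hrun : ∀ u, tableRun M t (codeWord e u) = j u := by
    intro u
    induction u using List.reverseRecOn with
    | nil => rw [hj0]; rfl
    | append_singleton u a ih =>
      rw [codeWord_append]
      unfold tableRun at *
      rw [List.foldl_append, ih]
      exact (hstep _ _).trans (by rw [hg])
  refine ⟨t, ?_, ?_⟩
  · simp only [tables, mem_listsOf, t, List.length_ofFn, List.mem_ofFn, List.mem_range]
    refine ⟨trivial, ?_⟩
    rintro _ ⟨p, rfl⟩
    refine ⟨by simp, ?_⟩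
    intro x hx
    obtain ⟨a, rfl⟩ := (List.mem_ofFn' _ _).1 hx
    exact (g p a).2
  · ext u v
    rw [runKer_tableAut, hrun, hrun, ← hj, Fin.val_inj]

/-- Tables with the right entries describe a bimachine with `M` left and `M` right states. -/
theorem toCode_represents {e : α ≃ Fin k} {b : BimachineTables} {B : Bimachine α}
    (eL : B.L ≃ Fin M) (eR : B.R ≃ Fin M) (hl : (eL B.left.start : ℕ) = 0)
    (hr : (eR B.right.start : ℕ) = 0)
    (hls : ∀ p a q, B.left.step p a = some q ↔ (eL q : ℕ) = tableStep M b.1 (eL p) (e a))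
    (hrs : ∀ p a q, B.right.step p a = some q ↔ (eR q : ℕ) = tableStep M b.2.1 (eR p) (e a))
    (hout : ∀ l a r, letterFilter k (((b.2.2.1.getD (eL l) []).getD (e a) []).getD (eR r) []) =
      codeWord e (B.out l a r))
    (hlam : ∀ r w, (b.2.2.2.1.getD (eR r) none).map (letterFilter k) = some w ↔
      ∃ h : r ∈ B.right.accept, w = codeWord e (B.lam ⟨r, h⟩))
    (hrho : ∀ l w, (b.2.2.2.2.getD (eL l) none).map (letterFilter k) = some w ↔
      ∃ h : l ∈ B.left.accept, w = codeWord e (B.rho ⟨l, h⟩)) :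
    (b.toCode k M).Represents e B := by
  have htrans : ∀ (t : List (List ℕ)) (p : Fin M) (a : Fin k) (q : ℕ),
      ((p : ℕ), (a : ℕ), q) ∈ tableTrans k M t ↔ q = tableStep M t p a := by
    intro t p a q
    simp only [tableTrans, List.mem_flatMap, List.mem_map, List.mem_range, Prod.mk.injEq]
    constructor
    · rintro ⟨p', -, a', -, rfl, rfl, rfl⟩
      rfl
    · rintro rfl
      exact ⟨p, p.2, a, a.2, rfl, rfl, rfl⟩
  have hfinal : ∀ (s : List (Option (List ℕ))) (p : Fin M) (w : List ℕ),
      ((p : ℕ), w) ∈ tableFinal k M s ↔ (s.getD p none).map (letterFilter k) = some w := by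
    intro s p w
    simp only [tableFinal, List.mem_filterMap, List.mem_range, Option.map_eq_some_iff,
      Prod.mk.injEq]
    constructor
    · rintro ⟨p', -, v, h1, rfl, rfl⟩
      exact ⟨v, h1, rfl⟩
    · rintro ⟨v, h1, rfl⟩
      exact ⟨p, p.2, v, h1, rfl, rfl⟩
  refine ⟨rfl, eL, eR, hl.symm, hr.symm, fun p a q => ?_, fun p a q => ?_, fun l a r w => ?_,
    fun r w => ?_, fun l w => ?_⟩
  · rw [hls]
    exact htrans _ _ _ _
  · rw [hrs]
    exact htrans _ _ _ _
  · rw [← hout]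
    simp only [BimachineTables.toCode, List.mem_flatMap, List.mem_map, List.mem_range,
      Prod.mk.injEq]
    constructor
    · rintro ⟨l', -, a', -, r', -, rfl, rfl, rfl, rfl⟩
      rfl
    · rintro rfl
      exact ⟨eL l, (eL l).2, e a, (e a).2, eR r, (eR r).2, rfl, rfl, rfl, rfl⟩
  · rw [← hlam]
    exact hfinal _ _ _
  · rw [← hrho]
    exact hfinal _ _ _

theorem toTransducerCode_represents {e : α ≃ Fin k} {c : BimachineCode} {B : Bimachine α}
    (h : c.Represents e B) : c.toTransducerCode.Represents e B.toTransducer := by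
  obtain ⟨hk, eL, eR, hl, hr, hlt, hrt, hout, hlam, hrho⟩ := h
  let eQ : B.L × B.R ≃ Fin (c.leftStates * c.rightStates) :=
    (Equiv.prodCongr eL eR).trans finProdFinEquiv
  have hinj : ∀ (l : B.L) (r : B.R) (i j : ℕ) (hi : i < c.leftStates) (hj : j < c.rightStates),
      j + c.rightStates * i = (eQ (l, r) : ℕ) → i = eL l ∧ j = eR r := by
    intro l r i j hi hj h
    have : finProdFinEquiv ((⟨i, hi⟩ : Fin c.leftStates), (⟨j, hj⟩ : Fin c.rightStates)) =
        finProdFinEquiv (eL l, eR r) := Fin.val_injective h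
    have := finProdFinEquiv.injective this
    rw [Prod.mk.injEq] at this
    exact ⟨congrArg Fin.val this.1, congrArg Fin.val this.2⟩
  refine ⟨hk, eQ, ?_, ?_, ?_⟩
  · rintro ⟨l, r'⟩ a ⟨l', r⟩ w
    simp only [BimachineCode.toTransducerCode, List.mem_flatMap, List.mem_filterMap]
    constructor
    · rintro ⟨⟨x1, x2, x3⟩, hx, ⟨y1, y2, y3⟩, hy, ⟨z1, z2, z3, z4⟩, hz, hs⟩
      split_ifs at hs with hc
      obtain ⟨h1, h2, h3, h4, ⟨h5, h6⟩, h7, h8⟩ := hc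
      simp only at h1 h2 h3 h4 h5 h6 h7 h8
      have hs := Option.some.inj hs
      simp only [Prod.mk.injEq] at hs
      obtain ⟨s1, s2, s3, s4⟩ := hs
      obtain ⟨i1, i2⟩ := hinj _ _ _ _ h5 h8 s1
      obtain ⟨i3, i4⟩ := hinj _ _ _ _ h6 h7 s3
      subst h1 h2 h3 h4 s2 s4 i1 i2 i3 i4
      refine ⟨⟨(hlt _ _ _).1 hx, (hrt _ _ _).1 hy⟩, ?_⟩
      exact (hout _ _ _ _).1 hz
    · rintro ⟨⟨h1, h2⟩, rfl⟩
      refine ⟨_, (hlt _ _ _).2 h1, _, (hrt _ _ _).2 h2, _, (hout l a r _).2 rfl, ?_⟩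
      rw [if_pos ⟨rfl, rfl, rfl, rfl, ⟨(eL l).2, (eL l').2⟩, (eR r).2, (eR r').2⟩]
      rfl
  · rintro ⟨l, r⟩ w
    simp only [BimachineCode.toTransducerCode, List.mem_filterMap]
    constructor
    · rintro ⟨⟨x1, x2⟩, hx, hs⟩
      split_ifs at hs with hc
      have hs := Option.some.inj hs
      simp only [Prod.mk.injEq] at hs
      rw [hl] at hs
      obtain ⟨i1, i2⟩ := hinj _ _ _ _ (eL _).2 hc hs.1
      obtain rfl : B.left.start = l := eL.injective (Fin.val_injective i1)
      simp only at i2 hs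
      rw [i2, hs.2] at hx
      obtain ⟨h1, h2⟩ := (hlam _ _).1 hx
      exact ⟨⟨rfl, h1⟩, h2⟩
    · rintro ⟨⟨h1, h2⟩, rfl⟩
      simp only at h1 h2
      subst h1
      refine ⟨_, (hlam _ _).2 ⟨h2, rfl⟩, ?_⟩
      rw [if_pos (eR r).2, hl]
      rfl
  · rintro ⟨l, r⟩ w
    simp only [BimachineCode.toTransducerCode, List.mem_filterMap]
    constructor
    · rintro ⟨⟨x1, x2⟩, hx, hs⟩
      split_ifs at hs with hc
      have hs := Option.some.inj hs
      simp only [Prod.mk.injEq] at hs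
      rw [hr] at hs
      obtain ⟨i1, i2⟩ := hinj _ _ _ _ hc (eR _).2 hs.1
      obtain rfl : B.right.start = r := eR.injective (Fin.val_injective i2)
      simp only at i1 hs
      rw [i1, hs.2] at hx
      obtain ⟨h1, h2⟩ := (hrho _ _).1 hx
      exact ⟨⟨h1, rfl⟩, h2⟩
    · rintro ⟨⟨h1, h2⟩, rfl⟩
      simp only at h1 h2
      subst h2
      refine ⟨_, (hrho _ _).2 ⟨h1, rfl⟩, ?_⟩
      rw [if_pos (eL l).2, hr]
      rfl

end Tables

/-! ### Correctness of the checks -/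

section Correctness

variable {α : Type} {k : ℕ} {e : α ≃ Fin k} {T : Transducer α} {c : TransducerCode}
  {f : List α →. List α}

theorem forall_mem_codeWords (h : c.Represents e T) {P : List ℕ → Prop} :
    (∀ w ∈ codeWords c, P w) ↔ ∀ u : List α, u.length ≤ codeLength c → P (codeWord e u) := by
  unfold codeWords
  rw [h.1]
  exact forall_mem_wordsUpTo e

theorem length_wordsUpTo_pos (k N : ℕ) : 0 < (wordsUpTo k N).length := by
  by_contra hcon
  have h0 : wordsUpTo k N = [] := List.length_eq_zero_iff.1 (by omega)
  exact (forall_mem_wordsUpTo (Equiv.refl (Fin k)) (N := N) (P := fun _ => False)).1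
    (by simp [h0]) [] (by simp)

theorem codeIndex_pos (c : TransducerCode) : 0 < codeIndex c := by
  unfold codeIndex
  positivity

theorem codeStates_pos (c : TransducerCode) : 0 < codeStates c :=
  Nat.mul_pos (codeIndex_pos c) (pow_pos (length_wordsUpTo_pos _ _) _)

theorem indexLE_reach (h : c.Represents e T) :
    IndexLE (Setoid.ker T.reach) (codeIndex c) ∧ IndexLE (Setoid.ker T.coreach) (codeIndex c) := by
  obtain ⟨-, eQ, -⟩ := h
  exact ⟨indexLE_ker eQ _, indexLE_ker eQ _⟩

theorem indexLE_codeStates (h : c.Represents e T) {g : List α →. List α} {K K' : Setoid (List α)}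
    (hc : Compat g K K') (hK : IsRightCong K) (hK' : IsRightCong K')
    (hm : IndexLE K (codeIndex c)) (hm' : IndexLE K' (codeIndex c)) :
    IndexLE (leftRel g (runKer (canonRight g))) (codeStates c) := by
  have : Finite α := Finite.of_equiv _ e.symm
  refine hc.indexLE_leftRel hK hK' hm hm'
    ((wordsUpTo c.letters (codeIndex c * codeIndex c * codeIndex c)).map (decodeWord e))
    (by simp) fun u hu => List.mem_map.2 ⟨codeWord e u, ?_, decodeWord_codeWord e u⟩
  rw [h.1]
  exact (forall_mem_wordsUpTo e (P := fun w => w ∈ wordsUpTo k _)).1 (fun _ h => h) u hu.le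

/-- The automata of a minimal bimachine have at most `codeStates c` reachable states. -/
theorem indexLE_of_isMinimal (h : c.Represents e T) (hT : T.Realizes f) {B : Bimachine α}
    (hB : B.IsMinimal f) : IndexLE (runKer B.left) (codeStates c) ∧
      IndexLE (runKer B.right) (codeStates c) := by
  obtain ⟨h1, h2⟩ := indexLE_reach h
  exact ⟨(indexLE_codeStates h hT.compat T.isRightCong_reach T.isRightCong_coreach h1 h2).mono
    hB.leftRel_le, (indexLE_codeStates h hT.compat.mirror T.isRightCong_coreach
      T.isRightCong_reach h2 h1).mono hB.rightRel_le⟩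

/-- The test on short words decides inclusion of transition congruences. -/
theorem tableFiner_iff (h : c.Represents e T) {t t' : List (List ℕ)} :
    TableFiner c t t' ↔ runKer (tableAut e (codeStates_pos c) t) ≤
      runKer (tableAut e (codeStates_pos c) t') := by
  unfold TableFiner
  simp only [forall_mem_codeWords h]
  constructor
  · intro H
    refine le_of_short (isRightCong_runKer _) (isRightCong_runKer _) (indexLE_tableAut e _ t)
      (indexLE_tableAut e _ t') (N := codeLength c) (by unfold codeLength; omega) ?_
    intro u v hu hv huv
    exact runKer_tableAut.2 (H u hu v hv (runKer_tableAut.1 huv))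
  · intro H u _ v _ huv
    exact runKer_tableAut.1 (H (runKer_tableAut.2 huv))

theorem sameDelay_codeVal_iff (h : c.Represents e T) (hT : T.Realizes f) {u v z w : List α} :
    SameDelay (codeVal c (codeWord e u ++ (codeWord e z).reverse))
      (codeVal c (codeWord e u ++ (codeWord e w).reverse))
      (codeVal c (codeWord e v ++ (codeWord e z).reverse))
      (codeVal c (codeWord e v ++ (codeWord e w).reverse)) ↔
    (gval f (u ++ z.reverse))⁻¹ * gval f (u ++ w.reverse) =
      (gval f (v ++ z.reverse))⁻¹ * gval f (v ++ w.reverse) := by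
  choose val h1 h2 using exists_codeVal h hT
  simp only [← codeWord_reverse, ← codeWord_append, h1, h2, sameDelay_codeWord_iff]

/-- The test on short words decides compatibility. -/
theorem tableCompat_iff (h : c.Represents e T) (hT : T.Realizes f) {t t' : List (List ℕ)} :
    TableCompat c t t' ↔ Compat f (runKer (tableAut e (codeStates_pos c) t))
      (runKer (tableAut e (codeStates_pos c) t')) := by
  unfold TableCompat
  simp only [forall_mem_codeWords h]
  simp only [sameDelay_codeVal_iff h hT]
  simp only [← codeWord_reverse, codeDom_iff h hT]
  obtain ⟨hm, hm'⟩ := indexLE_reach h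
  constructor
  · rintro ⟨H1, H2, H3⟩
    refine hT.compat.of_short T.isRightCong_reach T.isRightCong_coreach (isRightCong_runKer _)
      (isRightCong_runKer _) hm hm' (indexLE_tableAut e _ t) (indexLE_tableAut e _ t')
      (N := codeLength c) (by unfold codeLength; omega) ?_ ?_ ?_
    · exact fun u v hu hv huv => H1 u hu v hv (runKer_tableAut.1 huv)
    · exact fun u v hu hv huv => H2 u hu v hv (runKer_tableAut.1 huv)
    · exact fun u v z w hu hv hz hw huv hzw =>
        H3 u hu v hv z hz w hw (runKer_tableAut.1 huv) (runKer_tableAut.1 hzw)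
  · intro H
    exact ⟨fun u _ v _ huv => H.dom_left u v (runKer_tableAut.2 huv),
      fun u _ v _ huv => H.dom_right u v (runKer_tableAut.2 huv),
      fun u _ v _ z _ w _ huv hzw =>
        H.delay u v z w (runKer_tableAut.2 huv) (runKer_tableAut.2 hzw)⟩

/-- Every bimachine realizes some transduction. -/
theorem Bimachine.exists_realizes (B : Bimachine α) : ∃ g : List α →. List α, B.Realizes g := by
  have huniq : ∀ u x y, (u, x) ∈ B.sem → (u, y) ∈ B.sem → x = y := by
    rintro u x y ⟨l, r, w, h1, h2, h3, h4⟩ ⟨l', r', w', h1', h2', h3', h4'⟩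
    simp only at h1 h2 h3 h4 h1' h2' h3' h4'
    obtain rfl : l = l' := Subtype.ext (Option.some.inj (h1.symm.trans h1'))
    obtain rfl : r = r' := Subtype.ext (Option.some.inj (h2.symm.trans h2'))
    obtain rfl : w = w' := Option.some.inj (h3.symm.trans h3')
    rw [h4, h4']
  refine ⟨fun u => ⟨∃ x, (u, x) ∈ B.sem, fun h => h.choose⟩, ?_⟩
  ext ⟨u, x⟩
  constructor
  · intro hx
    exact ⟨⟨x, hx⟩, huniq u _ _ (Exists.choose_spec (p := fun x => (u, x) ∈ B.sem) ⟨x, hx⟩) hx⟩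
  · rintro ⟨hx, hx'⟩
    have e : Exists.choose (p := fun x => (u, x) ∈ B.sem) hx = x := hx'
    exact e ▸ Exists.choose_spec (p := fun x => (u, x) ∈ B.sem) hx

theorem eq_of_gval_eq {f g : List α →. List α} (hd : ∀ u, (f u).Dom ↔ (g u).Dom)
    (hv : ∀ u, gval f u = gval g u) : f = g := by
  funext u
  refine Part.ext' (hd u) fun h1 h2 => ?_
  have := hv u
  rw [gval_of_mem (Part.get_mem h1), gval_of_mem (Part.get_mem h2)] at this
  exact toGrp_injective this

/-- The bimachine over the alphabet `α` with the given tables. -/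
def tablesBimachine {M : ℕ} (e : α ≃ Fin k) (hM : 0 < M) (b : BimachineTables)
    (hl : ∀ u : List α, ¬ b.2.2.2.2.getD (tableRun M b.1 (codeWord e u)) none = none ↔
      ¬ b.2.2.2.1.getD (tableRun M b.2.1 (codeWord e u.reverse)) none = none) :
    Bimachine α where
  L := Fin M
  R := Fin M
  finite_L := inferInstance
  finite_R := inferInstance
  left := (tableAut e hM b.1).withAccept {q | ¬ b.2.2.2.2.getD q none = none}
  right := (tableAut e hM b.2.1).withAccept {q | ¬ b.2.2.2.1.getD q none = none}
  out l a r := decodeWord e (((b.2.2.1.getD l []).getD (e a) []).getD r [])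
  lam r := decodeWord e ((b.2.2.2.1.getD r.1 none).getD [])
  rho l := decodeWord e ((b.2.2.2.2.getD l.1 none).getD [])
  same_language u := by
    obtain ⟨h1, e1⟩ := tableAut_run e hM b.1 u
    obtain ⟨h2, e2⟩ := tableAut_run e hM b.2.1 u.reverse
    unfold DetAut.Accepts
    simp only [DetAut.run_withAccept, e1, e2, Option.some.injEq]
    simpa [DetAut.withAccept] using hl u

theorem tablesBimachine_represents {M : ℕ} (e : α ≃ Fin k) (hM : 0 < M) (b : BimachineTables)
    (hl : ∀ u : List α, ¬ b.2.2.2.2.getD (tableRun M b.1 (codeWord e u)) none = none ↔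
      ¬ b.2.2.2.1.getD (tableRun M b.2.1 (codeWord e u.reverse)) none = none) :
    (b.toCode k M).Represents e (tablesBimachine e hM b hl) := by
  have hstep : ∀ (t : List (List ℕ)) (p q : Fin M) (a : α),
      (tableAut e hM t).step p a = some q ↔ (q : ℕ) = tableStep M t p (e a) := by
    intro t p q a
    simp only [tableAut, Option.some.injEq, Fin.ext_iff]
    exact eq_comm
  have hfin : ∀ (o : Option (List ℕ)) (w : List ℕ), o.map (letterFilter k) = some w ↔
      ∃ _ : ¬ o = none, w = codeWord e (decodeWord e (o.getD [])) := by
    intro o w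
    cases o with
    | none => simp
    | some v => simp [codeWord_decodeWord, eq_comm]
  exact toCode_represents (Equiv.refl _) (Equiv.refl _) rfl rfl (fun p a q => hstep _ _ _ _)
    (fun p a q => hstep _ _ _ _) (fun l a r => (codeWord_decodeWord e _).symm)
    (fun r w => hfin _ _) (fun l w => hfin _ _)

/-- Tables that agree with a transducer code on short words describe a bimachine that realizes the
same transduction. -/
theorem TablesRealize.exists_bimachine (h : c.Represents e T) (hT : T.Realizes f)
    {b : BimachineTables} (hb : TablesRealize c b) :
    ∃ B : Bimachine α, (b.toCode c.letters (codeStates c)).Represents e B ∧ B.Realizes f ∧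
      runKer B.left = runKer (tableAut e (codeStates_pos c) b.1) ∧
      runKer B.right = runKer (tableAut e (codeStates_pos c) b.2.1) := by
  have hM := codeStates_pos c
  unfold TablesRealize at hb
  rw [forall_mem_codeWords h] at hb
  simp only [← codeWord_reverse, codeDom_iff h hT] at hb
  obtain ⟨hm, hm'⟩ := indexLE_reach h
  have hc0 := hT.compat
  -- short words represent the classes of the intersection with the subset construction
  have hml := (indexLE_tableAut e hM b.1).inf hm
  have hmr := (indexLE_tableAut e hM b.2.1).inf hm'
  have hcl := (isRightCong_runKer (tableAut e hM b.1)).inf T.isRightCong_reach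
  have hcr := (isRightCong_runKer (tableAut e hM b.2.1)).inf T.isRightCong_coreach
  have hN : 2 * (codeStates c * codeIndex c) ≤ codeLength c := by unfold codeLength; omega
  have hleft : ∀ u : List α,
      ¬ b.2.2.2.2.getD (tableRun (codeStates c) b.1 (codeWord e u)) none = none ↔ (f u).Dom := by
    intro u
    obtain ⟨u', hu, h1, h2⟩ := exists_short hcl hml u
    rw [runKer_tableAut.1 h1, hc0.dom_left u u' h2]
    exact (hb u' (by omega)).1
  have hright : ∀ u : List α, ¬ b.2.2.2.1.getD (tableRun (codeStates c) b.2.1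
      (codeWord e u.reverse)) none = none ↔ (f u).Dom := by
    intro u
    obtain ⟨u', hu, h1, h2⟩ := exists_short hcr hmr u.reverse
    rw [runKer_tableAut.1 h1]
    have h3 := hc0.dom_right _ _ h2
    rw [List.reverse_reverse] at h3
    rw [h3]
    have h4 := (hb u'.reverse (by simp; omega)).2.1
    rwa [List.reverse_reverse] at h4
  have hlang := fun u => (hleft u).trans (hright u).symm
  let B := tablesBimachine e hM b hlang
  have hrep : (b.toCode c.letters (codeStates c)).Represents e B := by
    rw [h.1]
    exact tablesBimachine_represents e hM b hlang
  have hkl : runKer B.left = runKer (tableAut e hM b.1) := runKer_withAccept _ _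
  have hkr : runKer B.right = runKer (tableAut e hM b.2.1) := runKer_withAccept _ _
  obtain ⟨g, hg⟩ := B.exists_realizes
  have hgT : B.toTransducer.Realizes g := B.toTransducer_sem.trans hg
  have hdom : ∀ u, (g u).Dom ↔ (f u).Dom := by
    intro u
    rw [hg.dom_iff_left, ← hleft u]
    obtain ⟨h1, e1⟩ := tableAut_run e hM b.1 u
    have e2 : B.left.run u = some ⟨_, h1⟩ := (DetAut.run_withAccept _ _ _).trans e1
    constructor
    · rintro ⟨q, hq, hq'⟩
      obtain rfl := Option.some.inj (hq'.symm.trans e2)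
      exact hq
    · intro hq
      exact ⟨_, hq, e2⟩
  have hcg := hg.compat
  rw [hkl, hkr] at hcg
  have hval := gval_eq_of_short (hcg.mono inf_le_left inf_le_left)
    (hc0.mono inf_le_right inf_le_right) hcl hcr hml hmr hN (fun u hu => by
      obtain ⟨x, hx, hx'⟩ := exists_codeVal (toTransducerCode_represents hrep) hgT u
      obtain ⟨y, hy, hy'⟩ := exists_codeVal h hT u
      rw [hx', hy', codeWord_injective e (hx.symm.trans ((hb u hu).2.2.trans hy))])
  obtain rfl := eq_of_gval_eq hdom hval
  exact ⟨B, hrep, hg, hkl, hkr⟩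

open Classical in
/-- On two tables that are compatible with `f` there is a bimachine that realizes `f`. -/
theorem exists_tablesRealize (h : c.Represents e T) (hT : T.Realizes f) {t t' : List (List ℕ)}
    (hc : Compat f (runKer (tableAut e (codeStates_pos c) t))
      (runKer (tableAut e (codeStates_pos c) t'))) :
    ∃ b : BimachineTables, b.1 = t ∧ b.2.1 = t' ∧ TablesRealize c b := by
  have hM := codeStates_pos c
  have hruns : ∀ u, (f u).Dom → (tableAut e hM t).run u ≠ none ∧
      (tableAut e hM t').run u.reverse ≠ none := by
    intro u _
    obtain ⟨_, e1⟩ := tableAut_run e hM t u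
    obtain ⟨_, e2⟩ := tableAut_run e hM t' u.reverse
    simp [e1, e2]
  let B := compatBimachine f _ _ hc hruns
  have hB : B.Realizes f := compatBimachine_realizes hc hruns
  let lam : Fin (codeStates c) → Option (List ℕ) := fun r =>
    if hr : r ∈ B.right.accept then some (codeWord e (B.lam ⟨r, hr⟩)) else none
  let rho : Fin (codeStates c) → Option (List ℕ) := fun r =>
    if hr : r ∈ B.left.accept then some (codeWord e (B.rho ⟨r, hr⟩)) else none
  let b : BimachineTables := (t, t', List.ofFn fun l => List.ofFn fun a : Fin k =>
    List.ofFn fun r => codeWord e (B.out l (e.symm a) r), List.ofFn lam, List.ofFn rho)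
  refine ⟨b, rfl, rfl, ?_⟩
  have hstep : ∀ (t : List (List ℕ)) (p q : Fin (codeStates c)) (a : α),
      (tableAut e hM t).step p a = some q ↔ (q : ℕ) = tableStep (codeStates c) t p (e a) := by
    intro t p q a
    simp only [tableAut, Option.some.injEq, Fin.ext_iff]
    exact eq_comm
  have hfin : ∀ (S : Set (Fin (codeStates c))) (g : S → List α) (r : Fin (codeStates c))
      (w : List ℕ), (if hr : r ∈ S then some (codeWord e (g ⟨r, hr⟩)) else none).map
        (letterFilter k) = some w ↔ ∃ hr : r ∈ S, w = codeWord e (g ⟨r, hr⟩) := by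
    intro S g r w
    by_cases hr : r ∈ S
    · simp [hr, letterFilter_codeWord, eq_comm]
    · simp [hr]
  have hrep : (b.toCode k (codeStates c)).Represents e B := by
    refine toCode_represents (Equiv.refl _) (Equiv.refl _) rfl rfl (fun p a q => hstep _ _ _ _)
      (fun p a q => hstep _ _ _ _) (fun l a r => ?_) (fun r w => ?_) (fun l w => ?_)
    · refine Eq.trans ?_ (letterFilter_codeWord e _)
      congr 1
      refine (congrArg (fun x => (List.getD (List.getD x _ _) _ _)) (getD_ofFn _ l [])).trans ?_
      refine (congrArg (fun x => List.getD x _ _) (getD_ofFn _ (e a) [])).trans ?_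
      refine (getD_ofFn _ r []).trans ?_
      rw [Equiv.symm_apply_apply]
    · exact (congrArg (fun o => Option.map (letterFilter k) o = some w)
        (getD_ofFn lam r none)).to_iff.trans (hfin _ _ _ _)
    · exact (congrArg (fun o => Option.map (letterFilter k) o = some w)
        (getD_ofFn rho l none)).to_iff.trans (hfin _ _ _ _)
  have hrepT := toTransducerCode_represents hrep
  have hTB : B.toTransducer.Realizes f := B.toTransducer_sem.trans hB
  unfold TablesRealize
  rw [forall_mem_codeWords h]
  intro u hu
  rw [h.1, ← codeWord_reverse, codeDom_iff h hT]
  obtain ⟨h1, e1⟩ := tableAut_run e hM t u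
  obtain ⟨h2, e2⟩ := tableAut_run e hM t' u.reverse
  refine ⟨?_, ?_, ?_⟩
  · have e1' : B.left.run u = some ⟨_, h1⟩ := (DetAut.run_withAccept _ _ _).trans e1
    rw [show b.2.2.2.2.getD (tableRun (codeStates c) t (codeWord e u)) none = rho ⟨_, h1⟩ from
      getD_ofFn rho ⟨_, h1⟩ none, hB.dom_iff_left]
    constructor
    · intro hq
      by_contra hcon
      exact hq (dif_neg fun hq => hcon ⟨_, hq, e1'⟩)
    · rintro ⟨q, hq, hq'⟩
      obtain rfl := Option.some.inj (hq'.symm.trans e1')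
      exact fun hn => Option.some_ne_none _ ((dif_pos hq).symm.trans hn)
  · have e2' : B.right.run u.reverse = some ⟨_, h2⟩ := (DetAut.run_withAccept _ _ _).trans e2
    rw [show b.2.2.2.1.getD (tableRun (codeStates c) t' (codeWord e u.reverse)) none =
      lam ⟨_, h2⟩ from getD_ofFn lam ⟨_, h2⟩ none, hB.dom_iff_right]
    constructor
    · intro hq
      by_contra hcon
      exact hq (dif_neg fun hq => hcon ⟨_, hq, e2'⟩)
    · rintro ⟨q, hq, hq'⟩
      obtain rfl := Option.some.inj (hq'.symm.trans e2')
      exact fun hn => Option.some_ne_none _ ((dif_pos hq).symm.trans hn)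
  · obtain ⟨x, hx, hx'⟩ := exists_codeVal hrepT hTB u
    obtain ⟨y, hy, hy'⟩ := exists_codeVal h hT u
    rw [hx, hy, toGrp_injective (hx'.symm.trans hy')]

end Correctness

/-! ### Lists of representatives -/

section Representatives

variable {α : Type} {k : ℕ} {e : α ≃ Fin k} {T : Transducer α} {c : TransducerCode}
  {f : List α →. List α}

/-- Tables exhaust the pairs of right congruences of the relevant index. -/
theorem exists_tables (h : c.Represents e T) {K K' : Setoid (List α)}
    (hK : IsRightCong K) (hK' : IsRightCong K') (hm : IndexLE K (codeStates c))
    (hm' : IndexLE K' (codeStates c)) :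
    ∃ t ∈ tables c.letters (codeStates c), ∃ t' ∈ tables c.letters (codeStates c),
      runKer (tableAut e (codeStates_pos c) t) = K ∧
        runKer (tableAut e (codeStates_pos c) t') = K' := by
  rw [h.1]
  obtain ⟨t, ht, e1⟩ := exists_table e (codeStates_pos c) hK hm
  obtain ⟨t', ht', e2⟩ := exists_table e (codeStates_pos c) hK' hm'
  exact ⟨t, ht, t', ht', e1, e2⟩

/-- A list that passes the check is a list of representatives. The check compares a bimachine of the
list only with automata of at most `codeStates c` states, but this covers everything coarser than
that bimachine, and all minimal bimachines by `indexLE_of_isMinimal`. -/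
theorem Check.describesRepresentatives (h : c.Represents e T) (hT : T.Realizes f)
    {D : List BimachineTables} (hD : Check c D) :
    DescribesRepresentatives e f (D.map fun b => b.toCode c.letters (codeStates c)) := by
  obtain ⟨h1, h2, h3, h4⟩ := hD
  simp only [tableFiner_iff h, tableCompat_iff h hT] at h2 h3 h4
  obtain ⟨hi, hi'⟩ := indexLE_reach h
  obtain ⟨B₀, -⟩ := hT.compat.exists_bimachine T.isRightCong_reach T.isRightCong_coreach hi hi'
  have : Nonempty (Bimachine α) := ⟨B₀⟩
  -- bimachines of the listed tables
  choose! g hg1 hg2 hg3 hg4 using fun b (hb : b ∈ D) => (h1 b hb).exists_bimachine h hT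
  have hgmin : ∀ b ∈ D, (g b).IsMinimal f := by
    refine fun b hb => ⟨hg2 b hb, fun B' hB' hle => ?_⟩
    obtain ⟨hl, hr⟩ := hle
    rw [finer_iff, hg3 b hb] at hl
    rw [finer_iff, hg4 b hb] at hr
    obtain ⟨t, ht, t', ht', e1, e2⟩ := exists_tables h (isRightCong_runKer B'.left)
      (isRightCong_runKer B'.right) ((indexLE_tableAut e _ _).mono hl)
      ((indexLE_tableAut e _ _).mono hr)
    have := h2 b hb t ht t' ht' (e1 ▸ e2 ▸ hB'.compat) (e1 ▸ hl) (e2 ▸ hr)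
    rw [e1, e2, ← hg3 b hb, ← hg4 b hb] at this
    exact this
  refine ⟨D.map g, ?_, ?_, ?_, ?_⟩
  · rw [List.forall₂_map_left_iff, List.forall₂_map_right_iff, List.forall₂_same]
    exact hg1
  · intro B hB
    obtain ⟨b, hb, rfl⟩ := List.mem_map.1 hB
    exact hgmin b hb
  · intro B hB
    obtain ⟨hl, hr⟩ := indexLE_of_isMinimal h hT hB
    obtain ⟨t, ht, t', ht', e1, e2⟩ := exists_tables h (isRightCong_runKer B.left)
      (isRightCong_runKer B.right) hl hr
    obtain ⟨b, hb, hbl, hbr⟩ := h3 t ht t' ht' (e1 ▸ e2 ▸ hB.1.compat)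
    rw [e1, ← hg3 b hb] at hbl
    rw [e2, ← hg4 b hb] at hbr
    exact ⟨g b, List.mem_map_of_mem hb, ⟨hbl, hbr⟩, hB.2 _ (hg2 b hb) ⟨hbl, hbr⟩,
      hB.1.trans (hg2 b hb).symm⟩
  · rw [List.pairwise_map, List.pairwise_iff_getElem]
    intro i j hi hj hij hE
    refine h4 i (List.mem_range.2 hi) j (List.mem_range.2 hj) hij.ne ?_
    rw [List.getD_eq_getElem _ _ hi, List.getD_eq_getElem _ _ hj,
      ← hg3 _ (List.getElem_mem hi), ← hg3 _ (List.getElem_mem hj),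
      ← hg4 _ (List.getElem_mem hi), ← hg4 _ (List.getElem_mem hj)]
    exact ⟨⟨hE.1.1, hE.2.1.1⟩, hE.1.2, hE.2.1.2⟩

/-- Some list passes the check: one bimachine for each maximal element of the finite set of
compatible pairs of congruences of index at most `codeStates c`. -/
theorem exists_check (h : c.Represents e T) (hT : T.Realizes f) : ∃ D, Check c D := by
  classical
  let ker : List (List ℕ) → Setoid (List α) := fun t => runKer (tableAut e (codeStates_pos c) t)
  let X : Set (List (List ℕ)) := {t | t ∈ tables c.letters (codeStates c)}
  have hX : X.Finite := List.finite_toSet _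
  let C : Set (Setoid (List α) × Setoid (List α)) :=
    ((fun p : List (List ℕ) × List (List ℕ) => (ker p.1, ker p.2)) '' (X ×ˢ X)) ∩
      {p | Compat f p.1 p.2}
  have hC : C.Finite := ((hX.prod hX).image _).inter_of_left _
  have hS : {p | Maximal (· ∈ C) p}.Finite := hC.subset fun p hp => hp.1
  have hb : ∀ p ∈ C, ∃ b : BimachineTables, (ker b.1, ker b.2.1) = p ∧ TablesRealize c b := by
    rintro _ ⟨⟨⟨t, t'⟩, -, rfl⟩, hc⟩
    obtain ⟨b, rfl, rfl, hb⟩ := exists_tablesRealize h hT hc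
    exact ⟨b, rfl, hb⟩
  choose! b hb1 hb2 using hb
  let S := hS.toFinset.toList
  have hmem : ∀ {p}, p ∈ S ↔ Maximal (· ∈ C) p := by simp [S]
  have hSC : ∀ {p}, p ∈ S → p ∈ C := fun hp => (hmem.1 hp).1
  have hmax : ∀ t ∈ X, ∀ t' ∈ X, Compat f (ker t) (ker t') → (ker t, ker t') ∈ C :=
    fun t ht t' ht' hc => ⟨⟨(t, t'), ⟨ht, ht'⟩, rfl⟩, hc⟩
  refine ⟨S.map b, ?_⟩
  unfold Check
  simp only [tableFiner_iff h, tableCompat_iff h hT, List.forall_mem_map]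
  refine ⟨fun p hp => hb2 p (hSC hp), ?_, ?_, ?_⟩
  · intro p hp t ht t' ht' hc hl hr
    have e1 := hb1 p (hSC hp)
    have hle : p ≤ (ker t, ker t') := by
      rw [← e1]
      exact ⟨hl, hr⟩
    have := (hmem.1 hp).2 (hmax t ht t' ht' hc) hle
    rw [← e1] at this
    exact this
  · intro t ht t' ht' hc
    obtain ⟨p, hle, hp⟩ := hC.exists_le_maximal (hmax t ht t' ht' hc)
    refine ⟨b p, List.mem_map_of_mem (hmem.2 hp), ?_⟩
    rw [← hb1 p hp.1] at hle
    exact hle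
  · intro i hi j hj hij
    rw [List.mem_range] at hi hj
    rw [List.getD_eq_getElem _ _ hi, List.getD_eq_getElem _ _ hj, List.getElem_map,
      List.getElem_map]
    rintro ⟨⟨h1, h2⟩, h3, h4⟩
    rw [List.length_map] at hi hj
    have e1 := hb1 _ (hSC (List.getElem_mem hi))
    have e2 := hb1 _ (hSC (List.getElem_mem hj))
    have : S[i] = S[j] := by
      rw [← e1, ← e2]
      exact Prod.ext (le_antisymm h1 h2) (le_antisymm h3 h4)
    exact hij ((Finset.nodup_toList _).getElem_inj_iff.1 this)

end Representatives

/-! ### The algorithms -/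

/-- The algorithm for transducers searches for a list that passes the check. -/
theorem exists_partrec_transducer : ∃ F : TransducerCode →. List BimachineCode, Partrec F ∧
    ∀ (α : Type) (k : ℕ) (e : α ≃ Fin k) (f : List α →. List α) (T : Transducer α)
      (c : TransducerCode), T.Realizes f → c.Represents e T →
        ∃ D ∈ F c, DescribesRepresentatives e f D := by
  obtain ⟨F, hF, hF'⟩ := exists_partrec_search (R := Check)
    (primrecPred_check Primrec.fst Primrec.snd)
  have hmap : Primrec₂ fun (c : TransducerCode) (D : List BimachineTables) =>
      D.map fun b => b.toCode c.letters (codeStates c) := by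
    unfold Primrec₂
    fun_prop
  refine ⟨_, hF.map hmap.to_comp, fun α k e f T c hT h => ?_⟩
  obtain ⟨D, hD, hD'⟩ := hF' c (exists_check h hT)
  exact ⟨_, Part.mem_map _ hD, hD'.describesRepresentatives h hT⟩

/-- The algorithm for bimachines converts the bimachine to a transducer. -/
theorem exists_partrec_bimachine : ∃ G : BimachineCode →. List BimachineCode, Partrec G ∧
    ∀ (α : Type) (k : ℕ) (e : α ≃ Fin k) (f : List α →. List α) (B : Bimachine α)
      (c : BimachineCode), B.Realizes f → c.Represents e B →
        ∃ D ∈ G c, DescribesRepresentatives e f D := by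
  obtain ⟨F, hF, hF'⟩ := exists_partrec_transducer
  have hcode : Primrec BimachineCode.toTransducerCode := primrec_toTransducerCode Primrec.id
  exact ⟨_, hF.comp hcode.to_comp, fun α k e f B c hB h => hF' α k e f B.toTransducer _
    (B.toTransducer_sem.trans hB) (toTransducerCode_represents h)⟩

end RatTrans

theorem mainTheorem2 :
    (∀ (α : Type) [Finite α] (f : List α →. List α),
      {c : Quotient (Bimachine.equivSetoid α) |
        ∃ B : Bimachine α, B.IsMinimal f ∧ Quotient.mk _ B = c}.Finite ∧
      ∀ B : Bimachine α, B.IsMinimal f →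
        ((minLeft f (canonRight f)).Finer B.left ∧ B.left.Finer (canonLeft f)) ∧
        ((minRight f (canonLeft f)).Finer B.right ∧ B.right.Finer (canonRight f))) ∧
    (∃ F : TransducerCode →. List BimachineCode, Partrec F ∧
      ∀ (α : Type) (k : ℕ) (e : α ≃ Fin k) (f : List α →. List α) (T : Transducer α)
        (c : TransducerCode), T.Realizes f → c.Represents e T →
          ∃ D ∈ F c, DescribesRepresentatives e f D) ∧
    (∃ G : BimachineCode →. List BimachineCode, Partrec G ∧
      ∀ (α : Type) (k : ℕ) (e : α ≃ Fin k) (f : List α →. List α) (B : Bimachine α)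
        (c : BimachineCode), B.Realizes f → c.Represents e B →
          ∃ D ∈ G c, DescribesRepresentatives e f D) :=
  ⟨fun _ _ f => ⟨finite_minimal f, fun _ h => minimal_bounds h⟩, exists_partrec_transducer,
    exists_partrec_bimachine⟩
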